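/- Let $n\ge 4$ and $m\in\mathbb N$. **Notation.** Let $F_n$ be the free group of rank $n$, $\Phi_n=F_n/F_n''$ the free metabelian group with its standard generators $\bar x_1,\dots,\bar x_n$, and $IA(\Phi_n)=\ker\big(\mathrm{Aut}(\Phi_n)\to \mathrm{Aut}(\Phi_n/\Phi_n')\big)$. Put $IA_n^m=\langle \alpha^m \mid \alpha\in IA(\Phi_n)\rangle$. For a group $K$ let $K^m$ be the subgroup generated by the $m$-th powers of its elements; put $M_{n,m}=(\Phi_n'\Phi_n^m)'(\Phi_n'\Phi_n^m)^m$ and $IG_{n,m}=\ker\big(IA(\Phi_n)\to \mathrm{Aut}(\Phi_n/M_{n,m})\big)$ (a principal congruence subgroup). Let $R_n=\mathbb Z[\mathbb Z^n]=\mathbb Z[x_1^{\pm1},\dots,x_n^{\pm1}]$, $\sigma_i=x_i-1$, $\vec\sigma=(\sigma_1,\dots,\sigma_n)^T$, and let $H_{n,m}=\sum_{i=1}^n(x_i^m-1)R_n+mR_n$. The Magnus embedding identifies $\Phi_n$ with a group of matrices $\begin{pmatrix} g & a_1t_1+\dots+a_nt_n\\ 0&1\end{pmatrix}$, where $g\in\mathbb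 Z^n$, $a_i\in R_n$ and $t_1,\dots,t_n$ is a basis of a free $R_n$-module, through $\bar x_i\mapsto\begin{pmatrix} x_i & t_i\\ 0&1\end{pmatrix}$. An automorphism $\alpha\in IA(\Phi_n)$ is identified with the matrix $(a_{i,j})\in GL_n(R_n)$ for which $\alpha(\bar x_i)$ corresponds to $\begin{pmatrix} x_i & a_{i,1}t_1+\dots+a_{i,n}t_n\\ 0&1\end{pmatrix}$; in this way $IA(\Phi_n)$ is viewed as the group of matrices $A\in GL_n(R_n)$ with $A\vec\sigma=\vec\sigma$, and $IA_n^m$ and $IG_{n,m}$ are viewed as groups of matrices. For a commutative ring $R$ and an ideal $I$ let $GL_d(R,I)=\ker(GL_d(R)\to GL_d(R/I))$ and $SL_d(R,I)=\ker(SL_d(R)\to SL_d(R/I))$. For $1\le i\le n$ let $IGL_{n-1,i}$ be the set of matrices in $IA(\Phi_n)$ whose $i$-th row is the $i$-th row of the identity matrix and for which the $(n-1)\times(n-1)$ matrix obtained by erasing the $i$-th row and the $i$-th column belongs to $GL_{n-1}(R_n,\sigma_iR_n)$. For an ideal $I$ of $R_n$ let $ISL_{n-1,i}(I)$ be the set of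 matrices in $IGL_{n-1,i}$ for which this $(n-1)\times(n-1)$ matrix belongs to $SL_{n-1}(R_n,I)$. **Lemma.** For every $n\ge4$ and $m\in\mathbb N$, as sets of matrices, $$IG_{n,m^2}\subseteq IA_n^m\cdot ISL_{n-1,1}(\sigma_1H_{n,m})\cdot ISL_{n-1,2}(\sigma_2H_{n,m})\cdots ISL_{n-1,n}(\sigma_nH_{n,m}).$$ -/

import Mathlib

open scoped Pointwise

namespace FreeMetabelian

/-! ### The Laurent polynomial ring `ℤ[ℤⁿ]` -/

/-- `R_n = ℤ[ℤⁿ]`, the ring of Laurent polynomials in `n` commuting variables. -/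
abbrev R (n : ℕ) : Type := AddMonoidAlgebra ℤ (Fin n → ℤ)

/-- The monomial `x_i`, an invertible element of `R_n`. -/
noncomputable def x (n : ℕ) (i : Fin n) : (R n)ˣ where
  val := AddMonoidAlgebra.single (Pi.single i 1) 1
  inv := AddMonoidAlgebra.single (-Pi.single i 1) 1
  val_inv := by
    rw [AddMonoidAlgebra.single_mul_single, add_neg_cancel, one_mul]; rfl
  inv_val := by
    rw [AddMonoidAlgebra.single_mul_single, neg_add_cancel, one_mul]; rfl

/-- `σ_i = x_i - 1`. -/
noncomputable def σ (n : ℕ) (i : Fin n) : R n := (x n i : R n) - 1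

/-- The ideal `H_{n,m} = ∑ i, (x_i ^ m - 1) R_n + m R_n`. -/
noncomputable def H (n m : ℕ) : Ideal (R n) :=
  Ideal.span (Set.range fun i : Fin n => (x n i : R n) ^ m - 1) ⊔ Ideal.span {(m : R n)}

/-! ### The free metabelian group and its automorphisms -/

/-- The free metabelian group `Φ_n = F_n / F_n''`. -/
abbrev Φ (n : ℕ) : Type := FreeGroup (Fin n) ⧸ derivedSeries (FreeGroup (Fin n)) 2

/-- The standard generators of `Φ_n`. -/
def gen (n : ℕ) (i : Fin n) : Φ n := QuotientGroup.mk (FreeGroup.of i)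

/-- For a subgroup `K` of a group, the subgroup `⟨k ^ m | k ∈ K⟩` generated by all `m`-th powers
of elements of `K`. -/
def powSubgroup {G : Type*} [Group G] (K : Subgroup G) (m : ℕ) : Subgroup G :=
  Subgroup.closure {g | ∃ k ∈ K, g = k ^ m}

/-- The automorphisms `α` of `G` with `α g ≡ g` modulo `N` for all `g`. For a characteristic
subgroup `N` this is the kernel of `Aut G → Aut (G / N)`. -/
def trivialMod {G : Type*} [Group G] (N : Subgroup G) : Subgroup (MulAut G) where
  carrier := {α | ∀ g, g⁻¹ * α g ∈ N}
  one_mem' := fun g => by simp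
  mul_mem' := fun {α β} hα hβ g => by
    have h := N.mul_mem (hβ g) (hα (β g))
    simpa [mul_assoc] using h
  inv_mem' := fun {α} hα g => by
    have h := N.inv_mem (hα (α⁻¹ g))
    simpa using h

/-- `IA(Φ_n) = ker (Aut Φ_n → Aut (Φ_n / Φ_n'))`. -/
def IA (n : ℕ) : Subgroup (MulAut (Φ n)) := trivialMod (commutator (Φ n))

/-- `IA_n^m = ⟨IA(Φ_n)^m⟩`. -/
def IAPow (n m : ℕ) : Subgroup (MulAut (Φ n)) := powSubgroup (IA n) m

/-- `M_{n,m} = (Φ_n' Φ_n^m)' (Φ_n' Φ_n^m)^m`. -/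
def M (n m : ℕ) : Subgroup (Φ n) :=
  let K : Subgroup (Φ n) := commutator (Φ n) ⊔ powSubgroup ⊤ m
  ⁅K, K⁆ ⊔ powSubgroup K m

/-- The principal congruence subgroup `IG_{n,m} = ker (IA(Φ_n) → Aut (Φ_n / M_{n,m}))`. -/
def IG (n m : ℕ) : Subgroup (MulAut (Φ n)) := IA n ⊓ trivialMod (M n m)

/-! ### The Magnus representation -/

/-- The group of matrices `(g, a; 0, 1)` where `g` is a unit of `R_n` and
`a = a_1 t_1 + ⋯ + a_n t_n` lies in the free `R_n`-module with basis `t_1, …, t_n`. -/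
@[ext] structure Magnus (n : ℕ) where
  /-- The upper left entry. -/
  g : (R n)ˣ
  /-- The coordinates of the upper right entry. -/
  a : Fin n → R n

namespace Magnus

variable {n : ℕ}

/-- Matrix multiplication: `(g, a; 0, 1) (h, b; 0, 1) = (g h, a + g b; 0, 1)`. -/
noncomputable instance : Group (Magnus n) where
  mul p q := ⟨p.g * q.g, p.a + (p.g : R n) • q.a⟩
  one := ⟨1, 0⟩
  inv p := ⟨p.g⁻¹, -(((p.g⁻¹ : (R n)ˣ) : R n) • p.a)⟩
  mul_assoc p q r := by
    apply Magnus.ext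
    · exact mul_assoc _ _ _
    · change p.a + (p.g : R n) • q.a + ((p.g * q.g : (R n)ˣ) : R n) • r.a
        = p.a + (p.g : R n) • (q.a + (q.g : R n) • r.a)
      rw [Units.val_mul, smul_add, smul_smul, add_assoc]
  one_mul p := by
    apply Magnus.ext
    · exact one_mul _
    · change 0 + ((1 : (R n)ˣ) : R n) • p.a = p.a
      simp
  mul_one p := by
    apply Magnus.ext
    · exact mul_one _
    · change p.a + (p.g : R n) • (0 : Fin n → R n) = p.a
      simp
  inv_mul_cancel p := by
    apply Magnus.ext
    · exact inv_mul_cancel _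
    · change -(((p.g⁻¹ : (R n)ˣ) : R n) • p.a) + ((p.g⁻¹ : (R n)ˣ) : R n) • p.a = 0
      simp

theorem mul_g (p q : Magnus n) : (p * q).g = p.g * q.g := rfl

theorem mul_a (p q : Magnus n) : (p * q).a = p.a + (p.g : R n) • q.a := rfl

/-- The projection `(g, a; 0, 1) ↦ g`. -/
noncomputable def toUnits : Magnus n →* (R n)ˣ where
  toFun p := p.g
  map_one' := rfl
  map_mul' _ _ := rfl

theorem derivedSeries_two : derivedSeries (Magnus n) 2 = ⊥ := by
  have h1 : derivedSeries (Magnus n) 1 ≤ (toUnits (n := n)).ker := by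
    rw [derivedSeries_one]
    exact Abelianization.commutator_subset_ker _
  rw [eq_bot_iff, derivedSeries_succ]
  refine (Subgroup.commutator_mono h1 h1).trans ?_
  rw [Subgroup.commutator_le]
  intro p hp q hq
  have hp' : p.g = 1 := hp
  have hq' : q.g = 1 := hq
  rw [Subgroup.mem_bot, commutatorElement_eq_one_iff_mul_comm]
  apply Magnus.ext
  · rw [mul_g, mul_g, mul_comm]
  · rw [mul_a, mul_a, hp', hq', Units.val_one, one_smul, one_smul, add_comm]

end Magnus

/-- The Magnus homomorphism on the free group, `x_i ↦ (x_i, t_i; 0, 1)`. -/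
noncomputable def freeMagnus (n : ℕ) : FreeGroup (Fin n) →* Magnus n :=
  FreeGroup.lift fun i => ⟨x n i, Pi.single i 1⟩

/-- The Magnus embedding of `Φ_n`, sending the `i`-th generator to `(x_i, t_i; 0, 1)`. -/
noncomputable def magnus (n : ℕ) : Φ n →* Magnus n :=
  QuotientGroup.lift _ (freeMagnus n) fun w hw => by
    have h := map_derivedSeries_le_derivedSeries (freeMagnus n) 2
      (Subgroup.mem_map_of_mem (freeMagnus n) hw)
    rwa [Magnus.derivedSeries_two, Subgroup.mem_bot] at h

/-- The matrix `(a_{i,j})` of an automorphism `α`: under the Magnus embedding, `α` maps the `i`-th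
generator to an element with upper right entry `a_{i,1} t_1 + ⋯ + a_{i,n} t_n`. -/
noncomputable def toMatrix {n : ℕ} (α : MulAut (Φ n)) : Matrix (Fin n) (Fin n) (R n) :=
  Matrix.of fun i j => (magnus n (α (gen n i))).a j

/-- A set of automorphisms of `Φ_n` viewed as a set of matrices. -/
def matrices {n : ℕ} (S : Set (MulAut (Φ n))) : Set (Matrix (Fin n) (Fin n) (R n)) :=
  toMatrix '' S

/-! ### The subgroups `IGL_{n-1,i}` and `ISL_{n-1,i}(H)` -/

section Relative

variable (ι : Type*) [Fintype ι] [DecidableEq ι] {A : Type*} [CommRing A]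

/-- `GL_d(A, I) = ker (GL_d(A) → GL_d(A / I))`, with rows and columns indexed by `ι`. -/
def GLRel (I : Ideal A) : Subgroup (Matrix.GeneralLinearGroup ι A) :=
  (Matrix.GeneralLinearGroup.map (n := ι) (Ideal.Quotient.mk I)).ker

/-- `SL_d(A, I) = ker (SL_d(A) → SL_d(A / I))`, with rows and columns indexed by `ι`. -/
def SLRel (I : Ideal A) : Subgroup (Matrix.SpecialLinearGroup ι A) :=
  (Matrix.SpecialLinearGroup.map (n := ι) (Ideal.Quotient.mk I)).ker

end Relative

/-- The matrix obtained from `A` by erasing the `i`-th row and the `i`-th column. -/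
def minor {n : ℕ} {S : Type*} (A : Matrix (Fin n) (Fin n) S) (i : Fin n) :
    Matrix {j : Fin n // j ≠ i} {j : Fin n // j ≠ i} S :=
  A.submatrix Subtype.val Subtype.val

/-- `IGL_{n-1,i}`: the matrices in `IA(Φ_n)` whose `i`-th row is that of the identity matrix and
whose `(i,i)`-minor lies in `GL_{n-1}(R_n, σ_i R_n)`. -/
def IGL (n : ℕ) (i : Fin n) : Set (Matrix (Fin n) (Fin n) (R n)) :=
  {A | A ∈ matrices (IA n : Set (MulAut (Φ n))) ∧
    (∀ j, A i j = (1 : Matrix (Fin n) (Fin n) (R n)) i j) ∧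
    ∃ B ∈ GLRel {j : Fin n // j ≠ i} (Ideal.span {σ n i}), B.val = minor A i}

/-- `ISL_{n-1,i}(I) = IGL_{n-1,i} ∩ SL_{n-1}(R_n, I)`, where an element of `IGL_{n-1,i}` is
identified with its `(i,i)`-minor. -/
def ISL (n : ℕ) (i : Fin n) (I : Ideal (R n)) : Set (Matrix (Fin n) (Fin n) (R n)) :=
  {A | A ∈ IGL n i ∧ ∃ B ∈ SLRel {j : Fin n // j ≠ i} I, B.val = minor A i}

end FreeMetabelian

/-! Write `μ_j = 1 + x_j + ⋯ + x_j ^ (m - 1)` (`geom`) and `τ_j = σ_j μ_j = x_j ^ m - 1`.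
Faithfulness of the Magnus embedding, together with the description of its image, identifies
`IA(Φ_n)` with the invertible matrices fixing the column `σ`. For an element of `IG_{n,m²}` the
matrix is congruent to `1` modulo `H_{n,m²}`. The problem then concerns matrices only: such an `X`
has to be multiplied on the right by a product `P` of `m`-th powers so that `X P` factors through
the groups `ISL`. Normality of the subgroup of `m`-th powers finally moves `P` to the left.

The factors are split off one variable at a time. Let `keep (low n k)` be the retraction of the ring
that sets the variables `x_i`, `i ≥ k`, to one. Before stage `v` the retraction by `low n v` sends
`X` to the identity. During the stage, the retraction by `low n (v + 1)` is considered. Off row and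
column `v`, the retracted entries of `X - 1` lie in `σ_v L` with `L ⊆ H`, so once row `v` and the
determinant are trivial after retraction, the retracted matrix agrees with a matrix `C` in
`ISL_{n-1,v}(σ_v H)`. Then `C⁻¹ X` retracts to the identity and enters the next stage. After all
stages nothing is retracted any more and the matrix is `1`.

To make row `v` trivial, enough matrices `1 + (column)(row)` have to be products of `m`-th powers.
They come from powers of a transvection times a matrix having its row as a left eigenvector
(`tv_geom_sum_smul_mem_powMat`), from scaled rows (`geom_smul_mem_rowGroup`), and from a commutator
trick that needs an index outside three given ones, hence `4 ≤ n`
(`subOne_mul_geom_smul_kos_mem_rowGroup`). Exactness of the Koszul complex of the `τ_j`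
(`koszul_exact`) turns these into a criterion for a whole row (`mem_rowGroup_of_mem_H`).

These multiplications must not spoil later stages, so a congruence is carried along: the entries of
`X - 1` lie in the ideal `N`, up to terms `σ_i² μ_j f` in prescribed positions (`Good`, `Inv`). The
exponent `m²` enters because `σ_j (1 + x_i + ⋯ + x_i ^ (m² - 1))` always lies in `N`
(`σ_mul_geom_sq_mem_N`). This gives the congruence at the start and allows the `m²`-th powers used
to correct determinants. -/

namespace FreeMetabelian

/-! ### Faithfulness and image of the Magnus embedding -/

section MagnusEmbedding

variable {n : ℕ}

/-- The degree homomorphism `F_n → ℤⁿ`. -/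
def deg (n : ℕ) : FreeGroup (Fin n) →* Multiplicative (Fin n → ℤ) :=
  FreeGroup.lift fun i => Multiplicative.ofAdd (Pi.single i 1)

/-- The monomial with exponent vector `g`, as a unit of `R_n`. -/
noncomputable def mon (n : ℕ) : Multiplicative (Fin n → ℤ) →* (R n)ˣ where
  toFun g :=
    { val := AddMonoidAlgebra.single g.toAdd 1
      inv := AddMonoidAlgebra.single (-g.toAdd) 1
      val_inv := by
        rw [AddMonoidAlgebra.single_mul_single, add_neg_cancel, one_mul]; rfl
      inv_val := by
        rw [AddMonoidAlgebra.single_mul_single, neg_add_cancel, one_mul]; rfl }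
  map_one' := by ext1; rfl
  map_mul' g h := by
    ext1
    simp [AddMonoidAlgebra.single_mul_single]

theorem mon_val (g : Multiplicative (Fin n → ℤ)) :
    (mon n g : R n) = AddMonoidAlgebra.single g.toAdd 1 := rfl

theorem mon_single (i : Fin n) : mon n (Multiplicative.ofAdd (Pi.single i 1)) = x n i := by
  ext1; rfl

theorem mon_injective : Function.Injective (mon n) := by
  intro g h hgh
  have h1 : (AddMonoidAlgebra.single g.toAdd 1 : R n) = AddMonoidAlgebra.single h.toAdd 1 := by
    rw [← mon_val, ← mon_val, hgh]
  exact Multiplicative.toAdd.injective ((AddMonoidAlgebra.single_left_inj one_ne_zero).1 h1)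

/-- The Fox derivative `F_n → R_n^n`. -/
noncomputable def fox (w : FreeGroup (Fin n)) : Fin n → R n := (freeMagnus n w).a

theorem freeMagnus_g (w : FreeGroup (Fin n)) : (freeMagnus n w).g = mon n (deg n w) := by
  have h : (Magnus.toUnits (n := n)).comp (freeMagnus n) = (mon n).comp (deg n) := by
    ext1 i
    simp [freeMagnus, deg, mon_single, Magnus.toUnits]
  exact DFunLike.congr_fun h w

theorem fox_mul (u v : FreeGroup (Fin n)) :
    fox (u * v) = fox u + (mon n (deg n u) : R n) • fox v := by
  rw [fox, map_mul, Magnus.mul_a, freeMagnus_g]; rfl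

theorem fox_one : fox (1 : FreeGroup (Fin n)) = 0 := by
  rw [fox, map_one]; rfl

theorem fox_of (i : Fin n) : fox (FreeGroup.of i) = Pi.single i 1 := by
  simp [fox, freeMagnus]

theorem smul_fox_inv (w : FreeGroup (Fin n)) :
    (mon n (deg n w) : R n) • fox w⁻¹ = - fox w := by
  have h := fox_mul w w⁻¹
  rw [mul_inv_cancel, fox_one] at h
  exact (neg_eq_of_add_eq_zero_right h.symm).symm

/-- Fox's fundamental formula: both sides obey the same product rule, so the generators decide. It
turns out to be the only constraint on the image of the embedding. -/
theorem dotProduct_fox (w : FreeGroup (Fin n)) :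
    fox w ⬝ᵥ σ n = (mon n (deg n w) : R n) - 1 := by
  induction w using FreeGroup.induction_on with
  | C1 => simp [fox_one]
  | of i => simp [fox_of, deg, mon_single, σ]
  | inv_of i h =>
    have h1 := congrArg (· ⬝ᵥ σ n) (smul_fox_inv (FreeGroup.of i))
    simp only [smul_dotProduct, neg_dotProduct, smul_eq_mul] at h1
    rw [h] at h1
    have h2 : (mon n (deg n (FreeGroup.of i)) : R n) * (mon n (deg n (FreeGroup.of i)⁻¹) : R n)
        = 1 := by
      rw [← Units.val_mul, ← map_mul, ← map_mul]; simp
    have h3 : (mon n (deg n (FreeGroup.of i)) : R n) *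
        (fox (FreeGroup.of i)⁻¹ ⬝ᵥ σ n - ((mon n (deg n (FreeGroup.of i)⁻¹) : R n) - 1)) = 0 := by
      rw [mul_sub, mul_sub, h1, h2]; ring
    exact sub_eq_zero.1 ((Units.mul_right_eq_zero _).1 h3)
  | mul u v hu hv =>
    rw [fox_mul, add_dotProduct, smul_dotProduct, hu, hv, map_mul, map_mul, Units.val_mul,
      smul_eq_mul]
    ring

theorem deg_surjective : Function.Surjective (deg n) := by
  rw [← MonoidHom.range_eq_top, eq_top_iff]
  intro g _
  have hg : g = ∏ i, (Multiplicative.ofAdd (Pi.single i 1 : Fin n → ℤ)) ^ (g.toAdd i) := by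
    apply Multiplicative.toAdd.injective
    rw [toAdd_prod]
    ext j
    simp [Finset.sum_apply, Pi.single_apply]
  rw [hg]
  refine Subgroup.prod_mem _ fun i _ => Subgroup.zpow_mem _
    (MonoidHom.mem_range.2 ⟨FreeGroup.of i, by simp [deg]⟩) _

theorem deg_eq_one_iff (w : FreeGroup (Fin n)) :
    deg n w = 1 ↔ w ∈ commutator (FreeGroup (Fin n)) := by
  constructor
  · intro h
    let ψ : Multiplicative (Fin n → ℤ) →* Abelianization (FreeGroup (Fin n)) :=
      { toFun := fun g => ∏ i, (Abelianization.of (FreeGroup.of i)) ^ (g.toAdd i)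
        map_one' := by simp
        map_mul' := fun g h => by simp [zpow_add, Finset.prod_mul_distrib] }
    have h1 : ψ.comp (deg n) = Abelianization.of := by
      ext1 i
      simp only [MonoidHom.comp_apply, deg, FreeGroup.lift_apply_of, ψ, MonoidHom.coe_mk,
        OneHom.coe_mk, toAdd_ofAdd]
      rw [Finset.prod_eq_single i]
      · simp
      · intro j _ hj
        simp [hj]
      · simp
    have h2 : Abelianization.of w = 1 := by
      rw [← h1, MonoidHom.comp_apply, h, map_one]
    exact (QuotientGroup.eq_one_iff w).1 h2
  · intro h
    exact Abelianization.commutator_subset_ker (deg n) h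

/-- A set-theoretic section of the degree homomorphism. -/
noncomputable def sec (g : Fin n → ℤ) : FreeGroup (Fin n) :=
  Function.surjInv deg_surjective (Multiplicative.ofAdd g)

theorem deg_sec (g : Fin n → ℤ) : deg n (sec g) = Multiplicative.ofAdd g :=
  Function.surjInv_eq _ _

/-- The abelianization of the derived subgroup of the free group. -/
abbrev DerivedAb (n : ℕ) : Type :=
  Additive (Abelianization ↥(commutator (FreeGroup (Fin n))))

/-- The class of `sec g * w * (sec (g + deg w))⁻¹` in the abelianized derived subgroup. -/
noncomputable def cls (g : Fin n → ℤ) (w : FreeGroup (Fin n)) : DerivedAb n :=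
  Additive.ofMul (Abelianization.of ⟨sec g * w * (sec (g + (deg n w).toAdd))⁻¹, by
    rw [← deg_eq_one_iff]
    simp only [map_mul, map_inv, deg_sec, ofAdd_add, ofAdd_toAdd]
    simp⟩)

theorem cls_mul (g : Fin n → ℤ) (u v : FreeGroup (Fin n)) :
    cls g (u * v) = cls g u + cls (g + (deg n u).toAdd) v := by
  rw [cls, cls, cls, ← ofMul_mul, ← map_mul]
  congr 2
  ext1
  simp only [map_mul, toAdd_mul, Subgroup.coe_mul, add_assoc]
  group

theorem cls_one (g : Fin n → ℤ) : cls g 1 = 0 := by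
  have h := cls_mul g 1 1
  simpa using h

/-- The additive map `R_n^n → F_n' / F_n''` sending the edge `(g, i)` of the Cayley graph of `ℤⁿ`
to the class of the loop closing it up through the section. -/
noncomputable def loop (n : ℕ) : (Fin n → R n) →+ DerivedAb n :=
  ∑ i, ((Finsupp.liftAddHom fun g : Fin n → ℤ =>
    ((zmultiplesHom (DerivedAb n)) (cls g (FreeGroup.of i)))).comp
      (AddMonoidAlgebra.coeffAddEquiv.toAddMonoidHom)).comp (Pi.evalAddMonoidHom (fun _ => R n) i)

theorem loop_single (i : Fin n) (g : Fin n → ℤ) (c : ℤ) :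
    loop n (Pi.single i (AddMonoidAlgebra.single g c)) = c • cls g (FreeGroup.of i) := by
  simp only [loop, AddMonoidHom.finsetSum_apply, AddMonoidHom.comp_apply, Pi.evalAddMonoidHom_apply]
  rw [Finset.sum_eq_single i]
  · simp
  · intro j _ hj
    simp [hj]
  · simp

/-- A word traces a path in the Cayley graph of `ℤⁿ` starting at `g`, and its Fox derivative lists
the edges. Both sides add up along the path, the starting point moving by the degree. For `g = 0`
and `w` of degree zero, the Fox derivative therefore determines `w` modulo the second derived
subgroup. -/
theorem loop_smul_fox (g : Fin n → ℤ) (w : FreeGroup (Fin n)) :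
    loop n ((AddMonoidAlgebra.single g 1 : R n) • fox w) = cls g w := by
  have key : ∀ (g : Fin n → ℤ) (u v : FreeGroup (Fin n)),
      loop n ((AddMonoidAlgebra.single g 1 : R n) • fox (u * v)) =
        loop n ((AddMonoidAlgebra.single g 1 : R n) • fox u) +
        loop n ((AddMonoidAlgebra.single (g + (deg n u).toAdd) 1 : R n) • fox v) := by
    intro g u v
    rw [fox_mul, smul_add, map_add, smul_smul, mon_val, AddMonoidAlgebra.single_mul_single, one_mul]
  have gen : ∀ (i : Fin n) (g : Fin n → ℤ),
      loop n ((AddMonoidAlgebra.single g 1 : R n) • fox (FreeGroup.of i)) =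
        cls g (FreeGroup.of i) := by
    intro i g
    rw [fox_of, ← Pi.single_smul, smul_eq_mul, mul_one, loop_single, one_smul]
  induction w using FreeGroup.induction_on generalizing g with
  | C1 => simp [fox_one, cls_one]
  | of i => exact gen i g
  | inv_of i h =>
    have h1 := key g (FreeGroup.of i)⁻¹ (FreeGroup.of i)
    have h2 := cls_mul g (FreeGroup.of i)⁻¹ (FreeGroup.of i)
    rw [gen, inv_mul_cancel, fox_one, smul_zero, map_zero] at h1
    rw [inv_mul_cancel, cls_one] at h2
    exact add_right_cancel (h1.symm.trans h2)
  | mul u v hu hv => rw [key, hu, hv, cls_mul]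

theorem mem_derivedSeries_two {G : Type*} [Group G] {w : G} (hw : w ∈ commutator G)
    (h : Abelianization.of (⟨w, hw⟩ : ↥(commutator G)) = 1) : w ∈ derivedSeries G 2 := by
  have h1 : (⟨w, hw⟩ : ↥(commutator G)) ∈ commutator ↥(commutator G) :=
    (QuotientGroup.eq_one_iff _).1 h
  have h2 : w ∈ (commutator ↥(commutator G)).map (commutator G).subtype := ⟨_, h1, rfl⟩
  rw [commutator_def (G := ↥(commutator G)), Subgroup.map_commutator, ← MonoidHom.range_eq_map,
    Subgroup.range_subtype]
    at h2
  rwa [derivedSeries_succ, derivedSeries_one]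

theorem freeMagnus_eq_one_iff (w : FreeGroup (Fin n)) :
    freeMagnus n w = 1 ↔ w ∈ derivedSeries (FreeGroup (Fin n)) 2 := by
  constructor
  · intro h
    have hd : deg n w = 1 := by
      apply mon_injective
      rw [← freeMagnus_g, h, map_one]; rfl
    have hf : fox w = 0 := by rw [fox, h]; rfl
    have h1 := loop_smul_fox 0 w
    rw [hf, smul_zero, map_zero, cls] at h1
    have h2 := mem_derivedSeries_two _ (ofMul_eq_zero.1 h1.symm)
    rw [hd, toAdd_one, add_zero] at h2
    -- The section need not send `0` to `1`, so `w` is only recovered up to conjugation by `sec 0`.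
    have := (derivedSeries_normal (FreeGroup (Fin n)) 2).conj_mem _ h2 (sec 0)⁻¹
    simpa [mul_assoc] using this
  · intro hw
    have h := map_derivedSeries_le_derivedSeries (freeMagnus n) 2
      (Subgroup.mem_map_of_mem (freeMagnus n) hw)
    rwa [Magnus.derivedSeries_two, Subgroup.mem_bot] at h

theorem magnus_mk (w : FreeGroup (Fin n)) : magnus n (QuotientGroup.mk w) = freeMagnus n w := rfl

/-- Faithfulness of the Magnus embedding. -/
theorem magnus_injective : Function.Injective (magnus n) := by
  rw [injective_iff_map_eq_one]
  intro w
  induction w using QuotientGroup.induction_on with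
  | H w =>
    rw [magnus_mk, freeMagnus_eq_one_iff]
    exact (QuotientGroup.eq_one_iff w).2

/-- The Fox derivative on the abelianized derived subgroup. -/
noncomputable def foxAb (n : ℕ) : DerivedAb n →+ (Fin n → R n) :=
  AddMonoidHom.toMultiplicative.symm (Abelianization.lift (
    { toFun := fun w => Multiplicative.ofAdd (fox w.1)
      map_one' := by rw [OneMemClass.coe_one, fox_one]; rfl
      map_mul' := fun u v => by
        rw [Subgroup.coe_mul, fox_mul, (deg_eq_one_iff _).2 u.2, map_one, Units.val_one, one_smul,
          ofAdd_add] } : ↥(commutator (FreeGroup (Fin n))) →* Multiplicative (Fin n → R n)))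

theorem foxAb_of (w : ↥(commutator (FreeGroup (Fin n)))) :
    foxAb n (Additive.ofMul (Abelianization.of w)) = fox w.1 := rfl

theorem foxAb_cls_of (g : Fin n → ℤ) (i : Fin n) :
    foxAb n (cls g (FreeGroup.of i)) = Pi.single i (AddMonoidAlgebra.single g 1) -
      (fox (sec (g + Pi.single i 1)) - fox (sec g)) := by
  have hd : deg n (FreeGroup.of i) = Multiplicative.ofAdd (Pi.single i 1) := by simp [deg]
  have h1 := smul_fox_inv (sec (g + Pi.single i 1))
  rw [deg_sec] at h1
  rw [cls, foxAb_of]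
  dsimp only
  rw [fox_mul, fox_mul, map_mul, hd, deg_sec, ← ofAdd_add, toAdd_ofAdd, h1, fox_of, mon_val,
    ← Pi.single_smul, smul_eq_mul, mul_one, toAdd_ofAdd]
  abel

/-- The additive extension of `g ↦ fox (sec g)` to the group ring. -/
noncomputable def foxSec (n : ℕ) : R n →+ (Fin n → R n) :=
  (Finsupp.liftAddHom fun g : Fin n → ℤ =>
    (zmultiplesHom (Fin n → R n)) (fox (sec g))).comp
      AddMonoidAlgebra.coeffAddEquiv.toAddMonoidHom

theorem foxSec_single (g : Fin n → ℤ) (c : ℤ) :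
    foxSec n (AddMonoidAlgebra.single g c) = c • fox (sec g) := by
  simp [foxSec]

/-- Closing up an edge through the section changes its Fox derivative by a difference of values of
`fox ∘ sec` at the endpoints. These differences assemble into a function of the boundary `a ⬝ᵥ σ`,
hence disappear on cycles. -/
theorem foxAb_loop (a : Fin n → R n) : foxAb n (loop n a) = a - foxSec n (a ⬝ᵥ σ n) := by
  let L : (Fin n → R n) →+ (Fin n → R n) := (foxAb n).comp (loop n)
  let E : (Fin n → R n) →+ R n :=
    { toFun := fun a => a ⬝ᵥ σ n
      map_zero' := zero_dotProduct _
      map_add' := fun a b => add_dotProduct _ _ _ }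
  let L' : (Fin n → R n) →+ (Fin n → R n) := AddMonoidHom.id _ - (foxSec n).comp E
  suffices h : L = L' from DFunLike.congr_fun h a
  refine AddMonoidHom.functions_ext' _ _ _ fun i => ?_
  refine AddMonoidAlgebra.addMonoidHom_ext fun g c => ?_
  change foxAb n (loop n (Pi.single i (AddMonoidAlgebra.single g c))) =
    Pi.single i (AddMonoidAlgebra.single g c) -
      foxSec n (Pi.single i (AddMonoidAlgebra.single g c) ⬝ᵥ σ n)
  rw [loop_single, map_zsmul, foxAb_cls_of, single_dotProduct, σ, mul_sub, mul_one]
  have h1 : (AddMonoidAlgebra.single g c : R n) * (x n i : R n) =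
      AddMonoidAlgebra.single (g + Pi.single i 1) c := by
    change (AddMonoidAlgebra.single g c : R n) * AddMonoidAlgebra.single (Pi.single i 1) 1 = _
    rw [AddMonoidAlgebra.single_mul_single, mul_one]
  rw [h1, map_sub, foxSec_single, foxSec_single, smul_sub, smul_sub]
  congr 1
  rw [← Pi.single_smul, AddMonoidAlgebra.smul_single, smul_eq_mul, mul_one]

/-- Every syzygy of `σ` is the Fox derivative of an element of the derived subgroup. -/
theorem exists_fox_eq_of_dotProduct_eq_zero {a : Fin n → R n} (ha : a ⬝ᵥ σ n = 0) :
    ∃ w ∈ commutator (FreeGroup (Fin n)), fox w = a := by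
  have h := foxAb_loop a
  rw [ha, map_zero, sub_zero] at h
  obtain ⟨w, hw⟩ := QuotientGroup.mk_surjective (s := commutator _) (loop n a).toMul
  refine ⟨w.1, w.2, ?_⟩
  rw [← foxAb_of, ← h]
  exact congrArg (fun y => foxAb n (Additive.ofMul y)) hw

/-- The image of the Magnus embedding. -/
theorem exists_freeMagnus_eq (g : Multiplicative (Fin n → ℤ)) {a : Fin n → R n}
    (ha : a ⬝ᵥ σ n = (mon n g : R n) - 1) : ∃ w, freeMagnus n w = ⟨mon n g, a⟩ := by
  obtain ⟨v, hv⟩ := deg_surjective g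
  have h1 : (a - fox v) ⬝ᵥ σ n = 0 := by
    rw [sub_dotProduct, ha, dotProduct_fox, hv, sub_self]
  obtain ⟨u, hu, hua⟩ := exists_fox_eq_of_dotProduct_eq_zero h1
  rw [← deg_eq_one_iff] at hu
  refine ⟨u * v, Magnus.ext ?_ ?_⟩
  · rw [freeMagnus_g, map_mul, hu, hv, one_mul]
  · change fox (u * v) = a
    rw [fox_mul, hu, map_one, Units.val_one, one_smul, hua, sub_add_cancel]

end MagnusEmbedding

/-! ### Invertible matrices fixing a column -/

section VecStab

variable {ι A : Type*} [Fintype ι] [DecidableEq ι] [CommRing A]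

/-- The group of invertible matrices fixing a column vector. -/
def vecStab (s : ι → A) : Subgroup (Matrix ι ι A)ˣ where
  carrier := {M | M.val.mulVec s = s}
  one_mem' := by simp
  mul_mem' := fun {M N} hM hN => by
    change (M * N).val.mulVec s = s
    rw [Units.val_mul, ← Matrix.mulVec_mulVec, hN, hM]
  inv_mem' := fun {M} hM => by
    change (M⁻¹).val.mulVec s = s
    conv_lhs => rw [← show M.val.mulVec s = s from hM]
    rw [Matrix.mulVec_mulVec, Units.inv_mul, Matrix.one_mulVec]

end VecStab

/-! ### The matrices of `IA(Φ_n)`, of its `m`-th powers and of the congruence subgroups -/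

section Automorphisms

variable {n : ℕ}

/-- The action of a matrix on the upper right entries of the Magnus group. -/
noncomputable def Magnus.act (A : Matrix (Fin n) (Fin n) (R n)) : Magnus n →* Magnus n where
  toFun p := ⟨p.g, Matrix.vecMul p.a A⟩
  map_one' := by
    apply Magnus.ext
    · rfl
    · exact Matrix.zero_vecMul A
  map_mul' p q := by
    apply Magnus.ext
    · rfl
    · simp only [Magnus.mul_a]
      rw [Matrix.add_vecMul, Matrix.smul_vecMul]

theorem hom_ext_gen {G : Type*} [Group G] {f g : Φ n →* G} (h : ∀ i, f (gen n i) = g (gen n i)) :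
    f = g := by
  refine QuotientGroup.monoidHom_ext _ ?_
  ext1 i
  exact h i

theorem magnus_gen (i : Fin n) : magnus n (gen n i) = ⟨x n i, Pi.single i 1⟩ := by
  rw [gen, magnus_mk]
  simp [freeMagnus]

theorem exists_magnus_eq (i : Fin n) {a : Fin n → R n} (ha : a ⬝ᵥ σ n = σ n i) :
    ∃ w : Φ n, magnus n w = ⟨x n i, a⟩ := by
  obtain ⟨w, hw⟩ := exists_freeMagnus_eq (Multiplicative.ofAdd (Pi.single i 1)) (a := a)
    (by rw [ha, mon_single, σ])
  refine ⟨QuotientGroup.mk w, ?_⟩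
  rw [magnus_mk, hw, mon_single]

theorem exists_hom_of_mulVec_eq {A : Matrix (Fin n) (Fin n) (R n)} (hA : A.mulVec (σ n) = σ n) :
    ∃ f : Φ n →* Φ n, (magnus n).comp f = (Magnus.act A).comp (magnus n) := by
  have h : ∀ i, ∃ w : FreeGroup (Fin n), freeMagnus n w = ⟨x n i, A i⟩ := fun i => by
    obtain ⟨w, hw⟩ := exists_magnus_eq i (a := A i) (congrFun hA i)
    obtain ⟨v, rfl⟩ := QuotientGroup.mk_surjective w
    exact ⟨v, hw⟩
  choose w hw using h
  refine ⟨QuotientGroup.map _ _ (FreeGroup.lift w)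
    (Subgroup.map_le_iff_le_comap.1 (map_derivedSeries_le_derivedSeries _ 2)), ?_⟩
  refine hom_ext_gen fun i => ?_
  rw [MonoidHom.comp_apply, MonoidHom.comp_apply, magnus_gen, gen, QuotientGroup.map_mk, magnus_mk,
    FreeGroup.lift_apply_of, hw]
  apply Magnus.ext
  · rfl
  · exact (Matrix.single_one_vecMul i A).symm

theorem act_mul (A B : Matrix (Fin n) (Fin n) (R n)) :
    Magnus.act (A * B) = (Magnus.act B).comp (Magnus.act A) := by
  refine MonoidHom.ext fun p => Magnus.ext rfl ?_
  exact (Matrix.vecMul_vecMul p.a A B).symm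

theorem act_one : Magnus.act (1 : Matrix (Fin n) (Fin n) (R n)) = MonoidHom.id _ := by
  refine MonoidHom.ext fun p => Magnus.ext rfl ?_
  exact Matrix.vecMul_one p.a

theorem magnus_g_eq_one_iff (w : Φ n) : (magnus n w).g = 1 ↔ w ∈ commutator (Φ n) := by
  constructor
  · induction w using QuotientGroup.induction_on with
    | H w =>
      intro h
      rw [magnus_mk, freeMagnus_g] at h
      have h1 : deg n w = 1 := mon_injective (h.trans (map_one _).symm)
      rw [deg_eq_one_iff] at h1
      have h2 := Subgroup.mem_map_of_mem (QuotientGroup.mk' (derivedSeries (FreeGroup (Fin n)) 2)) h1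
      have h3 := map_derivedSeries_le_derivedSeries
        (QuotientGroup.mk' (derivedSeries (FreeGroup (Fin n)) 2)) 1
      rw [derivedSeries_one, derivedSeries_one] at h3
      exact h3 h2
  · intro h
    exact Abelianization.commutator_subset_ker ((Magnus.toUnits).comp (magnus n)) h

theorem dotProduct_magnus (w : Φ n) :
    (magnus n w).a ⬝ᵥ σ n = ((magnus n w).g : R n) - 1 := by
  induction w using QuotientGroup.induction_on with
  | H w =>
    rw [magnus_mk, freeMagnus_g]
    exact dotProduct_fox w

theorem magnus_IA {α : MulAut (Φ n)} (hα : α ∈ IA n) (w : Φ n) :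
    (magnus n (α w)).g = (magnus n w).g := by
  have h := (magnus_g_eq_one_iff _).2 (hα w)
  rw [map_mul, Magnus.mul_g, map_inv] at h
  exact (inv_mul_eq_one.1 h).symm

theorem magnus_comp_IA {α : MulAut (Φ n)} (hα : α ∈ IA n) :
    (magnus n).comp α.toMonoidHom = (Magnus.act (toMatrix α)).comp (magnus n) := by
  refine hom_ext_gen fun i => ?_
  apply Magnus.ext
  · exact magnus_IA hα _
  · rw [MonoidHom.comp_apply, MonoidHom.comp_apply, magnus_gen]
    exact (Matrix.single_one_vecMul i (toMatrix α)).symm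

/-- Matrices act on row vectors from the right, whence the reversed order. Powers and generated
subgroups do not notice it. -/
theorem toMatrix_mul {α β : MulAut (Φ n)} (hα : α ∈ IA n) :
    toMatrix (α * β) = toMatrix β * toMatrix α := by
  ext1 i j
  have h := DFunLike.congr_fun (magnus_comp_IA hα) (β (gen n i))
  have h1 := congrFun (congrArg Magnus.a h) j
  exact h1

theorem toMatrix_one : toMatrix (1 : MulAut (Φ n)) = 1 := by
  ext1 i j
  change (magnus n (gen n i)).a j = _
  rw [magnus_gen, Matrix.one_apply]
  simp [Pi.single_apply, eq_comm]

theorem toMatrix_mulVec {α : MulAut (Φ n)} (hα : α ∈ IA n) :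
    (toMatrix α).mulVec (σ n) = σ n := by
  ext1 i
  have h := dotProduct_magnus (α (gen n i))
  rw [magnus_IA hα, magnus_gen] at h
  exact h

theorem exists_unit_toMatrix {α : MulAut (Φ n)} (hα : α ∈ IA n) :
    ∃ A ∈ vecStab (σ n), A.val = toMatrix α :=
  ⟨⟨toMatrix α, toMatrix α⁻¹,
    by rw [← toMatrix_mul ((IA n).inv_mem hα), inv_mul_cancel, toMatrix_one],
    by rw [← toMatrix_mul hα, mul_inv_cancel, toMatrix_one]⟩, toMatrix_mulVec hα, rfl⟩

/-- Every invertible matrix fixing `σ` comes from an automorphism in `IA(Φ_n)`. -/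
theorem exists_IA_toMatrix_eq {A : (Matrix (Fin n) (Fin n) (R n))ˣ} (hA : A ∈ vecStab (σ n)) :
    ∃ α ∈ IA n, toMatrix α = A.val := by
  obtain ⟨f, hf⟩ := exists_hom_of_mulVec_eq hA
  obtain ⟨g, hg⟩ := exists_hom_of_mulVec_eq ((vecStab (σ n)).inv_mem hA)
  have key : ∀ {f g : Φ n →* Φ n} {A B : Matrix (Fin n) (Fin n) (R n)},
      (magnus n).comp f = (Magnus.act A).comp (magnus n) →
      (magnus n).comp g = (Magnus.act B).comp (magnus n) → B * A = 1 → f.comp g = .id _ := by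
    intro f g A B hf hg h
    refine MonoidHom.ext fun w => magnus_injective ?_
    have h1 := DFunLike.congr_fun hf (g w)
    have h2 := DFunLike.congr_fun hg w
    have h3 := DFunLike.congr_fun (act_mul B A) (magnus n w)
    rw [h, act_one] at h3
    simp only [MonoidHom.comp_apply] at h1 h2 h3 ⊢
    rw [h1, h2, ← h3]; rfl
  refine ⟨MonoidHom.toMulEquiv f g (key hg hf A.mul_inv) (key hf hg A.inv_mul), ?_, ?_⟩
  · intro w
    rw [← magnus_g_eq_one_iff, map_mul, map_inv, Magnus.mul_g]
    have h1 := congrArg Magnus.g (DFunLike.congr_fun hf w)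
    change _ * (magnus n (f w)).g = 1
    rw [show (magnus n (f w)).g = (magnus n w).g from h1]
    exact inv_mul_cancel _
  · ext1 i j
    have h1 := congrFun (congrArg Magnus.a (DFunLike.congr_fun hf (gen n i))) j
    simp only [MonoidHom.comp_apply] at h1
    change (magnus n (f (gen n i))).a j = _
    rw [h1, magnus_gen]
    exact congrFun (Matrix.single_one_vecMul i _) j

theorem mem_matrices_IA {A : (Matrix (Fin n) (Fin n) (R n))ˣ} (hA : A ∈ vecStab (σ n)) :
    A.val ∈ matrices (IA n : Set (MulAut (Φ n))) := by
  obtain ⟨α, hα, h⟩ := exists_IA_toMatrix_eq hA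
  exact ⟨α, hα, h⟩

theorem powSubgroup_le {G : Type*} [Group G] (K : Subgroup G) (m : ℕ) : powSubgroup K m ≤ K := by
  rw [powSubgroup, Subgroup.closure_le]
  rintro _ ⟨k, hk, rfl⟩
  exact K.pow_mem hk m

theorem pow_mem_powSubgroup {G : Type*} [Group G] {K : Subgroup G} {k : G} (hk : k ∈ K) (m : ℕ) :
    k ^ m ∈ powSubgroup K m :=
  Subgroup.subset_closure ⟨k, hk, rfl⟩

theorem conj_mem_powSubgroup {G : Type*} [Group G] {K : Subgroup G} {m : ℕ} {g k : G}
    (hg : g ∈ powSubgroup K m) (hk : k ∈ K) : k * g * k⁻¹ ∈ powSubgroup K m := by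
  have h : powSubgroup K m ≤ (powSubgroup K m).comap (MulAut.conj k).toMonoidHom := by
    conv_lhs => rw [powSubgroup]
    rw [Subgroup.closure_le]
    rintro _ ⟨l, hl, rfl⟩
    change MulAut.conj k (l ^ m) ∈ powSubgroup K m
    rw [map_pow]
    exact pow_mem_powSubgroup (K.mul_mem (K.mul_mem hk hl) (K.inv_mem hk)) m
  exact h hg

theorem mem_matrices_IAPow {m : ℕ} {A : (Matrix (Fin n) (Fin n) (R n))ˣ}
    (hA : A ∈ powSubgroup (vecStab (σ n)) m) :
    A.val ∈ matrices (IAPow n m : Set (MulAut (Φ n))) := by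
  have hle : IAPow n m ≤ IA n := powSubgroup_le _ _
  have hpow : ∀ {α : MulAut (Φ n)}, α ∈ IA n → ∀ k, toMatrix (α ^ k) = toMatrix α ^ k := by
    intro α hα k
    induction k with
    | zero => simp [toMatrix_one]
    | succ k ih => rw [pow_succ, toMatrix_mul ((IA n).pow_mem hα k), ih, pow_succ']
  induction hA using Subgroup.closure_induction with
  | mem A h =>
    obtain ⟨B, hB, rfl⟩ := h
    obtain ⟨α, hα, h⟩ := exists_IA_toMatrix_eq hB
    exact ⟨α ^ m, pow_mem_powSubgroup hα m, by rw [hpow hα, h, Units.val_pow_eq_pow_val]⟩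
  | one => exact ⟨1, (IAPow n m).one_mem, toMatrix_one⟩
  | mul A B _ _ hA hB =>
    obtain ⟨α, hα, h⟩ := hA
    obtain ⟨β, hβ, h'⟩ := hB
    exact ⟨β * α, (IAPow n m).mul_mem hβ hα, by rw [toMatrix_mul (hle hβ), h, h', Units.val_mul]⟩
  | inv A _ hA =>
    obtain ⟨α, hα, h⟩ := hA
    refine ⟨α⁻¹, (IAPow n m).inv_mem hα, ?_⟩
    have h1 : toMatrix α⁻¹ * A.val = 1 := by
      rw [← h, ← toMatrix_mul (hle hα), mul_inv_cancel, toMatrix_one]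
    exact (Units.inv_eq_of_mul_eq_one_left h1).symm

/-! ### Congruences satisfied by the matrices of `IG_{n,k}` -/

/-- The elements of the Magnus group with diagonal entry congruent to one modulo an ideal. -/
def Magnus.diagCongr (I : Ideal (R n)) : Subgroup (Magnus n) where
  carrier := {p | (p.g : R n) - 1 ∈ I}
  one_mem' := by
    change ((1 : (R n)ˣ) : R n) - 1 ∈ I
    simp
  mul_mem' := fun {p q} hp hq => by
    change ((p * q).g : R n) - 1 ∈ I
    rw [Magnus.mul_g, Units.val_mul]
    have h := I.add_mem (I.mul_mem_left (p.g : R n) hq) hp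
    convert! h using 1
    ring
  inv_mem' := fun {p} hp => by
    change ((p.g⁻¹ : (R n)ˣ) : R n) - 1 ∈ I
    have h := I.mul_mem_left (-((p.g⁻¹ : (R n)ˣ) : R n)) hp
    convert! h using 1
    rw [mul_sub, neg_mul, Units.inv_mul]
    ring

/-- The elements of the Magnus group congruent to the identity modulo an ideal. -/
def Magnus.congr (I : Ideal (R n)) : Subgroup (Magnus n) where
  carrier := {p | (p.g : R n) - 1 ∈ I ∧ ∀ i, p.a i ∈ I}
  one_mem' := ⟨(Magnus.diagCongr I).one_mem, fun _ => I.zero_mem⟩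
  mul_mem' := fun {p q} hp hq => ⟨(Magnus.diagCongr I).mul_mem hp.1 hq.1, fun i => by
    rw [Magnus.mul_a]
    exact I.add_mem (hp.2 i) (I.mul_mem_left _ (hq.2 i))⟩
  inv_mem' := fun {p} hp => ⟨(Magnus.diagCongr I).inv_mem hp.1, fun i =>
    I.neg_mem (I.mul_mem_left _ (hp.2 i))⟩

theorem Magnus.pow_g (p : Magnus n) (k : ℕ) : (p ^ k).g = p.g ^ k :=
  map_pow Magnus.toUnits p k

theorem Magnus.pow_a (p : Magnus n) (k : ℕ) :
    (p ^ k).a = (∑ i ∈ Finset.range k, (p.g : R n) ^ i) • p.a := by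
  induction k with
  | zero => simp; rfl
  | succ k ih =>
    rw [pow_succ, Magnus.mul_a, ih, Magnus.pow_g, Units.val_pow_eq_pow_val, Finset.sum_range_succ,
      add_smul]

theorem mon_sub_one_mem_H (k : ℕ) (g : Multiplicative (Fin n → ℤ)) :
    ((mon n g : R n)) ^ k - 1 ∈ H n k := by
  let S : Subgroup (Multiplicative (Fin n → ℤ)) :=
    ((Magnus.diagCongr (H n k)).comap
      ({ toFun := fun u => ⟨u, 0⟩, map_one' := rfl, map_mul' := fun u v => Magnus.ext rfl (by
          rw [Magnus.mul_a]; simp) } : (R n)ˣ →* Magnus n)).comap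
      ((powMonoidHom k).comp (mon n))
  suffices h : g ∈ S by
    have h' : (((mon n g) ^ k : (R n)ˣ) : R n) - 1 ∈ H n k := h
    rwa [Units.val_pow_eq_pow_val] at h'
  obtain ⟨w, rfl⟩ := deg_surjective g
  induction w using FreeGroup.induction_on with
  | C1 => rw [map_one]; exact S.one_mem
  | of i =>
    change (((mon n (deg n (FreeGroup.of i))) ^ k : (R n)ˣ) : R n) - 1 ∈ H n k
    rw [deg, FreeGroup.lift_apply_of, mon_single, Units.val_pow_eq_pow_val]
    exact Ideal.mem_sup_left (Ideal.subset_span ⟨i, rfl⟩)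
  | inv_of i h => rw [map_inv]; exact S.inv_mem h
  | mul u v hu hv => rw [map_mul]; exact S.mul_mem hu hv

-- On `Φ_n' Φ_n ^ k` the diagonal entry is `1` modulo `H n k`. For `p`, `q` with such diagonal
-- entries, the upper right entry of the commutator is `q.a (p.g - 1) - p.a (q.g - 1)`, and that of
-- `p ^ k` is `(1 + g + ⋯ + g ^ (k - 1)) p.a` with `g = p.g`, which is congruent to `k p.a`. All of
-- these vanish modulo `H n k`.
open scoped commutatorElement in
theorem magnus_M_le (k : ℕ) : M n k ≤ (Magnus.congr (H n k)).comap (magnus n) := by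
  have hK : commutator (Φ n) ⊔ powSubgroup ⊤ k ≤ (Magnus.diagCongr (H n k)).comap (magnus n) := by
    refine sup_le ?_ ?_
    · intro w hw
      change ((magnus n w).g : R n) - 1 ∈ H n k
      rw [(magnus_g_eq_one_iff w).2 hw, Units.val_one, sub_self]
      exact Ideal.zero_mem _
    · rw [powSubgroup, Subgroup.closure_le]
      rintro _ ⟨w, -, rfl⟩
      change ((magnus n (w ^ k)).g : R n) - 1 ∈ H n k
      rw [map_pow, Magnus.pow_g, Units.val_pow_eq_pow_val]
      obtain ⟨v, rfl⟩ := QuotientGroup.mk_surjective w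
      rw [magnus_mk, freeMagnus_g]
      exact mon_sub_one_mem_H k _
  refine sup_le ?_ ?_
  · rw [Subgroup.commutator_le]
    intro p hp q hq
    have h1 : ((magnus n p).g : R n) - 1 ∈ H n k := hK hp
    have h2 : ((magnus n q).g : R n) - 1 ∈ H n k := hK hq
    refine ⟨?_, fun i => ?_⟩
    · have h3 := (magnus_g_eq_one_iff ⁅p, q⁆).2
        (Subgroup.commutator_mem_commutator (Subgroup.mem_top p) (Subgroup.mem_top q))
      rw [h3, Units.val_one, sub_self]
      exact Ideal.zero_mem _
    · have h3 : ⁅p, q⁆ * (q * p) = p * q := by rw [commutatorElement_def]; group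
      have h4 := congrFun (congrArg Magnus.a (congrArg (magnus n) h3)) i
      have h5 := (magnus_g_eq_one_iff ⁅p, q⁆).2
        (Subgroup.commutator_mem_commutator (Subgroup.mem_top p) (Subgroup.mem_top q))
      simp only [map_mul, Magnus.mul_a, h5, Units.val_one, Pi.add_apply, Pi.smul_apply, one_smul,
        smul_eq_mul] at h4
      have h6 : (magnus n ⁅p, q⁆).a i = (magnus n q).a i * ((magnus n p).g - 1)
          - (magnus n p).a i * ((magnus n q).g - 1) := by
        linear_combination h4
      rw [h6]
      exact Ideal.sub_mem _ (Ideal.mul_mem_left _ _ h1) (Ideal.mul_mem_left _ _ h2)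
  · rw [powSubgroup, Subgroup.closure_le]
    rintro _ ⟨w, hw, rfl⟩
    have h1 : ((magnus n w).g : R n) - 1 ∈ H n k := hK hw
    refine ⟨?_, fun i => ?_⟩
    · rw [map_pow]
      exact (Magnus.diagCongr (H n k)).pow_mem h1 k
    · rw [map_pow, Magnus.pow_a, Pi.smul_apply, smul_eq_mul]
      refine Ideal.mul_mem_right _ _ ?_
      have h2 : (∑ j ∈ Finset.range k, ((magnus n w).g : R n) ^ j) =
          (∑ j ∈ Finset.range k, (((magnus n w).g : R n) ^ j - 1)) + (k : R n) := by
        rw [Finset.sum_sub_distrib]; simp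
      rw [h2]
      refine Ideal.add_mem _ (Ideal.sum_mem _ fun j _ => ?_)
        (Ideal.mem_sup_right (Ideal.mem_span_singleton_self _))
      exact Ideal.mem_of_dvd _ (sub_one_dvd_pow_sub_one _ j) h1

theorem toMatrix_sub_one_mem_H {k : ℕ} {α : MulAut (Φ n)} (hα : α ∈ IG n k) (i j : Fin n) :
    toMatrix α i j - (1 : Matrix (Fin n) (Fin n) (R n)) i j ∈ H n k := by
  have h := (magnus_M_le k (hα.2 (gen n i))).2 j
  have h1 : α (gen n i) = gen n i * ((gen n i)⁻¹ * α (gen n i)) := by group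
  change (magnus n (α (gen n i))).a j - _ ∈ _
  rw [h1, map_mul, Magnus.mul_a, magnus_gen, Matrix.one_apply, Pi.add_apply]
  simp only [Pi.single_apply, eq_comm (a := i), add_sub_cancel_left]
  exact Ideal.mul_mem_left _ _ h

end Automorphisms

/-! ### Matrices `1 + y w` and products of `m`-th powers -/

section PowMat

open Matrix

variable {ι A : Type*} [Fintype ι] [DecidableEq ι] [CommRing A]

/-- The matrix `1 + y w`, where `y` is a column and `w` is a row. -/
def tv (y w : ι → A) : Matrix ι ι A := 1 + vecMulVec y w

theorem tv_apply (y w : ι → A) (i j : ι) :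
    tv y w i j = (1 : Matrix ι ι A) i j + y i * w j := by
  rw [tv, Matrix.add_apply, vecMulVec_apply]

theorem tv_zero (y : ι → A) : tv y 0 = 1 := by
  rw [tv, vecMulVec_zero, add_zero]

theorem tv_mul (y w : ι → A) (M : Matrix ι ι A) : tv y w * M = M + vecMulVec y (w ᵥ* M) := by
  rw [tv, add_mul, one_mul, vecMulVec_mul]

theorem mul_tv (y w : ι → A) (M : Matrix ι ι A) : M * tv y w = M + vecMulVec (M *ᵥ y) w := by
  rw [tv, mul_add, mul_one, mul_vecMulVec]

theorem vecMul_tv (y w v : ι → A) : v ᵥ* tv y w = v + (v ⬝ᵥ y) • w := by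
  rw [tv, vecMul_add, vecMul_one, vecMul_vecMulVec]

theorem tv_mulVec (y w v : ι → A) : tv y w *ᵥ v = v + (w ⬝ᵥ v) • y := by
  rw [tv, add_mulVec, one_mulVec, vecMulVec_mulVec, op_smul_eq_smul]

theorem tv_mul_tv (y v w : ι → A) : tv y v * tv y w = tv y (v + (1 + v ⬝ᵥ y) • w) := by
  rw [tv_mul, vecMul_tv, tv, tv, add_assoc, ← vecMulVec_add]
  congr 2
  rw [add_smul, one_smul]; abel

theorem tv_mul_tv_of_dotProduct_eq_zero {y v : ι → A} (h : v ⬝ᵥ y = 0) (w : ι → A) :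
    tv y v * tv y w = tv y (v + w) := by
  rw [tv_mul_tv, h, add_zero, one_smul]

theorem det_tv (y w : ι → A) : (tv y w).det = 1 + w ⬝ᵥ y := by
  rw [tv, vecMulVec_eq Unit, det_one_add_mul_comm, det_unique, Matrix.add_apply, one_apply_eq]
  rfl

theorem map_tv {B : Type*} [CommRing B] (f : A →+* B) (y w : ι → A) :
    (tv y w).map f = tv (f ∘ y) (f ∘ w) := by
  ext i j
  simp only [map_apply, tv_apply, map_add, map_mul, one_apply, Function.comp_apply]
  split_ifs <;> simp

/-- The invertible matrices fixing `s`, as matrices. -/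
def stabMat (s : ι → A) : Submonoid (Matrix ι ι A) :=
  (vecStab s).toSubmonoid.map (Units.coeHom _)

/-- The subgroup generated by the `m`-th powers of the invertible matrices fixing `s`,
as a set of matrices. -/
def powMat (s : ι → A) (m : ℕ) : Submonoid (Matrix ι ι A) :=
  (powSubgroup (vecStab s) m).toSubmonoid.map (Units.coeHom _)

variable {s : ι → A} {m : ℕ}

theorem mem_powMat {M : Matrix ι ι A} :
    M ∈ powMat s m ↔ ∃ U ∈ powSubgroup (vecStab s) m, U.val = M := Iff.rfl

theorem mem_stabMat {M : Matrix ι ι A} : M ∈ stabMat s ↔ ∃ U ∈ vecStab s, U.val = M := Iff.rfl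

theorem mem_stabMat_of_mul_eq_one {M N : Matrix ι ι A} (h : M * N = 1) (hM : M *ᵥ s = s) :
    M ∈ stabMat s :=
  ⟨⟨M, N, h, mul_eq_one_comm.1 h⟩, hM, rfl⟩

theorem powMat_le_stabMat : powMat s m ≤ stabMat s :=
  Submonoid.monotone_map (powSubgroup_le (vecStab s) m)

theorem pow_mem_powMat {M : Matrix ι ι A} (hM : M ∈ stabMat s) : M ^ m ∈ powMat s m := by
  obtain ⟨U, hU, rfl⟩ := hM
  exact ⟨U ^ m, pow_mem_powSubgroup hU m, map_pow _ _ _⟩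

theorem stabMat_of_mul_left {M N : Matrix ι ι A} (h : M * N = 1) (hM : M ∈ stabMat s) :
    N ∈ stabMat s := by
  obtain ⟨U, hU, rfl⟩ := hM
  exact ⟨U⁻¹, (vecStab s).inv_mem hU, Units.inv_eq_of_mul_eq_one_right h⟩

theorem powMat_of_mul_left {M N : Matrix ι ι A} (h : M * N ∈ powMat s m) (hM : M ∈ powMat s m) :
    N ∈ powMat s m := by
  obtain ⟨U, hU, rfl⟩ := hM
  obtain ⟨V, hV, h⟩ := h
  refine ⟨U⁻¹ * V, (powSubgroup (vecStab s) m).mul_mem (Subgroup.inv_mem _ hU) hV, ?_⟩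
  rw [map_mul, h]
  change (U⁻¹).val * (U.val * N) = N
  rw [← mul_assoc, Units.inv_mul, one_mul]

theorem powMat_of_mul_right {M N : Matrix ι ι A} (h : M * N ∈ powMat s m) (hN : N ∈ powMat s m) :
    M ∈ powMat s m := by
  obtain ⟨U, hU, rfl⟩ := hN
  obtain ⟨V, hV, h⟩ := h
  refine ⟨V * U⁻¹, (powSubgroup (vecStab s) m).mul_mem hV (Subgroup.inv_mem _ hU), ?_⟩
  rw [map_mul, h]
  change (M * U.val) * (U⁻¹).val = M
  rw [mul_assoc, Units.mul_inv, mul_one]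

theorem powMat_of_conj {D M M' : Matrix ι ι A} (hD : D ∈ stabMat s) (hM : M ∈ powMat s m)
    (h : D * M = M' * D) : M' ∈ powMat s m := by
  obtain ⟨U, hU, rfl⟩ := hD
  obtain ⟨V, hV, rfl⟩ := hM
  refine ⟨U * V * U⁻¹, conj_mem_powSubgroup hV hU, ?_⟩
  change U.val * V.val * (U⁻¹).val = M'
  change U.val * V.val = M' * U.val at h
  rw [h, mul_assoc, Units.mul_inv, mul_one]

theorem tv_mem_stabMat {y w : ι → A} (hy : w ⬝ᵥ y = 0) (hs : w ⬝ᵥ s = 0) : tv y w ∈ stabMat s := by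
  refine mem_stabMat_of_mul_eq_one (N := tv y (-w)) ?_ ?_
  · rw [tv_mul_tv_of_dotProduct_eq_zero hy, add_neg_cancel, tv_zero]
  · rw [tv_mulVec, hs, zero_smul, add_zero]

theorem tv_neg_mem_powMat {y w : ι → A} (hy : w ⬝ᵥ y = 0) (h : tv y w ∈ powMat s m) :
    tv y (-w) ∈ powMat s m := by
  refine powMat_of_mul_left (M := tv y w) ?_ h
  rw [tv_mul_tv_of_dotProduct_eq_zero hy, add_neg_cancel, tv_zero]
  exact one_mem _

theorem tv_add_mem_powMat {y v w : ι → A} (hy : v ⬝ᵥ y = 0) (hv : tv y v ∈ powMat s m)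
    (hw : tv y w ∈ powMat s m) : tv y (v + w) ∈ powMat s m := by
  rw [← tv_mul_tv_of_dotProduct_eq_zero hy]
  exact mul_mem hv hw

theorem tv_pow (y w : ι → A) (k : ℕ) :
    tv y w ^ k = tv y ((∑ i ∈ Finset.range k, (1 + w ⬝ᵥ y) ^ i) • w) := by
  induction k with
  | zero => simp [tv_zero]
  | succ k ih =>
    rw [pow_succ', ih, tv_mul_tv, geom_sum_succ, smul_smul, add_smul, one_smul, add_comm]

theorem tv_natCast_smul_mem_powMat {y w : ι → A} (hy : w ⬝ᵥ y = 0) (hs : w ⬝ᵥ s = 0) :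
    tv y ((m : A) • w) ∈ powMat s m := by
  have h := pow_mem_powMat (m := m) (tv_mem_stabMat hy hs)
  rw [tv_pow, hy] at h
  simpa using h

/-- The transvection `1 + (1 + c + ⋯ + c ^ (m - 1)) y w` is a product of `m`-th powers if some
matrix fixing `s` and `y` has `w` as a left eigenvector with eigenvalue `c`. -/
theorem tv_geom_sum_smul_mem_powMat {y w : ι → A} {D : Matrix ι ι A} {c : A} (hD : D ∈ stabMat s)
    (hDy : D *ᵥ y = y) (hwD : w ᵥ* D = c • w) (hy : w ⬝ᵥ y = 0) (hs : w ⬝ᵥ s = 0) :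
    tv y ((∑ i ∈ Finset.range m, c ^ i) • w) ∈ powMat s m := by
  have hcomm : ∀ a : A, tv y (a • w) * D = D * tv y ((c * a) • w) := by
    intro a
    rw [tv_mul, mul_tv, hDy, smul_vecMul, hwD, smul_smul, mul_comm]
  -- Each passage of `D` to the left across `1 + a y w` multiplies `a` by `c`, so collecting all
  -- factors `D` on the left leaves the geometric sum.
  have hpow : ∀ k : ℕ, (D * tv y w) ^ k = D ^ k * tv y ((∑ i ∈ Finset.range k, c ^ i) • w) := by
    intro k
    induction k with
    | zero => simp [tv_zero]
    | succ k ih =>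
      rw [pow_succ, ih, pow_succ, mul_assoc, ← mul_assoc _ D, hcomm, mul_assoc D,
        tv_mul_tv_of_dotProduct_eq_zero (by rw [smul_dotProduct, hy, smul_zero]), ← mul_assoc,
        geom_sum_succ, add_smul, one_smul]
  refine powMat_of_mul_left (M := D ^ m) ?_ (pow_mem_powMat hD)
  rw [← hpow]
  exact pow_mem_powMat (mul_mem hD (tv_mem_stabMat hy hs))

end PowMat

/-! ### Koszul rows and their multiples by `geom` -/

section Generators

open Matrix

variable {ι A : Type*} [Fintype ι] [DecidableEq ι] [CommRing A] (X : ι → Aˣ) {m : ℕ}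

/-- The vector with entries `X i - 1`. -/
def subOne (i : ι) : A := (X i : A) - 1

/-- The sum `1 + X i + ⋯ + X i ^ (m - 1)`. -/
def geom (m : ℕ) (i : ι) : A := ∑ k ∈ Finset.range m, (X i : A) ^ k

/-- The Koszul syzygy `σ_i e_j - σ_j e_i`. -/
def kos (i j : ι) : ι → A := subOne X i • Pi.single j 1 - subOne X j • Pi.single i 1

theorem kos_dotProduct (i j : ι) (v : ι → A) :
    kos X i j ⬝ᵥ v = subOne X i * v j - subOne X j * v i := by
  simp [kos, sub_dotProduct]

theorem kos_dotProduct_subOne (i j : ι) : kos X i j ⬝ᵥ subOne X = 0 := by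
  rw [kos_dotProduct]; ring

theorem kos_left {i j : ι} (h : i ≠ j) : kos X i j i = - subOne X j := by
  simp [kos, h]

theorem kos_right {i j : ι} (h : i ≠ j) : kos X i j j = subOne X i := by
  simp [kos, h.symm]

theorem kos_of_ne {i j k : ι} (hi : k ≠ i) (hj : k ≠ j) : kos X i j k = 0 := by
  simp [kos, hi, hj]

theorem kos_swap (i j : ι) : kos X j i = - kos X i j := by
  rw [kos, kos]; abel

variable {X}

/-- The `u`-th diagonal entry is the unit `c`, so the inverse adds `-c⁻¹ q` to row `u` instead. -/
theorem tv_single_mem_stabMat {u : ι} {q : ι → A} {c : Aˣ} (hq : q u = (c : A) - 1)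
    (hs : q ⬝ᵥ subOne X = 0) : tv (Pi.single u 1) q ∈ stabMat (subOne X) := by
  refine mem_stabMat_of_mul_eq_one (N := tv (Pi.single u 1) (-((c⁻¹ : Aˣ) : A) • q)) ?_ ?_
  · rw [tv_mul_tv, dotProduct_single_one, hq, smul_smul]
    have h : q + ((1 + ((c : A) - 1)) * -((c⁻¹ : Aˣ) : A)) • q = 0 := by
      rw [add_sub_cancel, mul_neg, Units.mul_inv, neg_one_smul, add_neg_cancel]
    rw [h, tv_zero]
  · rw [tv_mulVec, hs, zero_smul, add_zero]

variable (X)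

/-- The matrix scaling row `u` by `X r`, corrected so as to fix `subOne X`. -/
def scaling (u r : ι) : Matrix ι ι A := tv (Pi.single u 1) (kos X r u)

variable {X}

theorem scaling_mem_stabMat {u r : ι} (h : r ≠ u) : scaling X u r ∈ stabMat (subOne X) :=
  tv_single_mem_stabMat (kos_right X h) (kos_dotProduct_subOne X r u)

theorem scaling_pow {u r : ι} (h : r ≠ u) (k : ℕ) :
    scaling X u r ^ k = tv (Pi.single u 1) (geom X k r • kos X r u) := by
  rw [scaling, tv_pow, dotProduct_single_one, kos_right X h, subOne, add_sub_cancel, geom]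

variable (X)

/-- The scalar matrix `X r`, corrected so as to fix `subOne X`. -/
def scalar (r : ι) : Matrix ι ι A := (X r : A) • 1 - vecMulVec (subOne X) (Pi.single r 1)

variable {X}

theorem scalar_mulVec (r : ι) (v : ι → A) : scalar X r *ᵥ v = (X r : A) • v - v r • subOne X := by
  rw [scalar, sub_mulVec, smul_mulVec, one_mulVec, vecMulVec_mulVec, op_smul_eq_smul,
    single_one_dotProduct]

theorem vecMul_scalar (r : ι) (v : ι → A) :
    v ᵥ* scalar X r = (X r : A) • v - (v ⬝ᵥ subOne X) • Pi.single r 1 := by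
  rw [scalar, vecMul_sub, vecMul_smul, vecMul_one, vecMul_vecMulVec]

theorem scalar_mem_stabMat (r : ι) : scalar X r ∈ stabMat (subOne X) := by
  refine mem_stabMat_of_mul_eq_one
    (N := ((X r)⁻¹ : Aˣ).val • tv (subOne X) (Pi.single r 1)) ?_ ?_
  · rw [mul_smul_comm, mul_tv, scalar_mulVec, scalar, ← sub_smul]
    have h : (X r : A) - subOne X r = 1 := by rw [subOne]; ring
    rw [h, one_smul, sub_add_cancel, smul_smul, Units.inv_mul, one_smul]
  · rw [scalar_mulVec, ← sub_smul]
    have h : (X r : A) - subOne X r = 1 := by rw [subOne]; ring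
    rw [h, one_smul]

/-- The eigenvector principle applies to `scalar X r`: it fixes `subOne X` because `X r - (X r - 1)
= 1`, and it multiplies every row orthogonal to `subOne X` by `X r`. -/
theorem tv_subOne_geom_mem_powMat (r : ι) {w : ι → A} (hs : w ⬝ᵥ subOne X = 0) :
    tv (subOne X) (geom X m r • w) ∈ powMat (subOne X) m := by
  refine tv_geom_sum_smul_mem_powMat (scalar_mem_stabMat r) ?_ ?_ hs hs
  · rw [scalar_mulVec, ← sub_smul]
    have h : (X r : A) - subOne X r = 1 := by rw [subOne]; ring
    rw [h, one_smul]
  · rw [vecMul_scalar, hs, zero_smul, sub_zero]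

variable (X)

/-- The column `σ_v e_v + σ_j e_j`. -/
def pairCol (v j : ι) : ι → A := subOne X v • Pi.single v 1 + subOne X j • Pi.single j 1

theorem kos_dotProduct_pairCol (v j : ι) : kos X j v ⬝ᵥ pairCol X v j = 0 := by
  rw [kos_dotProduct]
  by_cases h : v = j
  · subst h; ring
  · simp [pairCol, h, Ne.symm h]; ring

theorem pairCol_comm (v j : ι) : pairCol X v j = pairCol X j v := by
  rw [pairCol, pairCol, add_comm]

variable {X}

/-- Here the eigenvector principle uses `scaling X v j`. It multiplies the row `kos X j v` by `X j`,
and it fixes the column `pairCol X v j` since that column is orthogonal to the row. -/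
theorem tv_pairCol_geom_mem_powMat {v j : ι} (h : j ≠ v) (b : A) :
    tv (pairCol X v j) ((geom X m j * b) • kos X j v) ∈ powMat (subOne X) m := by
  have h0 : kos X j v ⬝ᵥ pairCol X v j = 0 := kos_dotProduct_pairCol X v j
  rw [mul_smul]
  refine tv_geom_sum_smul_mem_powMat (scaling_mem_stabMat (u := v) h) ?_ ?_ ?_ ?_
  · rw [scaling, tv_mulVec, h0, zero_smul, add_zero]
  · rw [scaling, vecMul_tv, dotProduct_single_one, Pi.smul_apply, kos_right X h, smul_smul,
      ← add_smul, subOne, smul_eq_mul]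
    congr 1; ring
  · rw [smul_dotProduct, h0, smul_zero]
  · rw [smul_dotProduct, kos_dotProduct_subOne, smul_zero]

theorem tv_pairCol_natCast_mem_powMat (v j : ι) (b : A) :
    tv (pairCol X v j) (((m : A) * b) • kos X j v) ∈ powMat (subOne X) m := by
  rw [mul_smul]
  refine tv_natCast_smul_mem_powMat ?_ ?_
  · rw [smul_dotProduct, kos_dotProduct_pairCol, smul_zero]
  · rw [smul_dotProduct, kos_dotProduct_subOne, smul_zero]

/-- The rows `w` with vanishing `u`-th entry such that adding `w` to the `u`-th row of the identity
gives a product of `m`-th powers. -/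
def rowGroup (X : ι → Aˣ) (m : ℕ) (u : ι) : AddSubgroup (ι → A) where
  carrier := {w | w u = 0 ∧ w ⬝ᵥ subOne X = 0 ∧ tv (Pi.single u 1) w ∈ powMat (subOne X) m}
  zero_mem' := ⟨rfl, zero_dotProduct _, by rw [tv_zero]; exact one_mem _⟩
  add_mem' := fun {v w} hv hw => ⟨by rw [Pi.add_apply, hv.1, hw.1, add_zero],
    by rw [add_dotProduct, hv.2.1, hw.2.1, add_zero],
    tv_add_mem_powMat (by rw [dotProduct_single_one, hv.1]) hv.2.2 hw.2.2⟩
  neg_mem' := fun {w} hw => ⟨by rw [Pi.neg_apply, hw.1, neg_zero],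
    by rw [neg_dotProduct, hw.2.1, neg_zero],
    tv_neg_mem_powMat (by rw [dotProduct_single_one, hw.1]) hw.2.2⟩

theorem natCast_smul_mem_rowGroup {u : ι} {w : ι → A} (hu : w u = 0) (hs : w ⬝ᵥ subOne X = 0) :
    (m : A) • w ∈ rowGroup X m u :=
  ⟨by rw [Pi.smul_apply, hu, smul_zero], by rw [smul_dotProduct, hs, smul_zero],
    tv_natCast_smul_mem_powMat (by rw [dotProduct_single_one, hu]) hs⟩

/-- Adding `w + kos X r u` to row `u` gives a matrix whose diagonal entry there is `X r`. Its `m`-th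
power adds `geom X m r • (w + kos X r u)`. Dividing by the `m`-th power for `w = 0` leaves the
required row. -/
theorem geom_smul_mem_rowGroup {u r : ι} (hr : r ≠ u) {w : ι → A} (hu : w u = 0)
    (hs : w ⬝ᵥ subOne X = 0) : geom X m r • w ∈ rowGroup X m u := by
  refine ⟨by rw [Pi.smul_apply, hu, smul_zero], by rw [smul_dotProduct, hs, smul_zero], ?_⟩
  have h1 : tv (Pi.single u 1) (w + kos X r u) ∈ stabMat (subOne X) :=
    tv_single_mem_stabMat (c := X r)
      (by rw [Pi.add_apply, hu, kos_right X hr, zero_add, subOne])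
      (by rw [add_dotProduct, hs, kos_dotProduct_subOne, add_zero])
  refine powMat_of_mul_right (N := scaling X u r ^ m) ?_ (pow_mem_powMat (scaling_mem_stabMat hr))
  have h2 := pow_mem_powMat (m := m) h1
  rw [tv_pow, dotProduct_single_one, Pi.add_apply, hu, kos_right X hr, zero_add, subOne,
    add_sub_cancel, ← geom, smul_add] at h2
  rwa [scaling_pow hr, tv_mul_tv_of_dotProduct_eq_zero]
  rw [dotProduct_single_one, Pi.smul_apply, hu, smul_zero]

/-- The previous lemma excludes the factor `geom X m u` in row `u` itself, but it applies in an
auxiliary row `l`. Conjugation by `scaling X u l` turns the column `e_l` into `e_l - σ_u e_u` and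
leaves the row alone, since its entries at `u` and `l` vanish. The quotient by the original matrix
lives in row `u` and has acquired the factor `σ_u`. -/
theorem subOne_mul_geom_smul_kos_mem_rowGroup {u i k l : ι} (hiu : i ≠ u) (hku : k ≠ u)
    (hlu : l ≠ u) (hli : l ≠ i) (hlk : l ≠ k) (b : A) :
    (subOne X u * geom X m u * b) • kos X i k ∈ rowGroup X m u := by
  have hu : kos X i k u = 0 := kos_of_ne X hiu.symm hku.symm
  have hl : kos X i k l = 0 := kos_of_ne X hli hlk
  refine ⟨by rw [Pi.smul_apply, hu, smul_zero],
    by rw [smul_dotProduct, kos_dotProduct_subOne, smul_zero], ?_⟩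
  have h1 := geom_smul_mem_rowGroup (X := X) (m := m) (u := l) (r := u) hlu.symm
    (w := b • kos X i k) (by rw [Pi.smul_apply, hl, smul_zero])
    (by rw [smul_dotProduct, kos_dotProduct_subOne, smul_zero])
  rw [smul_smul] at h1
  set w := (geom X m u * b) • kos X i k with hw
  have hwu : w u = 0 := by rw [hw, Pi.smul_apply, hu, smul_zero]
  have hwl : w l = 0 := by rw [hw, Pi.smul_apply, hl, smul_zero]
  have h2 : tv (Pi.single l 1 - subOne X u • Pi.single u 1) w ∈ powMat (subOne X) m := by
    refine powMat_of_conj (scaling_mem_stabMat (u := u) hlu) h1.2.2 ?_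
    rw [scaling, mul_tv, tv_mul, tv_mulVec, vecMul_tv, dotProduct_single_one, dotProduct_single_one,
      kos_left X hlu, hwu, zero_smul, add_zero, neg_smul, ← sub_eq_add_neg]
  have h3 := tv_neg_mem_powMat (by rw [dotProduct_single_one, hwl]) h1.2.2
  have h4 := mul_mem h2 h3
  have h5 : tv (Pi.single l 1 - subOne X u • Pi.single u 1) w * tv (Pi.single l 1) (-w) =
      tv (Pi.single u 1) (-(subOne X u • w)) := by
    rw [mul_tv, tv_mulVec, dotProduct_single_one, hwl, zero_smul, add_zero, tv, tv, sub_vecMulVec]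
    simp only [vecMulVec_neg, smul_vecMulVec, vecMulVec_smul]
    abel
  rw [h5] at h4
  have h6 := tv_neg_mem_powMat (by rw [neg_dotProduct, smul_dotProduct, dotProduct_single_one, hwu,
    smul_zero, neg_zero]) h4
  rwa [neg_neg, hw, smul_smul, ← mul_assoc] at h6

end Generators

theorem exists_eq_sum_of_mem_span_image {ι A : Type*} [DecidableEq ι] [CommRing A] {S : Finset ι}
    {t : ι → A} {y : A} (hy : y ∈ Ideal.span (t '' S)) :
    ∃ a : ι → A, (∀ j ∉ S, a j = 0) ∧ ∑ j ∈ S, a j * t j = y := by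
  obtain ⟨a, ha⟩ := (Submodule.mem_span_image_finset_iff_exists_fun A).1 hy
  refine ⟨fun j => if h : j ∈ S then a ⟨j, h⟩ else 0, fun j hj => dif_neg hj, ?_⟩
  rw [← ha, ← Finset.sum_coe_sort S]
  exact Finset.sum_congr rfl fun j _ => by simp

/-! ### Setting some of the variables to one -/

section Retraction

variable {n : ℕ}

theorem ringHom_ext_x {B : Type*} [Ring B] {f g : R n →+* B}
    (h : ∀ i, f (x n i) = g (x n i)) : f = g := by
  refine AddMonoidAlgebra.ringHom_ext' (Subsingleton.elim _ _) ?_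
  have key : (Units.map (f : R n →* B)).comp (mon n) = (Units.map (g : R n →* B)).comp (mon n) := by
    rw [← MonoidHom.cancel_right (g₁ := (Units.map (f : R n →* B)).comp (mon n))
      (deg_surjective (n := n))]
    ext1 i
    ext1
    simp only [MonoidHom.comp_apply, deg, FreeGroup.lift_apply_of, mon_single]
    exact h i
  refine MonoidHom.ext fun w => ?_
  exact congrArg Units.val (DFunLike.congr_fun key w)

/-- The ring endomorphism of `R_n` which sends `x_i` to `1` for `i ∉ S`. -/
noncomputable def keep (S : Finset (Fin n)) : R n →+* R n :=
  AddMonoidAlgebra.mapDomainRingHom ℤ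
    { toFun := fun g i => if i ∈ S then g i else 0
      map_zero' := by ext; simp
      map_add' := fun g h => by ext i; by_cases hi : i ∈ S <;> simp [hi] }

theorem keep_single (S : Finset (Fin n)) (g : Fin n → ℤ) (c : ℤ) :
    keep S (AddMonoidAlgebra.single g c) =
      AddMonoidAlgebra.single (fun i => if i ∈ S then g i else 0) c :=
  AddMonoidAlgebra.mapDomain_single

theorem keep_x_of_mem {S : Finset (Fin n)} {i : Fin n} (hi : i ∈ S) :
    keep S (x n i : R n) = x n i := by
  change keep S (AddMonoidAlgebra.single (Pi.single i 1) 1) =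
    AddMonoidAlgebra.single (Pi.single i 1) 1
  rw [keep_single]
  congr 1
  ext j
  by_cases hj : j = i
  · subst hj; simp [hi]
  · simp [hj]

theorem keep_x_of_notMem {S : Finset (Fin n)} {i : Fin n} (hi : i ∉ S) :
    keep S (x n i : R n) = 1 := by
  change keep S (AddMonoidAlgebra.single (Pi.single i 1) 1) = AddMonoidAlgebra.single 0 1
  rw [keep_single]
  congr 1
  ext j
  by_cases hj : j = i
  · subst hj; simp [hi]
  · simp [hj]

theorem keep_keep (S T : Finset (Fin n)) (f : R n) : keep S (keep T f) = keep (S ∩ T) f := by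
  have h : (keep S).comp (keep T) = keep (S ∩ T) := by
    refine ringHom_ext_x fun i => ?_
    rw [RingHom.comp_apply]
    by_cases hT : i ∈ T
    · rw [keep_x_of_mem hT]
      by_cases hS : i ∈ S
      · rw [keep_x_of_mem hS, keep_x_of_mem (Finset.mem_inter.2 ⟨hS, hT⟩)]
      · rw [keep_x_of_notMem hS, keep_x_of_notMem fun h => hS (Finset.mem_inter.1 h).1]
    · rw [keep_x_of_notMem hT, map_one, keep_x_of_notMem fun h => hT (Finset.mem_inter.1 h).2]
  exact DFunLike.congr_fun h f

theorem keep_univ (f : R n) : keep Finset.univ f = f := by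
  have h : keep (Finset.univ : Finset (Fin n)) = RingHom.id _ :=
    ringHom_ext_x fun i => keep_x_of_mem (Finset.mem_univ i)
  exact DFunLike.congr_fun h f

theorem keep_σ_of_mem {S : Finset (Fin n)} {i : Fin n} (hi : i ∈ S) :
    keep S (σ n i) = σ n i := by
  rw [σ, map_sub, map_one, keep_x_of_mem hi]

theorem keep_σ_of_notMem {S : Finset (Fin n)} {i : Fin n} (hi : i ∉ S) : keep S (σ n i) = 0 := by
  rw [σ, map_sub, map_one, keep_x_of_notMem hi, sub_self]

/-- An element differs from its retraction by a combination of the `σ_i` with `i ∉ S`. -/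
theorem exists_sub_keep_eq (S : Finset (Fin n)) (f : R n) :
    ∃ a : Fin n → R n, f - keep S f = ∑ i ∈ Sᶜ, a i * σ n i := by
  let J : Ideal (R n) := Ideal.span (σ n '' (Sᶜ : Finset (Fin n)))
  have h : (Ideal.Quotient.mk J) = (Ideal.Quotient.mk J).comp (keep S) := by
    refine ringHom_ext_x fun i => ?_
    rw [RingHom.comp_apply]
    by_cases hi : i ∈ S
    · rw [keep_x_of_mem hi]
    · rw [keep_x_of_notMem hi, Ideal.Quotient.eq]
      exact Ideal.subset_span ⟨i, by simpa using hi, rfl⟩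
  have h1 : f - keep S f ∈ J := by
    rw [← Ideal.Quotient.eq]
    exact DFunLike.congr_fun h f
  obtain ⟨a, -, ha⟩ := exists_eq_sum_of_mem_span_image h1
  exact ⟨a, ha.symm⟩

end Retraction

/-! ### Slices in one variable and exactness of the Koszul complex -/

section Slices

variable {n : ℕ}

/-- The part of a Laurent polynomial in which `x_j` has exponent `k`. -/
noncomputable def slice (j : Fin n) (k : ℤ) : R n →+ R n :=
  (AddMonoidAlgebra.coeffAddEquiv.symm.toAddMonoidHom.comp
    (Finsupp.filterAddHom fun g : Fin n → ℤ => g j = k)).comp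
      AddMonoidAlgebra.coeffAddEquiv.toAddMonoidHom

theorem coeff_slice (j : Fin n) (k : ℤ) (f : R n) (g : Fin n → ℤ) :
    (slice j k f).coeff g = if g j = k then f.coeff g else 0 := by
  change (Finsupp.filter _ f.coeff) g = _
  rw [Finsupp.filter_apply]

theorem slice_single (j : Fin n) (k : ℤ) (g : Fin n → ℤ) (c : ℤ) :
    slice j k (AddMonoidAlgebra.single g c) =
      if g j = k then AddMonoidAlgebra.single g c else 0 := by
  ext h
  rw [coeff_slice]
  by_cases hg : g = h
  · subst hg; split_ifs <;> simp
  · split_ifs <;> simp [Ne.symm hg]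

theorem slice_keep_mul (j : Fin n) (k : ℤ) (t f : R n) :
    slice j k (keep {j}ᶜ t * f) = keep {j}ᶜ t * slice j k f := by
  let L : R n →+ R n →+ R n :=
    (AddMonoidHom.compHom (slice j k)).comp (AddMonoidHom.mul.comp (keep {j}ᶜ).toAddMonoidHom)
  let L' : R n →+ R n →+ R n :=
    ((AddMonoidHom.compHom.flip (slice j k)).comp
      (AddMonoidHom.mul.comp (keep {j}ᶜ).toAddMonoidHom))
  suffices h : L = L' from DFunLike.congr_fun (DFunLike.congr_fun h t) f
  refine AddMonoidAlgebra.addMonoidHom_ext fun g c => ?_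
  refine AddMonoidAlgebra.addMonoidHom_ext fun h d => ?_
  change slice j k (keep {j}ᶜ (AddMonoidAlgebra.single g c) * AddMonoidAlgebra.single h d) =
    keep {j}ᶜ (AddMonoidAlgebra.single g c) * slice j k (AddMonoidAlgebra.single h d)
  rw [keep_single, AddMonoidAlgebra.single_mul_single, slice_single, slice_single]
  by_cases hh : h j = k
  · simp [hh, AddMonoidAlgebra.single_mul_single]
  · simp [hh]

theorem slice_x_pow_mul (j : Fin n) (k : ℤ) (m : ℕ) (f : R n) :
    slice j k ((x n j : R n) ^ m * f) = (x n j : R n) ^ m * slice j (k - m) f := by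
  have hx : (x n j : R n) ^ m = AddMonoidAlgebra.single (m • Pi.single j 1) 1 := by
    change (AddMonoidAlgebra.single (Pi.single j 1) 1 : R n) ^ m = _
    rw [AddMonoidAlgebra.single_pow, one_pow]
  rw [hx]
  let L : R n →+ R n :=
    (slice j k).comp (AddMonoidHom.mulLeft (AddMonoidAlgebra.single (m • Pi.single j 1) 1))
  let L' : R n →+ R n :=
    (AddMonoidHom.mulLeft (AddMonoidAlgebra.single (m • Pi.single j 1) 1)).comp (slice j (k - m))
  suffices h : L = L' from DFunLike.congr_fun h f
  refine AddMonoidAlgebra.addMonoidHom_ext fun g c => ?_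
  change slice j k (AddMonoidAlgebra.single (m • Pi.single j 1) 1 * AddMonoidAlgebra.single g c) =
    AddMonoidAlgebra.single (m • Pi.single j 1) 1 * slice j (k - m) (AddMonoidAlgebra.single g c)
  rw [AddMonoidAlgebra.single_mul_single, slice_single, slice_single]
  have h1 : (m • (Pi.single j 1 : Fin n → ℤ) + g) j = m + g j := by simp
  rw [h1]
  by_cases hg : g j = k - m
  · rw [if_pos (by omega), if_pos hg, AddMonoidAlgebra.single_mul_single]
  · rw [if_neg (by omega), if_neg hg, mul_zero]

/-- An ideal is slice-stable in the variable `x_j` if it contains all slices of its elements. -/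
def SliceStable (j : Fin n) (J : Ideal (R n)) : Prop := ∀ f ∈ J, ∀ k, slice j k f ∈ J

theorem sliceStable_span {j : Fin n} {s : Set (R n)} (hs : ∀ t ∈ s, keep {j}ᶜ t = t) :
    SliceStable j (Ideal.span s) := by
  intro f hf k
  induction hf using Submodule.span_induction with
  | mem t ht =>
    have h := slice_keep_mul j k t 1
    rw [hs t ht, mul_one] at h
    rw [h]
    exact Ideal.mul_mem_right _ _ (Ideal.subset_span ht)
  | zero => rw [map_zero]; exact Ideal.zero_mem _
  | add f g _ _ hf hg => rw [map_add]; exact Ideal.add_mem _ hf hg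
  | smul a f hf' _ =>
    -- Slicing is not linear over the ring, so the induction hypothesis for `f` alone is too weak. A
    -- second induction treats `a * f` for all `a` at once.
    clear * - hf' hs
    induction hf' using Submodule.span_induction generalizing a with
    | mem t ht =>
      have h := slice_keep_mul j k t a
      rw [hs t ht] at h
      rw [smul_eq_mul, mul_comm, h]
      exact Ideal.mul_mem_right _ _ (Ideal.subset_span ht)
    | zero => rw [smul_zero, map_zero]; exact Ideal.zero_mem _
    | add f g _ _ hf hg => rw [smul_add, map_add]; exact Ideal.add_mem _ (hf a) (hg a)
    | smul b f _ hf => rw [smul_smul]; exact hf _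

theorem mem_of_slice_mem {j : Fin n} {J : Ideal (R n)} {f : R n} (h : ∀ k, slice j k f ∈ J) :
    f ∈ J := by
  have hf : f = ∑ k ∈ f.coeff.support.image fun g => g j, slice j k f := by
    ext g
    rw [AddMonoidAlgebra.coeff_sum, Finsupp.finsetSum_apply]
    simp only [coeff_slice]
    rw [Finset.sum_ite_eq]
    split_ifs with hg
    · rfl
    · by_contra hne
      exact hg (Finset.mem_image.2 ⟨g, Finsupp.mem_support_iff.2 hne, rfl⟩)
  rw [hf]
  exact Ideal.sum_mem _ fun k _ => h k

/-- `x_j ^ m - 1` is a nonzerodivisor modulo a slice-stable ideal. -/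
theorem mem_of_x_pow_sub_one_mul_mem {j : Fin n} {J : Ideal (R n)} (hJ : SliceStable j J) {m : ℕ}
    (hm : m ≠ 0) {f : R n} (hf : ((x n j : R n) ^ m - 1) * f ∈ J) : f ∈ J := by
  have h1 : ∀ k, (x n j : R n) ^ m * slice j (k - m) f - slice j k f ∈ J := by
    intro k
    have h := hJ _ hf k
    rwa [sub_mul, one_mul, map_sub, slice_x_pow_mul] at h
  obtain ⟨K, hK⟩ : ∃ K : ℤ, ∀ k < K, slice j k f = 0 := by
    obtain ⟨K, hK⟩ := (f.coeff.support.image fun g => g j).bddBelow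
    refine ⟨K, fun k hk => ?_⟩
    ext g
    rw [coeff_slice]
    split_ifs with hg
    · by_contra hne
      have := hK (Finset.mem_coe.2 (Finset.mem_image.2 ⟨g, Finsupp.mem_support_iff.2 hne, rfl⟩))
      omega
    · rfl
  -- The slices satisfy `f_k ≡ x_j ^ m f_{k - m}` modulo `J` and vanish below the support, so
  -- membership propagates upwards. The index really drops because `m ≠ 0`.
  have h2 : ∀ q : ℕ, ∀ k < K + q, slice j k f ∈ J := by
    intro q
    induction q with
    | zero => intro k hk; rw [hK k (by simpa using hk)]; exact J.zero_mem
    | succ q ih =>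
      intro k hk
      have h3 := J.mul_mem_left ((x n j : R n) ^ m) (ih (k - m) (by push_cast at hk; omega))
      have h4 := J.sub_mem h3 (h1 k)
      rwa [sub_sub_cancel] at h4
  refine mem_of_slice_mem fun k => h2 (k - K + 1).toNat k ?_
  have := Int.self_le_toNat (k - K + 1)
  omega

/-- Exactness of the Koszul complex of the elements `x_j ^ m - 1`, `j ∈ S`, in degree one,
modulo an ideal defined without the variables in `S`. -/
theorem koszul_exact {m : ℕ} (hm : m ≠ 0) (S : Finset (Fin n)) {J : Ideal (R n)}
    (hJ : ∀ s : Set (Fin n), ∀ j ∈ S, j ∉ s →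
      SliceStable j (J ⊔ Ideal.span ((fun i => (x n i : R n) ^ m - 1) '' s)))
    {f : Fin n → R n} (hf0 : ∀ j ∉ S, f j = 0)
    (hf : ∑ j ∈ S, ((x n j : R n) ^ m - 1) * f j ∈ J) :
    ∃ (a : Fin n → Fin n → R n) (q : Fin n → R n), (∀ j, q j ∈ J) ∧ (∀ j ∉ S, q j = 0) ∧
      (∀ r s, a r s ≠ 0 → r ∈ S ∧ s ∈ S ∧ r ≠ s) ∧
      f = q + ∑ r, ∑ s, a r s • (((x n s : R n) ^ m - 1) • Pi.single r 1 -
        ((x n r : R n) ^ m - 1) • Pi.single s 1) := by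
  classical
  induction S using Finset.induction_on generalizing f with
  | empty =>
    refine ⟨0, 0, fun _ => J.zero_mem, fun _ _ => rfl, fun r s h => absurd rfl h, ?_⟩
    ext1 j
    simp [hf0 j]
  | insert j0 S hj0 ih =>
    rw [Finset.sum_insert hj0] at hf
    -- The new element `x_{j0} ^ m - 1` is a nonzerodivisor modulo `J` and the elements for `S`, as
    -- that ideal is slice-stable in `x_{j0}`.
    have h1 : f j0 ∈ J ⊔ Ideal.span ((fun i => (x n i : R n) ^ m - 1) '' S) := by
      refine mem_of_x_pow_sub_one_mul_mem
        (hJ S j0 (Finset.mem_insert_self _ _) (by simpa using hj0)) hm ?_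
      rw [← add_sub_cancel_right (((x n j0 : R n) ^ m - 1) * f j0)
        (∑ j ∈ S, ((x n j : R n) ^ m - 1) * f j)]
      refine Ideal.sub_mem _ (Ideal.mem_sup_left hf) (Ideal.mem_sup_right ?_)
      exact Ideal.sum_mem _ fun j hj => Ideal.mul_mem_right _ _
        (Ideal.subset_span ⟨j, by simpa using hj, rfl⟩)
    obtain ⟨q0, hq0, y, hy, hqy⟩ := Submodule.mem_sup.1 h1
    obtain ⟨g, hg0, hg⟩ := exists_eq_sum_of_mem_span_image hy
    -- What remains after subtracting `q0` in position `j0` and the Koszul relations with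
    -- coefficients `g` that pair `j0` with `S`.
    let f' : Fin n → R n := fun j => if j ∈ S then f j + ((x n j0 : R n) ^ m - 1) * g j else 0
    obtain ⟨a, q, hq, hqS, ha, hfq⟩ := ih (f := f')
      (fun s j hj hjs => hJ s j (Finset.mem_insert_of_mem hj) hjs)
      (fun j hj => if_neg hj) (by
        have h2 : ∑ j ∈ S, ((x n j : R n) ^ m - 1) * f' j =
            (((x n j0 : R n) ^ m - 1) * f j0 + ∑ j ∈ S, ((x n j : R n) ^ m - 1) * f j)
            - ((x n j0 : R n) ^ m - 1) * q0 := by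
          have h3 : ∑ j ∈ S, ((x n j : R n) ^ m - 1) * f' j =
              ∑ j ∈ S, (((x n j : R n) ^ m - 1) * f j +
                ((x n j0 : R n) ^ m - 1) * (g j * ((x n j : R n) ^ m - 1))) :=
            Finset.sum_congr rfl fun j hj => by simp only [f', if_pos hj]; ring
          rw [h3, Finset.sum_add_distrib, ← Finset.mul_sum, hg, ← hqy]
          ring
        rw [h2]
        exact J.sub_mem hf (J.mul_mem_left _ hq0))
    refine ⟨fun r s => a r s + if r = j0 then g s else 0, q + Pi.single j0 q0, ?_, ?_, ?_, ?_⟩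
    · intro j
      refine J.add_mem (hq j) ?_
      by_cases hj : j = j0
      · subst hj; rwa [Pi.single_eq_same]
      · rw [Pi.single_eq_of_ne hj]; exact J.zero_mem
    · intro j hj
      rw [Finset.mem_insert, not_or] at hj
      rw [Pi.add_apply, hqS j hj.2, Pi.single_eq_of_ne hj.1, add_zero]
    · intro r s hrs
      by_cases has : a r s = 0
      · have hr : r = j0 := by
          by_contra hr
          simp [has, hr] at hrs
        have hs : s ∈ S := by
          by_contra hs
          simp [has, hg0 s hs] at hrs
        refine ⟨hr ▸ Finset.mem_insert_self _ _, Finset.mem_insert_of_mem hs, ?_⟩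
        rintro rfl
        exact hj0 (hr ▸ hs)
      · obtain ⟨h1, h2, h3⟩ := ha r s has
        exact ⟨Finset.mem_insert_of_mem h1, Finset.mem_insert_of_mem h2, h3⟩
    · have h5 : f = f' + (Pi.single j0 (f j0) - ((x n j0 : R n) ^ m - 1) • g) := by
        ext1 j
        by_cases hj : j ∈ S
        · have hjj : j ≠ j0 := fun h => hj0 (h ▸ hj)
          simp [f', hj, hjj]
        · by_cases hjj : j = j0
          · subst hjj; simp [f', hj, hg0 j hj]
          · have := hf0 j (by simp [hj, hjj])
            simp [f', hj, hjj, this, hg0 j hj]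
      have h6 : ∑ r, ∑ s, (if r = j0 then g s else 0) •
          (((x n s : R n) ^ m - 1) • (Pi.single r 1 : Fin n → R n) -
            ((x n r : R n) ^ m - 1) • Pi.single s 1) =
          Pi.single j0 (f j0 - q0) - ((x n j0 : R n) ^ m - 1) • g := by
        rw [Finset.sum_eq_single j0 (fun r _ hr => by simp [hr]) (by simp)]
        simp only [if_true, smul_sub, Finset.sum_sub_distrib]
        congr 1
        · have h7 : f j0 - q0 = ∑ s, g s * ((x n s : R n) ^ m - 1) := by
            rw [← Finset.sum_subset (Finset.subset_univ S) (fun s _ hs => by rw [hg0 s hs, zero_mul]),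
              hg, ← hqy]
            ring
          simp only [smul_smul, ← Finset.sum_smul, ← h7]
          rw [← Pi.single_smul, smul_eq_mul, mul_one]
        · ext1 i
          rw [Finset.sum_apply, Finset.sum_eq_single i]
          · simp [mul_comm]
          · intro s _ hs; simp [Ne.symm hs]
          · simp
      simp only [add_smul, Finset.sum_add_distrib]
      rw [h6]
      conv_lhs => rw [h5, hfq]
      rw [Pi.single_sub]
      abel

end Slices

/-! ### A criterion for a row to come from a product of `m`-th powers -/

section RowKilling

variable {n : ℕ}

theorem subOne_x : subOne (x n) = σ n := rfl

/-- The element `x_i ^ m - 1`. -/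
noncomputable def τ (n m : ℕ) (i : Fin n) : R n := (x n i : R n) ^ m - 1

theorem geom_mul_σ (m : ℕ) (i : Fin n) : geom (x n) m i * σ n i = τ n m i :=
  geom_sum_mul _ m

theorem σ_mul_geom (m : ℕ) (i : Fin n) : σ n i * geom (x n) m i = τ n m i := by
  rw [mul_comm, geom_mul_σ]

theorem mem_H_iff {m : ℕ} {f : R n} :
    f ∈ H n m ↔ ∃ (a : R n) (b : Fin n → R n), f = m * a + ∑ i, b i * τ n m i := by
  constructor
  · intro hf
    obtain ⟨y, hy, z, hz, rfl⟩ := Submodule.mem_sup.1 hf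
    obtain ⟨b, rfl⟩ := Ideal.mem_span_range_iff_exists_fun.1 hy
    obtain ⟨a, rfl⟩ := Ideal.mem_span_singleton'.1 hz
    exact ⟨a, b, by simp only [τ]; ring⟩
  · rintro ⟨a, b, rfl⟩
    refine Ideal.add_mem _ (Ideal.mul_mem_right _ _
      (Ideal.mem_sup_right (Ideal.mem_span_singleton_self _))) ?_
    exact Ideal.sum_mem _ fun i _ => Ideal.mul_mem_left _ _
      (Ideal.mem_sup_left (Ideal.subset_span ⟨i, rfl⟩))

theorem keep_τ_of_mem {S : Finset (Fin n)} {m : ℕ} {i : Fin n} (hi : i ∈ S) :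
    keep S (τ n m i) = τ n m i := by
  rw [τ, map_sub, map_one, map_pow, keep_x_of_mem hi]

theorem keep_τ_of_notMem {S : Finset (Fin n)} {m : ℕ} {i : Fin n} (hi : i ∉ S) :
    keep S (τ n m i) = 0 := by
  rw [τ, map_sub, map_one, map_pow, keep_x_of_notMem hi, one_pow, sub_self]

theorem σ_ne_zero (i : Fin n) : σ n i ≠ 0 := by
  intro h
  have h1 : mon n (Multiplicative.ofAdd (Pi.single i 1)) = mon n 1 := by
    ext1
    rw [mon_single, map_one, Units.val_one]
    exact sub_eq_zero.1 h
  have h2 := congrArg Multiplicative.toAdd (mon_injective h1)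
  have h3 := congrFun h2 i
  simp at h3

theorem natCast_ne_zero {m : ℕ} (hm : m ≠ 0) : (m : R n) ≠ 0 := by
  intro h
  rw [AddMonoidAlgebra.natCast_def, AddMonoidAlgebra.single_eq_zero] at h
  exact hm (by exact_mod_cast h)

theorem exists_notMem_triple (hn : 4 ≤ n) (i j k : Fin n) : ∃ l, l ≠ i ∧ l ≠ j ∧ l ≠ k := by
  have h : ({i, j, k} : Finset (Fin n)) ≠ Finset.univ := by
    intro h
    have h1 := congrArg Finset.card h
    rw [Finset.card_univ, Fintype.card_fin] at h1
    have := Finset.card_le_three (a := i) (b := j) (c := k)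
    omega
  obtain ⟨l, hl⟩ := not_forall.1 fun h' => h (Finset.eq_univ_iff_forall.2 h')
  exact ⟨l, by simpa using hl⟩

theorem sliceStable_natCast_sup {m : ℕ} {P : Set (Fin n)} {j : Fin n} (hj : j ∉ P) (c : Set (R n))
    (hc : ∀ t ∈ c, keep {j}ᶜ t = t) :
    SliceStable j (Ideal.span c ⊔ Ideal.span ((fun i => (x n i : R n) ^ m - 1) '' P)) := by
  rw [← Ideal.span_union]
  refine sliceStable_span ?_
  rintro t (ht | ⟨i, hi, rfl⟩)
  · exact hc t ht
  · refine keep_τ_of_mem ?_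
    rw [Finset.mem_compl, Finset.mem_singleton]
    rintro rfl
    exact hj hi

/-- A syzygy of the `σ_j`, `j ≠ v`, is a combination of Koszul syzygies. -/
theorem exists_eq_sum_kos {v : Fin n} {w : Fin n → R n} (hv : w v = 0) (hw : w ⬝ᵥ σ n = 0) :
    ∃ a : Fin n → Fin n → R n, (∀ r s, a r s ≠ 0 → r ≠ v ∧ s ≠ v) ∧
      w = ∑ r, ∑ s, a r s • kos (x n) s r := by
  -- The exponent one gives `x_j ^ 1 - 1 = σ_j`, and the zero ideal makes the error term `q` vanish.
  obtain ⟨a, q, hq, -, ha, h⟩ := koszul_exact one_ne_zero {v}ᶜ (J := Ideal.span ∅) (f := w)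
    (fun P j _ hj => sliceStable_natCast_sup hj ∅ (by simp))
    (fun j hj => by
      have : j = v := by simpa using hj
      rw [this, hv])
    (by
      have h1 : ∑ j ∈ ({v}ᶜ : Finset (Fin n)), ((x n j : R n) ^ 1 - 1) * w j = 0 := by
        rw [← hw, dotProduct, ← Finset.sum_subset (Finset.subset_univ ({v}ᶜ : Finset (Fin n)))]
        · exact Finset.sum_congr rfl fun j _ => by rw [pow_one, σ, mul_comm]
        · intro j _ hj
          have : j = v := by simpa using hj
          rw [this, hv, zero_mul]
      rw [h1]
      exact Ideal.zero_mem _)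
  refine ⟨a, fun r s hrs => ?_, ?_⟩
  · obtain ⟨h1, h2, -⟩ := ha r s hrs
    exact ⟨by simpa using h1, by simpa using h2⟩
  · have hq0 : q = 0 := by
      ext1 j
      simpa using hq j
    rw [hq0, zero_add] at h
    simp only [pow_one] at h
    exact h

/-- A syzygy avoiding `v` is a combination of Koszul syzygies. For each of them `4 ≤ n` provides an
index different from `v` and from its two indices, as the commutator trick requires. -/
theorem τ_smul_mem_rowGroup (hn : 4 ≤ n) {m : ℕ} {v : Fin n} {w : Fin n → R n} (hv : w v = 0)
    (hw : w ⬝ᵥ σ n = 0) : τ n m v • w ∈ rowGroup (x n) m v := by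
  obtain ⟨a, ha, rfl⟩ := exists_eq_sum_kos hv hw
  simp only [Finset.smul_sum]
  refine AddSubgroup.sum_mem _ fun r _ => AddSubgroup.sum_mem _ fun s _ => ?_
  by_cases h : a r s = 0
  · rw [h, zero_smul, smul_zero]
    exact AddSubgroup.zero_mem _
  · obtain ⟨hr, hs⟩ := ha r s h
    obtain ⟨l, hlv, hls, hlr⟩ := exists_notMem_triple hn v s r
    rw [smul_smul, ← σ_mul_geom]
    exact subOne_mul_geom_smul_kos_mem_rowGroup hs hr hlv hls hlr _

/-- A row `c` with `c_v = 0` and `∑ c_j σ_j = 0` whose entries lie in suitable ideals can be added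
to the `v`-th row of the identity by a product of `m`-th powers. -/
theorem mem_rowGroup_of_mem_H (hn : 4 ≤ n) {m : ℕ} (hm : m ≠ 0) {v : Fin n} {c : Fin n → R n}
    (hv : c v = 0) (hs : c ⬝ᵥ σ n = 0)
    (hc : ∀ j, ∃ g, c j - σ n v * geom (x n) m j * g ∈ H n m) : c ∈ rowGroup (x n) m v := by
  have hrep : ∀ j, ∃ (g a : R n) (b : Fin n → R n),
      c j = m * a + ∑ r, b r * τ n m r + σ n v * geom (x n) m j * g := by
    intro j
    obtain ⟨g, hg⟩ := hc j
    obtain ⟨a, b, h⟩ := mem_H_iff.1 hg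
    exact ⟨g, a, b, by rw [← h]; ring⟩
  choose g a b hrep using hrep
  have hkos : ∀ (i j r : Fin n) (y : R n), i ≠ v → j ≠ v → r ≠ v →
      (geom (x n) m r * y) • kos (x n) i j ∈ rowGroup (x n) m v := by
    intro i j r y hi hj hr
    rw [mul_smul]
    refine geom_smul_mem_rowGroup hr ?_ ?_
    · rw [Pi.smul_apply, kos_of_ne _ hi.symm hj.symm, smul_zero]
    · rw [smul_dotProduct, kos_dotProduct_subOne, smul_zero]
  let S : Finset (Fin n) := {v}ᶜ
  have hS : ∀ {j}, j ∈ S ↔ j ≠ v := by simp [S]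
  -- Subtracting `d1` trades each `τ_r b_{j,r}` with `r ≠ v` for multiples of `μ_j`, since the
  -- `j`-th entry of `μ_r • kos r j` is `τ_r` and its `r`-th entry is `-σ_j μ_r`. The `j`-th entry
  -- becomes `m a_j + τ_v b_{j,v} + μ_j f_j`.
  let d1 : Fin n → R n := ∑ j ∈ S, ∑ r ∈ S, (geom (x n) m r * b j r) • kos (x n) r j
  have hd1 : d1 ∈ rowGroup (x n) m v :=
    AddSubgroup.sum_mem _ fun j hj => AddSubgroup.sum_mem _ fun r hr =>
      hkos r j r _ (hS.1 hr) (hS.1 hj) (hS.1 hr)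
  let f : Fin n → R n := fun j => if j ∈ S then σ n v * g j + ∑ i ∈ S, σ n i * b i j else 0
  have hc1 : ∀ j ∈ S, (c - d1) j = m * a j + τ n m v * b j v + geom (x n) m j * f j := by
    intro j hj
    have hd : d1 j = ∑ r ∈ S, b j r * τ n m r - geom (x n) m j * ∑ i ∈ S, σ n i * b i j := by
      simp only [d1, Finset.sum_apply, Pi.smul_apply, kos, smul_eq_mul, Pi.sub_apply, mul_sub,
        Finset.sum_sub_distrib]
      congr 1
      · rw [Finset.sum_eq_single j]
        · refine Finset.sum_congr rfl fun r _ => ?_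
          rw [Pi.single_eq_same, subOne_x, ← geom_mul_σ]; ring
        · intro i _ hi
          simp [hi.symm]
        · exact fun h => absurd hj h
      · rw [Finset.mul_sum]
        refine Finset.sum_congr rfl fun i _ => ?_
        rw [Finset.sum_eq_single j]
        · rw [Pi.single_eq_same, subOne_x]; ring
        · intro r _ hr
          simp [hr.symm]
        · exact fun h => absurd hj h
    have hsum : ∑ r, b j r * τ n m r = ∑ r ∈ S, b j r * τ n m r + b j v * τ n m v := by
      rw [← Finset.sum_compl_add_sum S, add_comm]
      simp [S]
    rw [Pi.sub_apply, hrep j, hd, hsum]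
    simp only [f, if_pos hj]
    ring
  have hc1v : (c - d1) v = 0 := by rw [Pi.sub_apply, hv, hd1.1, sub_zero]
  have hc1s : (c - d1) ⬝ᵥ σ n = 0 := by
    rw [sub_dotProduct, hs, ← subOne_x, hd1.2.1, sub_zero]
  have hdot : ∀ w : Fin n → R n, w v = 0 → w ⬝ᵥ σ n = ∑ j ∈ S, w j * σ n j := by
    intro w hw
    rw [dotProduct, ← Finset.sum_compl_add_sum S]
    simp [S, hw]
  let J : Ideal (R n) := Ideal.span {(m : R n), τ n m v}
  have hmJ : (m : R n) ∈ J := Ideal.subset_span (by simp)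
  have hτJ : τ n m v ∈ J := Ideal.subset_span (by simp)
  -- Orthogonality to `σ` now says `∑ τ_j f_j ∈ (m, τ_v)`, because `μ_j σ_j = τ_j`.
  obtain ⟨α, q, hq, hq0, hα, hf⟩ := koszul_exact hm S (J := J) (f := f)
    (fun P j hj hjP => sliceStable_natCast_sup hjP _ (by
      rintro t (rfl | rfl)
      · rw [map_natCast]
      · exact keep_τ_of_mem (by simpa using (hS.1 hj).symm)))
    (fun j hj => if_neg hj)
    (by
      have h1 : ∑ j ∈ S, ((x n j : R n) ^ m - 1) * f j =
          -(m * ∑ j ∈ S, a j * σ n j + τ n m v * ∑ j ∈ S, b j v * σ n j) := by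
        rw [eq_neg_iff_add_eq_zero, ← hc1s, hdot _ hc1v, Finset.mul_sum, Finset.mul_sum,
          ← Finset.sum_add_distrib, ← Finset.sum_add_distrib]
        refine Finset.sum_congr rfl fun j hj => ?_
        rw [hc1 j hj, ← τ, ← geom_mul_σ m j]
        ring
      rw [h1]
      exact Submodule.neg_mem _ (Ideal.add_mem _ (Ideal.mul_mem_right _ _ hmJ)
        (Ideal.mul_mem_right _ _ hτJ)))
  -- The Koszul part of `f` is made of relations among the `τ_j`. Multiplying its `j`-th entry by
  -- `μ_j` turns the relation for `r, s` into `μ_r μ_s` times the Koszul syzygy of the `σ_j`.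
  let d2 : Fin n → R n :=
    ∑ r, ∑ s, (geom (x n) m r * (geom (x n) m s * α r s)) • kos (x n) s r
  have hd2 : d2 ∈ rowGroup (x n) m v := by
    refine AddSubgroup.sum_mem _ fun r _ => AddSubgroup.sum_mem _ fun s _ => ?_
    by_cases h : α r s = 0
    · rw [h, mul_zero, mul_zero, zero_smul]
      exact AddSubgroup.zero_mem _
    · obtain ⟨hr, hs, -⟩ := hα r s h
      exact hkos s r r _ (hS.1 hs) (hS.1 hr) (hS.1 hr)
  have hd2f : ∀ j, geom (x n) m j * f j = geom (x n) m j * q j + d2 j := by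
    intro j
    have h1 := congrFun hf j
    rw [h1, Pi.add_apply, mul_add]
    congr 1
    simp only [d2, Finset.sum_apply, Pi.smul_apply, smul_eq_mul, Finset.mul_sum, kos, Pi.sub_apply]
    refine Finset.sum_congr rfl fun r _ => Finset.sum_congr rfl fun s _ => ?_
    have hr : geom (x n) m j * (Pi.single r 1 : Fin n → R n) j =
        geom (x n) m r * (Pi.single r 1 : Fin n → R n) j := by
      by_cases h : j = r
      · rw [h]
      · simp [h]
    have hs : geom (x n) m j * (Pi.single s 1 : Fin n → R n) j =
        geom (x n) m s * (Pi.single s 1 : Fin n → R n) j := by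
      by_cases h : j = s
      · rw [h]
      · simp [h]
    rw [← τ, ← τ, ← geom_mul_σ m r, ← geom_mul_σ m s, subOne_x]
    linear_combination (α r s * geom (x n) m s * σ n s) * hr -
      (α r s * geom (x n) m r * σ n r) * hs
  have hqJ : ∀ j, ∃ y z, q j = m * y + τ n m v * z := by
    intro j
    obtain ⟨y, z, h⟩ := Ideal.mem_span_pair.1 (hq j)
    exact ⟨y, z, by rw [← h]; ring⟩
  choose y z hyz using hqJ
  let a' : Fin n → R n := fun j => if j ∈ S then a j + geom (x n) m j * y j else 0
  let b' : Fin n → R n := fun j => if j ∈ S then b j v + geom (x n) m j * z j else 0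
  have hv' : v ∉ S := by simp [S]
  have ha'v : a' v = 0 := if_neg hv'
  have hb'v : b' v = 0 := if_neg hv'
  have hc2 : c - d1 - d2 = (m : R n) • a' + τ n m v • b' := by
    ext1 j
    simp only [Pi.add_apply, Pi.smul_apply, smul_eq_mul]
    by_cases hj : j ∈ S
    · rw [Pi.sub_apply, hc1 j hj, hd2f, hyz]
      simp only [a', b', if_pos hj]
      ring
    · have : j = v := by simpa [S] using hj
      rw [this, Pi.sub_apply, hc1v, hd2.1, ha'v, hb'v]
      ring
  have hsum : (m : R n) * (a' ⬝ᵥ σ n) + τ n m v * (b' ⬝ᵥ σ n) = 0 := by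
    have h1 := congrArg (· ⬝ᵥ σ n) hc2
    simp only [add_dotProduct, smul_dotProduct, smul_eq_mul] at h1
    rw [← h1, sub_dotProduct, hc1s, ← subOne_x, hd2.2.1, sub_zero]
  -- The remainder `m a' + τ_v b'` is a syzygy, but `a'` and `b'` need not be. As `τ_v` is a
  -- nonzerodivisor modulo `m`, their defects are `-τ_v β` and `m β` for a common `β`.
  have hβ : b' ⬝ᵥ σ n ∈ Ideal.span {(m : R n)} := by
    refine mem_of_x_pow_sub_one_mul_mem (j := v) (sliceStable_span ?_) hm ?_
    · rintro t rfl
      rw [map_natCast]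
    · refine Ideal.mem_span_singleton'.2 ⟨-(a' ⬝ᵥ σ n), ?_⟩
      rw [← τ]
      linear_combination (-1 : R n) * hsum
  obtain ⟨β, hβ⟩ := Ideal.mem_span_singleton.1 hβ
  have hα' : a' ⬝ᵥ σ n = - (τ n m v * β) := by
    have h1 : (m : R n) * (a' ⬝ᵥ σ n + τ n m v * β) = 0 := by
      rw [hβ] at hsum
      linear_combination hsum
    exact eq_neg_of_add_eq_zero_left ((mul_eq_zero.1 h1).resolve_left (natCast_ne_zero hm))
  -- Since `b'` vanishes at `v`, so does `m β` after setting all variables except `x_v` to one.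
  -- Hence `β` is a combination of the `σ_j`, `j ≠ v`, and the row `γ'` of its coefficients corrects
  -- both defects without touching position `v`.
  have hkβ : keep {v} β = 0 := by
    have h1 : keep {v} (b' ⬝ᵥ σ n) = 0 := by
      rw [hdot _ hb'v, map_sum]
      refine Finset.sum_eq_zero fun j hj => ?_
      rw [map_mul, keep_σ_of_notMem (by simpa using hS.1 hj), mul_zero]
    rw [hβ, map_mul, map_natCast] at h1
    exact (mul_eq_zero.1 h1).resolve_left (natCast_ne_zero hm)
  obtain ⟨γ, hγ⟩ := exists_sub_keep_eq {v} β
  rw [hkβ, sub_zero] at hγ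
  let γ' : Fin n → R n := fun j => if j ∈ S then γ j else 0
  have hγ'v : γ' v = 0 := if_neg hv'
  have hγ' : γ' ⬝ᵥ σ n = β := by
    rw [hdot _ hγ'v, hγ]
    exact Finset.sum_congr rfl fun j hj => by rw [show γ' j = γ j from if_pos hj]
  have hfinal : c = d1 + (d2 + ((m : R n) • (a' + τ n m v • γ') +
      τ n m v • (b' - (m : R n) • γ'))) := by
    have h1 : c = d1 + (d2 + (c - d1 - d2)) := by abel
    rw [h1, hc2, smul_add, smul_sub, smul_comm (m : R n) (τ n m v) γ']
    abel
  rw [hfinal]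
  refine AddSubgroup.add_mem _ hd1 (AddSubgroup.add_mem _ hd2 (AddSubgroup.add_mem _ ?_ ?_))
  · refine natCast_smul_mem_rowGroup ?_ ?_
    · rw [Pi.add_apply, Pi.smul_apply, ha'v, hγ'v, smul_zero, add_zero]
    · rw [subOne_x, add_dotProduct, smul_dotProduct, hγ', hα', smul_eq_mul, neg_add_cancel]
  · refine τ_smul_mem_rowGroup hn ?_ ?_
    · rw [Pi.sub_apply, Pi.smul_apply, hb'v, hγ'v, smul_zero, sub_zero]
    · rw [sub_dotProduct, smul_dotProduct, hγ', hβ, smul_eq_mul, sub_self]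

end RowKilling

/-! ### The ideals `N` and `L`, and the congruences preserved during a stage -/

section Conditions

variable {n : ℕ}

/-- The indices below `k`. -/
def low (n k : ℕ) : Finset (Fin n) := Finset.univ.filter fun i => i.val < k

theorem mem_low {k : ℕ} {i : Fin n} : i ∈ low n k ↔ i.val < k := by simp [low]

theorem keep_low_of_le {k l : ℕ} (h : k ≤ l) {f : R n} (hf : keep (low n k) f = f) :
    keep (low n l) f = f := by
  conv_lhs => rw [← hf]
  rw [keep_keep]
  have h1 : low n l ∩ low n k = low n k :=
    Finset.inter_eq_right.2 fun i hi => mem_low.2 ((mem_low.1 hi).trans_le h)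
  rw [h1, hf]

theorem keep_idem (S : Finset (Fin n)) (f : R n) : keep S (keep S f) = keep S f := by
  rw [keep_keep, Finset.inter_self]

theorem keep_geom_of_mem {S : Finset (Fin n)} {i : Fin n} (hi : i ∈ S) (m : ℕ) :
    keep S (geom (x n) m i) = geom (x n) m i := by
  rw [geom, map_sum]
  exact Finset.sum_congr rfl fun k _ => by rw [map_pow, keep_x_of_mem hi]

theorem keep_geom_of_notMem {S : Finset (Fin n)} {i : Fin n} (hi : i ∉ S) (m : ℕ) :
    keep S (geom (x n) m i) = m := by
  rw [geom, map_sum]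
  simp [keep_x_of_notMem hi]

/-- The ideal generated by `m²`, the `m σ_i σ_j`, the `σ_i (x_r ^ m - 1)` with `r < k`, and the
`σ_r (x_r ^ m - 1)`. -/
noncomputable def N (n m k : ℕ) : Ideal (R n) :=
  Ideal.span {f | f = (m : R n) ^ 2 ∨ (∃ i j, f = m * σ n i * σ n j) ∨
    ∃ i r : Fin n, (r.val < k ∨ i = r) ∧ f = σ n i * τ n m r}

/-- The ideal generated by `m²`, the `m σ_i` and the `x_r ^ m - 1`. -/
noncomputable def L (n m : ℕ) : Ideal (R n) :=
  Ideal.span {f | f = (m : R n) ^ 2 ∨ (∃ i, f = m * σ n i) ∨ ∃ r, f = τ n m r}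

variable {m k : ℕ}

theorem sq_mem_N (a : R n) : (m : R n) ^ 2 * a ∈ N n m k :=
  Ideal.mul_mem_right _ _ (Ideal.subset_span (Or.inl rfl))

theorem mul_σ_σ_mem_N (i j : Fin n) (a : R n) : m * σ n i * σ n j * a ∈ N n m k :=
  Ideal.mul_mem_right _ _ (Ideal.subset_span (Or.inr (Or.inl ⟨i, j, rfl⟩)))

theorem σ_τ_mem_N {i r : Fin n} (h : r.val < k ∨ i = r) (a : R n) :
    σ n i * τ n m r * a ∈ N n m k :=
  Ideal.mul_mem_right _ _ (Ideal.subset_span (Or.inr (Or.inr ⟨i, r, h, rfl⟩)))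

theorem sq_mem_L (a : R n) : (m : R n) ^ 2 * a ∈ L n m :=
  Ideal.mul_mem_right _ _ (Ideal.subset_span (Or.inl rfl))

theorem mul_σ_mem_L (i : Fin n) (a : R n) : m * σ n i * a ∈ L n m :=
  Ideal.mul_mem_right _ _ (Ideal.subset_span (Or.inr (Or.inl ⟨i, rfl⟩)))

theorem τ_mem_L (r : Fin n) (a : R n) : τ n m r * a ∈ L n m :=
  Ideal.mul_mem_right _ _ (Ideal.subset_span (Or.inr (Or.inr ⟨r, rfl⟩)))

theorem N_mono {l : ℕ} (h : k ≤ l) : N n m k ≤ N n m l := by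
  refine Ideal.span_mono ?_
  rintro f (hf | hf | ⟨i, r, hr, hf⟩)
  · exact Or.inl hf
  · exact Or.inr (Or.inl hf)
  · exact Or.inr (Or.inr ⟨i, r, hr.imp (fun h' => h'.trans_le h) id, hf⟩)

theorem N_le_L : N n m k ≤ L n m := by
  rw [N, Ideal.span_le]
  rintro f (rfl | ⟨i, j, rfl⟩ | ⟨i, r, -, rfl⟩)
  · simpa using sq_mem_L (m := m) (1 : R n)
  · exact mul_σ_mem_L i _
  · rw [mul_comm]; exact τ_mem_L r _

theorem L_le_H : L n m ≤ H n m := by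
  rw [L, Ideal.span_le]
  have hm : (m : R n) ∈ H n m := Ideal.mem_sup_right (Ideal.mem_span_singleton_self _)
  rintro f (rfl | ⟨i, rfl⟩ | ⟨r, rfl⟩)
  · rw [pow_two]; exact Ideal.mul_mem_right _ _ hm
  · exact Ideal.mul_mem_right _ _ hm
  · exact Ideal.mem_sup_left (Ideal.subset_span ⟨r, rfl⟩)

theorem keep_mem_N (S : Finset (Fin n)) {f : R n} (hf : f ∈ N n m k) : keep S f ∈ N n m k := by
  have h : N n m k ≤ (N n m k).comap (keep S) := by
    conv_lhs => rw [N]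
    rw [Ideal.span_le]
    rintro f (rfl | ⟨i, j, rfl⟩ | ⟨i, r, hr, rfl⟩)
    · simpa using sq_mem_N (m := m) (k := k) (1 : R n)
    · change keep S (m * σ n i * σ n j) ∈ N n m k
      rw [map_mul, map_mul, map_natCast]
      by_cases hi : i ∈ S <;> by_cases hj : j ∈ S
      · rw [keep_σ_of_mem hi, keep_σ_of_mem hj]
        simpa using mul_σ_σ_mem_N i j (1 : R n)
      · rw [keep_σ_of_notMem hj, mul_zero]; exact Ideal.zero_mem _
      · rw [keep_σ_of_notMem hi, mul_zero, zero_mul]; exact Ideal.zero_mem _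
      · rw [keep_σ_of_notMem hj, mul_zero]; exact Ideal.zero_mem _
    · change keep S (σ n i * τ n m r) ∈ N n m k
      rw [map_mul]
      by_cases hi : i ∈ S <;> by_cases hj : r ∈ S
      · rw [keep_σ_of_mem hi, keep_τ_of_mem hj]
        simpa using σ_τ_mem_N hr (1 : R n)
      · rw [keep_τ_of_notMem hj, mul_zero]; exact Ideal.zero_mem _
      · rw [keep_σ_of_notMem hi, zero_mul]; exact Ideal.zero_mem _
      · rw [keep_τ_of_notMem hj, mul_zero]; exact Ideal.zero_mem _
  exact h hf

theorem mem_L_iff {f : R n} : f ∈ L n m ↔ ∃ (z : R n) (a b : Fin n → R n),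
    f = (m : R n) ^ 2 * z + ∑ i, m * σ n i * a i + ∑ r, τ n m r * b r := by
  constructor
  · intro hf
    induction hf using Submodule.span_induction with
    | mem f hf =>
      obtain rfl | ⟨i, rfl⟩ | ⟨r, rfl⟩ := hf
      · exact ⟨1, 0, 0, by simp⟩
      · refine ⟨0, Pi.single i 1, 0, ?_⟩
        rw [Finset.sum_eq_single i (fun j _ hj => by rw [Pi.single_eq_of_ne hj, mul_zero])
          (by simp)]
        simp
      · refine ⟨0, 0, Pi.single r 1, ?_⟩
        rw [Finset.sum_eq_single (s := Finset.univ) (f := fun i => τ n m i * _) r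
          (fun j _ hj => by rw [Pi.single_eq_of_ne hj, mul_zero]) (by simp)]
        simp
    | zero => exact ⟨0, 0, 0, by simp⟩
    | add f g _ _ hf hg =>
      obtain ⟨z, a, b, rfl⟩ := hf
      obtain ⟨z', a', b', rfl⟩ := hg
      refine ⟨z + z', a + a', b + b', ?_⟩
      simp only [Pi.add_apply, mul_add, Finset.sum_add_distrib]
      ring
    | smul c f _ hf =>
      obtain ⟨z, a, b, rfl⟩ := hf
      refine ⟨c * z, c • a, c • b, ?_⟩
      simp only [smul_eq_mul, Pi.smul_apply, mul_add, Finset.mul_sum]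
      congr 1
      · congr 1
        · ring
        · exact Finset.sum_congr rfl fun i _ => by ring
      · exact Finset.sum_congr rfl fun i _ => by ring
  · rintro ⟨z, a, b, rfl⟩
    refine Ideal.add_mem _ (Ideal.add_mem _ (sq_mem_L _) ?_) ?_
    · exact Ideal.sum_mem _ fun i _ => mul_σ_mem_L _ _
    · exact Ideal.sum_mem _ fun i _ => τ_mem_L _ _

theorem keep_mem_L (S : Finset (Fin n)) {f : R n} (hf : f ∈ L n m) : keep S f ∈ L n m := by
  obtain ⟨z, a, b, rfl⟩ := mem_L_iff.1 hf
  simp only [map_add, map_mul, map_sum, map_pow, map_natCast]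
  refine Ideal.add_mem _ (Ideal.add_mem _ (sq_mem_L _) ?_) ?_
  · refine Ideal.sum_mem _ fun i _ => ?_
    by_cases hi : i ∈ S
    · rw [keep_σ_of_mem hi]; exact mul_σ_mem_L _ _
    · rw [keep_σ_of_notMem hi, mul_zero, zero_mul]; exact Ideal.zero_mem _
  · refine Ideal.sum_mem _ fun i _ => ?_
    by_cases hi : i ∈ S
    · rw [keep_τ_of_mem hi]; exact τ_mem_L _ _
    · rw [keep_τ_of_notMem hi, zero_mul]; exact Ideal.zero_mem _

theorem σ_mul_mem_L (i : Fin n) {h : R n} (hh : h ∈ H n m) : σ n i * h ∈ L n m := by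
  obtain ⟨a, b, rfl⟩ := mem_H_iff.1 hh
  rw [mul_add, Finset.mul_sum]
  refine Ideal.add_mem _ ?_ (Ideal.sum_mem _ fun r _ => ?_)
  · have := mul_σ_mem_L (m := m) i a
    convert! this using 1; ring
  · have := τ_mem_L (m := m) r (σ n i * b r)
    convert! this using 1; ring

/-- Among the generators `τ_r` of `L`, the retraction lets only those with `r < k` survive, and
exactly for these `N n m k` contains every `σ_i τ_r`. -/
theorem σ_mul_keep_mem_N (i : Fin n) {h : R n} (hh : h ∈ L n m) :
    σ n i * keep (low n k) h ∈ N n m k := by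
  obtain ⟨z, a, b, rfl⟩ := mem_L_iff.1 hh
  simp only [map_add, map_mul, map_sum, map_pow, map_natCast, mul_add, Finset.mul_sum]
  refine Ideal.add_mem _ (Ideal.add_mem _ ?_ ?_) ?_
  · rw [mul_left_comm]; exact sq_mem_N _
  · refine Ideal.sum_mem _ fun j _ => ?_
    by_cases hj : j ∈ low n k
    · rw [keep_σ_of_mem hj]
      have := mul_σ_σ_mem_N (m := m) (k := k) i j (keep (low n k) (a j))
      convert! this using 1; ring
    · rw [keep_σ_of_notMem hj]; simp
  · refine Ideal.sum_mem _ fun r _ => ?_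
    by_cases hr : r ∈ low n k
    · rw [keep_τ_of_mem hr, ← mul_assoc]
      exact σ_τ_mem_N (Or.inl (mem_low.1 hr)) _
    · rw [keep_τ_of_notMem hr]; simp

/-- Division by `σ_v` of the difference of two consecutive retractions of an element of `N`. -/
theorem exists_keep_sub_keep_eq (v : Fin n) {y : R n} (hy : y ∈ N n m v) :
    ∃ h ∈ L n m, keep (low n (v + 1)) y - keep (low n v) y = σ n v * h := by
  have hv : v ∈ low n (v + 1) := mem_low.2 (Nat.lt_succ_self _)
  have hv' : v ∉ low n v := fun h => lt_irrefl _ (mem_low.1 h)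
  have hiff : ∀ i : Fin n, i ≠ v → (i ∈ low n (v + 1) ↔ i ∈ low n v) := by
    intro i hi
    rw [mem_low, mem_low]
    have : i.val ≠ v.val := fun h => hi (Fin.ext h)
    omega
  have hσ : ∀ i : Fin n, i ≠ v → keep (low n (v + 1)) (σ n i) = keep (low n v) (σ n i) := by
    intro i hi
    by_cases h : i ∈ low n v
    · rw [keep_σ_of_mem h, keep_σ_of_mem ((hiff i hi).2 h)]
    · rw [keep_σ_of_notMem h, keep_σ_of_notMem fun h' => h ((hiff i hi).1 h')]
  have hτ : ∀ i : Fin n, i ≠ v → keep (low n (v + 1)) (τ n m i) = keep (low n v) (τ n m i) := by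
    intro i hi
    by_cases h : i ∈ low n v
    · rw [keep_τ_of_mem h, keep_τ_of_mem ((hiff i hi).2 h)]
    · rw [keep_τ_of_notMem h, keep_τ_of_notMem fun h' => h ((hiff i hi).1 h')]
  induction hy using Submodule.span_induction with
  | mem f hf =>
    obtain rfl | ⟨i, j, rfl⟩ | ⟨i, r, hr, rfl⟩ := hf
    · exact ⟨0, Ideal.zero_mem _, by simp⟩
    · simp only [map_mul, map_natCast]
      by_cases hi : i = v
      · subst hi
        refine ⟨m * keep (low n (i + 1)) (σ n j), ?_, ?_⟩
        · rw [← map_natCast (keep (low n (i + 1))), ← map_mul]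
          exact keep_mem_L _ (by simpa using mul_σ_mem_L j (1 : R n))
        · rw [keep_σ_of_mem hv, keep_σ_of_notMem hv']; ring
      · by_cases hj : j = v
        · subst hj
          refine ⟨m * keep (low n (j + 1)) (σ n i), ?_, ?_⟩
          · rw [← map_natCast (keep (low n (j + 1))), ← map_mul]
            exact keep_mem_L _ (by simpa using mul_σ_mem_L i (1 : R n))
          · rw [keep_σ_of_mem hv, keep_σ_of_notMem hv']; ring
        · exact ⟨0, Ideal.zero_mem _, by rw [hσ i hi, hσ j hj]; ring⟩
    · simp only [map_mul]
      by_cases hi : i = v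
      · subst hi
        refine ⟨keep (low n (i + 1)) (τ n m r), keep_mem_L _ (by simpa using τ_mem_L r (1 : R n)), ?_⟩
        rw [keep_σ_of_mem hv, keep_σ_of_notMem hv']; ring
      -- The generator `σ_i τ_v` with `i ≠ v` would have the quotient `σ_i μ_v`, which is why `N n m
      -- v` admits `τ_v` only with the factor `σ_v`.
      · have hrv : r ≠ v := by
          rintro rfl
          rcases hr with hr | hr
          · exact lt_irrefl _ hr
          · exact hi hr
        exact ⟨0, Ideal.zero_mem _, by rw [hσ i hi, hτ r hrv]; ring⟩
  | zero => exact ⟨0, Ideal.zero_mem _, by simp⟩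
  | add f g _ _ hf hg =>
    obtain ⟨h, hh, hf⟩ := hf
    obtain ⟨h', hh', hg⟩ := hg
    refine ⟨h + h', Ideal.add_mem _ hh hh', ?_⟩
    rw [map_add, map_add]
    linear_combination hf + hg
  | smul c f hfN hf =>
    obtain ⟨h, hh, hf⟩ := hf
    -- The product rule for differences of two ring homomorphisms, with the two retractions of the
    -- coefficient `c` differing by a multiple of `σ_v`.
    obtain ⟨d, hd⟩ := exists_sub_keep_eq (low n v) (keep (low n (v + 1)) c)
    have hd' := congrArg (keep (low n (v + 1))) hd
    rw [keep_keep] at hd hd'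
    have h1 : low n v ∩ low n (v + 1) = low n v :=
      Finset.inter_eq_left.2 fun i hi => mem_low.2 ((mem_low.1 hi).trans (Nat.lt_succ_self _))
    rw [h1, map_sub, keep_idem, keep_keep, Finset.inter_comm, h1, map_sum,
      Finset.sum_eq_single v] at hd'
    · rw [map_mul, keep_σ_of_mem hv] at hd'
      refine ⟨keep (low n (v + 1)) c * h + keep (low n (v + 1)) (d v) * keep (low n v) f,
        Ideal.add_mem _ (Ideal.mul_mem_left _ _ hh)
          (Ideal.mul_mem_left _ _ (keep_mem_L _ (N_le_L hfN))), ?_⟩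
      rw [smul_eq_mul, map_mul, map_mul]
      linear_combination (keep (low n (v + 1)) c) * hf + (keep (low n v) f) * hd'
    · intro i hi hiv
      have : i ∉ low n (v + 1) := by
        rw [hiff i hiv]
        exact Finset.mem_compl.1 hi
      rw [map_mul, keep_σ_of_notMem this, mul_zero]
    · intro h
      exact absurd (Finset.mem_compl.2 hv') h

/-! ### The conditions on matrices during a stage of the reduction -/

/-- The elements of `N + σ_i² μ_j ℤ[x_0, …, x_i]`, where the second summand is
omitted for `i < v` and for `v < j`. -/
def E1 (m : ℕ) (v i j : Fin n) : AddSubgroup (R n) where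
  carrier := {y | ∃ f, keep (low n (i + 1)) f = f ∧ (i < v ∨ v < j → f = 0) ∧
    y - σ n i ^ 2 * geom (x n) m j * f ∈ N n m (v + 1)}
  zero_mem' := ⟨0, map_zero _, fun _ => rfl, by simp⟩
  add_mem' := by
    rintro y z ⟨f, hf, hf0, hy⟩ ⟨g, hg, hg0, hz⟩
    refine ⟨f + g, by rw [map_add, hf, hg], fun h => by rw [hf0 h, hg0 h, add_zero], ?_⟩
    convert! Ideal.add_mem _ hy hz using 1
    ring
  neg_mem' := by
    rintro y ⟨f, hf, hf0, hy⟩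
    refine ⟨-f, by rw [map_neg, hf], fun h => by rw [hf0 h, neg_zero], ?_⟩
    convert! Submodule.neg_mem _ hy using 1
    ring

/-- The elements of `σ_v (L + σ_v μ_j R)` involving only the variables up to `v`, where the second
summand is omitted for `v < j`. -/
def E2 (m : ℕ) (v j : Fin n) : AddSubgroup (R n) where
  carrier := {y | ∃ f h, keep (low n (v + 1)) f = f ∧ (v < j → f = 0) ∧ h ∈ L n m ∧
    keep (low n (v + 1)) h = h ∧ y = σ n v * (h + σ n v * geom (x n) m j * f)}
  zero_mem' := ⟨0, 0, map_zero _, fun _ => rfl, Ideal.zero_mem _, map_zero _, by simp⟩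
  add_mem' := by
    rintro y z ⟨f, h, hf, hf0, hh, hh', rfl⟩ ⟨g, h', hg, hg0, hk, hk', rfl⟩
    exact ⟨f + g, h + h', by rw [map_add, hf, hg], fun h => by rw [hf0 h, hg0 h, add_zero],
      Ideal.add_mem _ hh hk, by rw [map_add, hh', hk'], by ring⟩
  neg_mem' := by
    rintro y ⟨f, h, hf, hf0, hh, hh', rfl⟩
    exact ⟨-f, -h, by rw [map_neg, hf], fun h => by rw [hf0 h, neg_zero],
      Submodule.neg_mem _ hh, by rw [map_neg, hh'], by ring⟩

/-- The elements of `σ_v L` involving only the variables up to `v`. -/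
def E3 (m : ℕ) (v : Fin n) : AddSubgroup (R n) where
  carrier := {y | ∃ h ∈ L n m, keep (low n (v + 1)) h = h ∧ y = σ n v * h}
  zero_mem' := ⟨0, Ideal.zero_mem _, map_zero _, by simp⟩
  add_mem' := by
    rintro y z ⟨h, hh, hh', rfl⟩ ⟨h', hk, hk', rfl⟩
    exact ⟨h + h', Ideal.add_mem _ hh hk, by rw [map_add, hh', hk'], by ring⟩
  neg_mem' := by
    rintro y ⟨h, hh, hh', rfl⟩
    exact ⟨-h, Submodule.neg_mem _ hh, by rw [map_neg, hh'], by ring⟩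

variable {v : Fin n}

theorem mem_E1_of_mem_N {i j : Fin n} {y : R n} (hy : y ∈ N n m (v + 1)) : y ∈ E1 m v i j :=
  ⟨0, map_zero _, fun _ => rfl, by simpa using hy⟩

theorem mem_E2_of_mem_E3 {j : Fin n} {y : R n} (hy : y ∈ E3 m v) : y ∈ E2 m v j := by
  obtain ⟨h, hh, hh', rfl⟩ := hy
  exact ⟨0, h, map_zero _, fun _ => rfl, hh, hh', by simp⟩

theorem mem_low_self (v : Fin n) : v ∈ low n (v + 1) := mem_low.2 (Nat.lt_succ_self _)

theorem mem_E3_of_mem_E2 {y : R n} (hy : y ∈ E2 m v v) : y ∈ E3 m v := by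
  obtain ⟨f, h, hf, -, hh, hh', rfl⟩ := hy
  refine ⟨h + τ n m v * f, Ideal.add_mem _ hh (τ_mem_L _ _), ?_, ?_⟩
  · rw [map_add, hh', map_mul, hf, keep_τ_of_mem (mem_low_self v)]
  · rw [← σ_mul_geom]

theorem E3_mul {y z : R n} (hy : y ∈ E3 m v) (hz : keep (low n (v + 1)) z = z) :
    y * z ∈ E3 m v := by
  obtain ⟨h, hh, hh', rfl⟩ := hy
  exact ⟨h * z, Ideal.mul_mem_right _ _ hh, by rw [map_mul, hh', hz], by ring⟩

theorem E2_mul {j : Fin n} {y z : R n} (hy : y ∈ E2 m v j) (hz : keep (low n (v + 1)) z = z)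
    (hzL : z ∈ L n m) : y * z ∈ E3 m v := by
  obtain ⟨f, h, hf, hf0, hh, hh', rfl⟩ := hy
  have hv := mem_low_self v
  by_cases hj : v < j
  · rw [hf0 hj]
    exact ⟨h * z, Ideal.mul_mem_right _ _ hh, by rw [map_mul, hh', hz], by ring⟩
  · have hj' : j ∈ low n (v + 1) := mem_low.2 (Nat.lt_succ_of_le (not_lt.1 hj))
    refine ⟨(h + σ n v * geom (x n) m j * f) * z, Ideal.mul_mem_left _ _ hzL, ?_, by ring⟩
    rw [map_mul, map_add, map_mul, map_mul, hh', hz, hf, keep_σ_of_mem hv, keep_geom_of_mem hj']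

/-- For `k < v` the second factor has no exceptional term, for `v < k` the first has none. For `k =
v` the two exceptional terms meet in a multiple of `σ_v² μ_v = σ_v τ_v`, a generator of `N`. -/
theorem E1_mul {i k j : Fin n} {y z : R n} (hy : y ∈ E1 m v i k) (hz : z ∈ E1 m v k j) :
    y * z ∈ N n m (v + 1) := by
  obtain ⟨f, -, hf0, hy⟩ := hy
  obtain ⟨g, -, hg0, hz⟩ := hz
  rcases lt_trichotomy k v with h | h | h
  · rw [hg0 (Or.inl h), mul_zero, sub_zero] at hz
    exact Ideal.mul_mem_left _ _ hz
  · subst h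
    have h1 : y * z = (y - σ n i ^ 2 * geom (x n) m k * f) * z +
        σ n i ^ 2 * geom (x n) m k * f * (z - σ n k ^ 2 * geom (x n) m j * g) +
        σ n k * (σ n k * geom (x n) m k) * (σ n i ^ 2 * f * geom (x n) m j * g) := by ring
    rw [h1, σ_mul_geom]
    exact Ideal.add_mem _ (Ideal.add_mem _ (Ideal.mul_mem_right _ _ hy)
      (Ideal.mul_mem_left _ _ hz)) (σ_τ_mem_N (Or.inr rfl) _)
  · rw [hf0 (Or.inr h), mul_zero, sub_zero] at hy
    exact Ideal.mul_mem_right _ _ hy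

theorem keep_mem_L_of_mem_E1 {i j : Fin n} (hi : i ≠ v) {y : R n} (hy : y ∈ E1 m v i j) :
    keep (low n (v + 1)) y ∈ L n m := by
  obtain ⟨f, -, hf0, hy⟩ := hy
  have h1 : keep (low n (v + 1)) (σ n i ^ 2 * geom (x n) m j * f) = 0 := by
    rcases lt_or_gt_of_ne hi with h | h
    · rw [hf0 (Or.inl h), mul_zero, map_zero]
    · rw [map_mul, map_mul, map_pow, keep_σ_of_notMem, zero_pow two_ne_zero, zero_mul, zero_mul]
      rw [mem_low]
      have : v.val < i.val := h
      omega
  have h2 := keep_mem_L (low n (v + 1)) (N_le_L hy)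
  rwa [map_sub, h1, sub_zero] at h2

/-- The invariant of the matrices during stage `v` of the reduction. -/
structure Good (m : ℕ) (v : Fin n) (X : Matrix (Fin n) (Fin n) (R n)) : Prop where
  entry : ∀ i j, (X - 1) i j ∈ E1 m v i j
  row : ∀ j, keep (low n (v + 1)) ((X - 1) v j) ∈ E2 m v j
  minor : ∀ i j, i ≠ v → j ≠ v → keep (low n (v + 1)) ((X - 1) i j) ∈ E3 m v

theorem Good.one : Good m v (1 : Matrix (Fin n) (Fin n) (R n)) where
  entry i j := by rw [sub_self]; exact zero_mem _
  row j := by rw [sub_self, Matrix.zero_apply, map_zero]; exact zero_mem _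
  minor i j _ _ := by rw [sub_self, Matrix.zero_apply, map_zero]; exact zero_mem _

/-- All cross terms of `(X - 1) (Y - 1)` are harmless. In retracted entries, a factor from row `v`
meets an element of `L`, except for the diagonal one, where the exceptional term is absorbed through
`σ_v μ_v = τ_v ∈ L`. -/
theorem Good.mul {X Y : Matrix (Fin n) (Fin n) (R n)} (hX : Good m v X) (hY : Good m v Y) :
    Good m v (X * Y) := by
  have h : X * Y - 1 = (X - 1) + (Y - 1) + (X - 1) * (Y - 1) := by noncomm_ring
  refine ⟨fun i j => ?_, fun j => ?_, fun i j hi hj => ?_⟩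
  · rw [h, Matrix.add_apply, Matrix.add_apply, Matrix.mul_apply]
    refine add_mem (add_mem (hX.entry i j) (hY.entry i j)) (mem_E1_of_mem_N ?_)
    exact Ideal.sum_mem _ fun k _ => E1_mul (hX.entry i k) (hY.entry k j)
  · rw [h, Matrix.add_apply, Matrix.add_apply, Matrix.mul_apply, map_add, map_add, map_sum]
    refine add_mem (add_mem (hX.row j) (hY.row j)) (mem_E2_of_mem_E3 (sum_mem fun k _ => ?_))
    rw [map_mul]
    by_cases hk : k = v
    · subst hk
      exact E3_mul (mem_E3_of_mem_E2 (hX.row k)) (keep_idem _ _)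
    · exact E2_mul (hX.row k) (keep_idem _ _) (keep_mem_L_of_mem_E1 hk (hY.entry k j))
  · rw [h, Matrix.add_apply, Matrix.add_apply, Matrix.mul_apply, map_add, map_add, map_sum]
    refine add_mem (add_mem (hX.minor i j hi hj) (hY.minor i j hi hj)) (sum_mem fun k _ => ?_)
    rw [map_mul]
    by_cases hk : k = v
    · subst hk
      rw [mul_comm]
      exact E2_mul (hY.row j) (keep_idem _ _) (keep_mem_L_of_mem_E1 hi (hX.entry i k))
    · exact E3_mul (hX.minor i k hi hk) (keep_idem _ _)

/-- The group of monomials in the `x_i ^ (m ^ 2)`. -/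
noncomputable def detGroup (n m : ℕ) : Subgroup (R n)ˣ :=
  Subgroup.closure (Set.range fun i => x n i ^ m ^ 2)

/-- The products of `m`-th powers allowed during stage `v`. -/
noncomputable def adm (m : ℕ) (v : Fin n) : Submonoid (Matrix (Fin n) (Fin n) (R n)) where
  carrier := {P | P ∈ powMat (σ n) m ∧ Good m v P ∧ ∃ u ∈ detGroup n m, (u : R n) = P.det}
  one_mem' := ⟨one_mem _, Good.one, 1, one_mem _, by simp⟩
  mul_mem' := by
    rintro P Q ⟨hP, hP', u, hu, hud⟩ ⟨hQ, hQ', w, hw, hwd⟩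
    exact ⟨mul_mem hP hQ, hP'.mul hQ', u * w, mul_mem hu hw, by
      rw [Units.val_mul, hud, hwd, Matrix.det_mul]⟩

/-- The products of `m`-th powers allowed during stage `v` whose determinant does not involve the
variables up to `v`. -/
noncomputable def admOne (m : ℕ) (v : Fin n) : Submonoid (Matrix (Fin n) (Fin n) (R n)) where
  carrier := {P | P ∈ adm m v ∧ keep (low n (v + 1)) P.det = 1}
  one_mem' := ⟨one_mem _, by simp⟩
  mul_mem' := by
    rintro P Q ⟨hP, hP'⟩ ⟨hQ, hQ'⟩
    exact ⟨mul_mem hP hQ, by rw [Matrix.det_mul, map_mul, hP', hQ', one_mul]⟩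

theorem mem_admOne_of_det_eq_one {P : Matrix (Fin n) (Fin n) (R n)} (hP : P ∈ powMat (σ n) m)
    (hG : Good m v P) (hd : P.det = 1) : P ∈ admOne m v :=
  ⟨⟨hP, hG, 1, one_mem _, by rw [hd, Units.val_one]⟩, by rw [hd, map_one]⟩

end Conditions

/-! ### Products of `m`-th powers which preserve the congruences -/

section GoodGenerators

open Matrix

variable {n m : ℕ} {v : Fin n}

theorem mem_E1_of_eq {i j : Fin n} {f : R n} (hf : keep (low n (i + 1)) f = f)
    (h0 : i < v ∨ v < j → f = 0) : σ n i ^ 2 * geom (x n) m j * f ∈ E1 m v i j :=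
  ⟨f, hf, h0, by rw [sub_self]; exact Ideal.zero_mem _⟩

theorem σ_mul_mem_E3 {h : R n} (hh : h ∈ L n m) (hh' : keep (low n (v + 1)) h = h) :
    σ n v * h ∈ E3 m v := ⟨h, hh, hh', rfl⟩

theorem keep_σ_mul_mem_E3 {h : R n} (hh : h ∈ L n m) :
    keep (low n (v + 1)) (σ n v * h) ∈ E3 m v := by
  rw [map_mul, keep_σ_of_mem (mem_low_self v)]
  exact ⟨_, keep_mem_L _ hh, keep_idem _ _, rfl⟩

theorem notMem_low_of_lt {j : Fin n} (h : v < j) : j ∉ low n (v + 1) := by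
  rw [mem_low]
  have : v.val < j.val := h
  omega

theorem mem_low_of_le {j : Fin n} (h : j ≤ v) : j ∈ low n (v + 1) :=
  mem_low.2 (Nat.lt_succ_of_le h)

theorem Good.tv_of {y w : Fin n → R n} (h1 : ∀ i j, y i * w j ∈ E1 m v i j)
    (h2 : ∀ j, keep (low n (v + 1)) (y v * w j) ∈ E2 m v j)
    (h3 : ∀ i j, i ≠ v → j ≠ v → keep (low n (v + 1)) (y i * w j) ∈ E3 m v) :
    Good m v (tv y w) := by
  have h : ∀ i j, (tv y w - 1) i j = y i * w j := fun i j => by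
    rw [Matrix.sub_apply, tv_apply, add_sub_cancel_left]
  exact ⟨fun i j => by rw [h]; exact h1 i j, fun j => by rw [h]; exact h2 j,
    fun i j hi hj => by rw [h]; exact h3 i j hi hj⟩

theorem Good.tv_single {w : Fin n → R n} (h1 : ∀ j, w j ∈ E1 m v v j)
    (h2 : ∀ j, keep (low n (v + 1)) (w j) ∈ E2 m v j) : Good m v (tv (Pi.single v 1) w) := by
  refine Good.tv_of (fun i j => ?_) (fun j => ?_) fun i j hi hj => ?_
  · rcases eq_or_ne i v with rfl | hi
    · rw [Pi.single_eq_same, one_mul]; exact h1 j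
    · rw [Pi.single_eq_of_ne hi, zero_mul]; exact zero_mem _
  · rw [Pi.single_eq_same, one_mul]; exact h2 j
  · rw [Pi.single_eq_of_ne hi, zero_mul, map_zero]; exact zero_mem _

theorem pairCol_left {j : Fin n} (h : j ≠ v) : pairCol (x n) v j v = σ n v := by
  simp [pairCol, h.symm, subOne_x]

theorem pairCol_right {j : Fin n} (h : j ≠ v) : pairCol (x n) v j j = σ n j := by
  simp [pairCol, h, subOne_x]

theorem pairCol_of_ne {i j : Fin n} (hi : i ≠ v) (hj : i ≠ j) : pairCol (x n) v j i = 0 := by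
  simp [pairCol, hi, hj]

theorem det_tv_pairCol (j : Fin n) (d : R n) :
    (tv (pairCol (x n) v j) (d • kos (x n) j v)).det = 1 := by
  rw [det_tv, smul_dotProduct, kos_dotProduct_pairCol, smul_zero, add_zero]

/-- Every nonzero entry contains `σ_i τ_j` with `j < v`, except entry `(v, j)`, which is `-σ_v² μ_j
b`. That is the exceptional term permitted in row `v`. -/
theorem tv_pairCol_mem_admOne_of_lt {j : Fin n} (hj : j < v) {b : R n}
    (hb : keep (low n (v + 1)) b = b) :
    tv (pairCol (x n) v j) ((geom (x n) m j * b) • kos (x n) j v) ∈ admOne m v := by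
  have hjv : j ≠ v := hj.ne
  have hτ : ∀ i, σ n i * τ n m j * b ∈ N n m (v + 1) := fun i =>
    σ_τ_mem_N (Or.inl (Nat.lt_succ_of_lt hj)) b
  have hσ := σ_mul_geom (n := n) m j
  have hL : τ n m j * b ∈ L n m := τ_mem_L j b
  refine mem_admOne_of_det_eq_one (tv_pairCol_geom_mem_powMat hjv b)
    (Good.tv_of (fun i k => ?_) (fun k => ?_) fun i k hi hk => ?_) (det_tv_pairCol j _)
  · rcases eq_or_ne i v with rfl | hi
    · rw [pairCol_left hjv, Pi.smul_apply, smul_eq_mul]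
      rcases eq_or_ne k i with rfl | hk
      · rw [kos_right _ hjv, subOne_x]
        refine mem_E1_of_mem_N ?_
        convert! hτ k using 1
        rw [← hσ]; ring
      · rcases eq_or_ne k j with rfl | hk'
        · rw [kos_left _ hjv, subOne_x]
          convert! mem_E1_of_eq (m := m) (v := i) (i := i) (j := k) (f := -b)
            (by rw [map_neg, hb]) (fun h => ?_) using 1
          · ring
          · exact absurd h (by simp [hj.le])
        · rw [kos_of_ne _ hk' hk, mul_zero, mul_zero]; exact zero_mem _
    · rcases eq_or_ne i j with rfl | hi'
      · rw [pairCol_right hjv, Pi.smul_apply, smul_eq_mul]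
        rcases eq_or_ne k v with rfl | hk
        · rw [kos_right _ hjv, subOne_x]
          refine mem_E1_of_mem_N ?_
          convert! hτ i using 1
          rw [← hσ]; ring
        · rcases eq_or_ne k i with rfl | hk'
          · rw [kos_left _ hjv, subOne_x]
            refine mem_E1_of_mem_N ?_
            convert! Submodule.neg_mem _ (hτ v) using 1
            rw [← hσ]; ring
          · rw [kos_of_ne _ hk' hk, mul_zero, mul_zero]; exact zero_mem _
      · rw [pairCol_of_ne hi hi', zero_mul]; exact zero_mem _
  · rw [pairCol_left hjv, Pi.smul_apply, smul_eq_mul]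
    rcases eq_or_ne k v with rfl | hk
    · rw [kos_right _ hjv, subOne_x]
      refine mem_E2_of_mem_E3 ?_
      convert! keep_σ_mul_mem_E3 hL using 2
      rw [← hσ]; ring
    · rcases eq_or_ne k j with rfl | hk'
      · rw [kos_left _ hjv, subOne_x]
        refine ⟨-b, 0, by rw [map_neg, hb], fun h => absurd h hj.le.not_gt, Ideal.zero_mem _,
          map_zero _, ?_⟩
        rw [map_mul, map_mul, map_mul, map_neg, hb, keep_σ_of_mem (mem_low_self v),
          keep_geom_of_mem (mem_low_of_le hj.le)]
        ring
      · rw [kos_of_ne _ hk' hk, mul_zero, mul_zero, map_zero]; exact zero_mem _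
  · rcases eq_or_ne i j with rfl | hi'
    · rw [pairCol_right hjv, Pi.smul_apply, smul_eq_mul]
      rcases eq_or_ne k i with rfl | hk'
      · rw [kos_left _ hjv, subOne_x]
        convert! keep_σ_mul_mem_E3 (Submodule.neg_mem _ hL) using 2
        rw [← hσ]; ring
      · rw [kos_of_ne _ hk' hk, mul_zero, mul_zero, map_zero]; exact zero_mem _
    · rw [pairCol_of_ne hi hi', zero_mul, map_zero]; exact zero_mem _

/-- Now the exceptional entry is `(j, v)`, namely `σ_j² μ_v b` up to a multiple of `m σ_j²`. The
retraction kills it together with `σ_j`. The part with `μ_v` is a product of `m`-th powers by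
exchanging `v` and `j`, which only changes the sign of the Koszul row. -/
theorem tv_pairCol_mem_admOne_of_gt {j : Fin n} (hj : v < j) {a b : R n}
    (hb : keep (low n (v + 1)) b = b) :
    tv (pairCol (x n) v j) ((m * a + geom (x n) m v * b) • kos (x n) j v) ∈ admOne m v := by
  have hjv : j ≠ v := hj.ne'
  have hσ := σ_mul_geom (n := n) m v
  have hN : ∀ i, σ n i * (m * σ n v * a + τ n m v * b) ∈ N n m (v + 1) := fun i => by
    convert! Ideal.add_mem _ (mul_σ_σ_mem_N i v a)
      (σ_τ_mem_N (m := m) (k := v + 1) (i := i) (r := v) (Or.inl (Nat.lt_succ_self _)) b) using 1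
    ring
  have hL : m * σ n v * a + τ n m v * b ∈ L n m :=
    Ideal.add_mem _ (mul_σ_mem_L _ _) (τ_mem_L _ _)
  have hj0 : keep (low n (v + 1)) (σ n j) = 0 := keep_σ_of_notMem (notMem_low_of_lt hj)
  refine mem_admOne_of_det_eq_one ?_
    (Good.tv_of (fun i k => ?_) (fun k => ?_) fun i k hi hk => ?_) (det_tv_pairCol j _)
  · rw [add_smul]
    refine tv_add_mem_powMat ?_ (tv_pairCol_natCast_mem_powMat v j a) ?_
    · rw [smul_dotProduct, kos_dotProduct_pairCol, smul_zero]
    · have h := tv_pairCol_geom_mem_powMat (X := x n) (m := m) hj.ne (-b)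
      rwa [pairCol_comm, kos_swap, smul_neg, mul_neg, neg_smul, neg_neg] at h
  · rcases eq_or_ne i v with rfl | hi
    · rw [pairCol_left hjv, Pi.smul_apply, smul_eq_mul]
      refine mem_E1_of_mem_N ?_
      rcases eq_or_ne k i with rfl | hk
      · rw [kos_right _ hjv, subOne_x]
        convert! hN j using 1
        rw [← hσ]; ring
      · rcases eq_or_ne k j with rfl | hk'
        · rw [kos_left _ hjv, subOne_x]
          convert! Submodule.neg_mem _ (hN i) using 1
          rw [← hσ]; ring
        · rw [kos_of_ne _ hk' hk, mul_zero, mul_zero]; exact Ideal.zero_mem _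
    · rcases eq_or_ne i j with rfl | hi'
      · rw [pairCol_right hjv, Pi.smul_apply, smul_eq_mul]
        rcases eq_or_ne k v with rfl | hk
        · rw [kos_right _ hjv, subOne_x]
          refine ⟨b, keep_low_of_le (Nat.succ_le_succ hj.le) hb,
            fun h => absurd h (by simp [hj.le]), ?_⟩
          convert! mul_σ_σ_mem_N i i a using 1
          ring
        · rcases eq_or_ne k i with rfl | hk'
          · rw [kos_left _ hjv, subOne_x]
            refine mem_E1_of_mem_N ?_
            convert! Submodule.neg_mem _ (hN k) using 1
            rw [← hσ]; ring
          · rw [kos_of_ne _ hk' hk, mul_zero, mul_zero]; exact zero_mem _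
      · rw [pairCol_of_ne hi hi', zero_mul]; exact zero_mem _
  · rw [pairCol_left hjv, Pi.smul_apply, smul_eq_mul]
    refine mem_E2_of_mem_E3 ?_
    rcases eq_or_ne k v with rfl | hk
    · rw [kos_right _ hjv, subOne_x, map_mul, map_mul, hj0, mul_zero, mul_zero]
      exact zero_mem _
    · rcases eq_or_ne k j with rfl | hk'
      · rw [kos_left _ hjv, subOne_x]
        convert! keep_σ_mul_mem_E3 (Submodule.neg_mem _ hL) using 2
        rw [← hσ]; ring
      · rw [kos_of_ne _ hk' hk, mul_zero, mul_zero, map_zero]; exact zero_mem _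
  · rcases eq_or_ne i j with rfl | hi'
    · rw [pairCol_right hjv, map_mul, hj0, zero_mul]; exact zero_mem _
    · rw [pairCol_of_ne hi hi', zero_mul, map_zero]; exact zero_mem _

/-- With the column `σ` any multiplier in `H` is available: the row is orthogonal to the column, so
the contributions of `m` and of each `τ_i = μ_i σ_i` multiply to give their sum. The entries are of
the form `± σ_i σ_j h` with `j ≤ v`, and `σ_j h` lies in `L` and involves only the variables up to
`v`. -/
theorem tv_σ_mem_admOne {k : Fin n} (hk : k < v) {h : R n} (hh : h ∈ H n m)
    (hh' : keep (low n (v + 1)) h = h) : tv (σ n) (h • kos (x n) k v) ∈ admOne m v := by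
  have hkv : k ≠ v := hk.ne
  have hs : ∀ d : R n, (d • kos (x n) k v) ⬝ᵥ σ n = 0 := fun d => by
    rw [smul_dotProduct, ← subOne_x, kos_dotProduct_subOne, smul_zero]
  have hN : ∀ i j, j ≤ v → σ n i * (σ n j * h) ∈ N n m (v + 1) := fun i j hj => by
    have h1 := σ_mul_keep_mem_N (k := v + 1) i (σ_mul_mem_L j hh)
    rwa [map_mul, hh', keep_σ_of_mem (mem_low_of_le hj)] at h1
  refine mem_admOne_of_det_eq_one ?_
    (Good.tv_of (fun i j => mem_E1_of_mem_N ?_) (fun j => mem_E2_of_mem_E3 ?_) fun i j hi hj => ?_)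
    (by rw [det_tv, hs, add_zero])
  · obtain ⟨a, b, rfl⟩ := mem_H_iff.1 hh
    rw [add_smul, mul_smul]
    refine tv_add_mem_powMat (by rw [smul_dotProduct, hs, smul_zero])
      (tv_natCast_smul_mem_powMat (hs _) (hs _)) ?_
    have h1 : ∀ S : Finset (Fin n),
        tv (σ n) ((∑ i ∈ S, b i * τ n m i) • kos (x n) k v) ∈ powMat (σ n) m := by
      intro S
      induction S using Finset.induction_on with
      | empty => rw [Finset.sum_empty, zero_smul, tv_zero]; exact one_mem _
      | insert i S hi ih =>
        rw [Finset.sum_insert hi, add_smul]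
        refine tv_add_mem_powMat (hs _) ?_ ih
        have h2 := tv_subOne_geom_mem_powMat (X := x n) (m := m) i (hs (b i * σ n i))
        rw [smul_smul] at h2
        convert! h2 using 3
        rw [← geom_mul_σ]; ring
    exact h1 _
  · rw [Pi.smul_apply, smul_eq_mul]
    rcases eq_or_ne j v with rfl | hj
    · rw [kos_right _ hkv, subOne_x, mul_comm h]; exact hN i k hk.le
    · rcases eq_or_ne j k with rfl | hj'
      · rw [kos_left _ hkv, subOne_x]
        convert! Submodule.neg_mem _ (hN i v le_rfl) using 1
        ring
      · rw [kos_of_ne _ hj' hj, mul_zero, mul_zero]; exact Ideal.zero_mem _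
  · rw [Pi.smul_apply, smul_eq_mul]
    rcases eq_or_ne j v with rfl | hj
    · rw [kos_right _ hkv, subOne_x, mul_comm h]; exact keep_σ_mul_mem_E3 (σ_mul_mem_L k hh)
    · rcases eq_or_ne j k with rfl | hj'
      · rw [kos_left _ hkv, subOne_x]
        convert! keep_σ_mul_mem_E3 (Submodule.neg_mem _ (σ_mul_mem_L v hh)) using 2
        ring
      · rw [kos_of_ne _ hj' hj, mul_zero, mul_zero, map_zero]; exact zero_mem _
  · rw [Pi.smul_apply, smul_eq_mul]
    rcases eq_or_ne j k with rfl | hj'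
    · rw [kos_left _ hkv, subOne_x]
      convert! keep_σ_mul_mem_E3 (Submodule.neg_mem _ (σ_mul_mem_L i hh)) using 2
      ring
    · rw [kos_of_ne _ hj' hj, mul_zero, mul_zero, map_zero]; exact zero_mem _

theorem tv_σ_sum_mem_admOne (S : Finset (Fin n)) (hS : ∀ k ∈ S, k < v) {h : Fin n → R n}
    (hh : ∀ k, h k ∈ H n m) (hh' : ∀ k, keep (low n (v + 1)) (h k) = h k) :
    tv (σ n) (∑ k ∈ S, h k • kos (x n) k v) ∈ admOne m v := by
  induction S using Finset.induction_on with
  | empty => rw [Finset.sum_empty, tv_zero]; exact one_mem _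
  | insert i S hi ih =>
    rw [Finset.sum_insert hi, ← tv_mul_tv_of_dotProduct_eq_zero]
    · exact mul_mem (tv_σ_mem_admOne (hS i (Finset.mem_insert_self _ _)) (hh i) (hh' i))
        (ih fun k hk => hS k (Finset.mem_insert_of_mem hk))
    · rw [smul_dotProduct, ← subOne_x, kos_dotProduct_subOne, smul_zero]

theorem geom_eq (m : ℕ) (i : Fin n) : ∃ p, geom (x n) m i = m + σ n i * p := by
  obtain ⟨p, hp⟩ : σ n i ∣ geom (x n) m i - m := by
    rw [geom]
    induction m with
    | zero => simp
    | succ m ih =>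
      rw [Finset.sum_range_succ, Nat.cast_succ]
      have h1 : σ n i ∣ (x n i : R n) ^ m - 1 := sub_one_dvd_pow_sub_one _ _
      convert! dvd_add ih h1 using 1
      ring
  exact ⟨p, by rw [← hp]; ring⟩

/-- The sum of length `m²` is `μ_i` times the sum of the first `m` powers of `x_i ^ m`. The first
factor is `m` modulo `σ_i`, the second is `m` modulo `τ_i`. -/
theorem geom_sq_eq (m : ℕ) (i : Fin n) : ∃ p q,
    geom (x n) (m ^ 2) i = (m : R n) ^ 2 + m * σ n i * p + σ n i * τ n m i * q := by
  obtain ⟨p, hp⟩ := geom_eq m i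
  obtain ⟨q, hq⟩ : τ n m i ∣ (∑ k ∈ Finset.range m, ((x n i : R n) ^ m) ^ k) - m := by
    have : ∀ l : ℕ, τ n m i ∣ (∑ k ∈ Finset.range l, ((x n i : R n) ^ m) ^ k) - l := by
      intro l
      induction l with
      | zero => simp
      | succ l ih =>
        rw [Finset.sum_range_succ, Nat.cast_succ]
        have h1 : τ n m i ∣ ((x n i : R n) ^ m) ^ l - 1 := sub_one_dvd_pow_sub_one _ _
        convert! dvd_add ih h1 using 1
        ring
    exact this m
  have h1 : geom (x n) (m ^ 2) i =
      geom (x n) m i * ∑ k ∈ Finset.range m, ((x n i : R n) ^ m) ^ k := by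
    refine mul_right_cancel₀ (σ_ne_zero i) ?_
    rw [geom_mul_σ, mul_right_comm, geom_mul_σ, mul_comm, τ, τ, geom_sum_mul, ← pow_mul, pow_two]
  have h2 := σ_mul_geom (n := n) m i
  refine ⟨p + q * geom (x n) m i, p * q, ?_⟩
  rw [h1, sub_eq_iff_eq_add.1 hq, ← h2, hp]
  ring

/-- This is what the exponent `m²` is for: already at `k = 0`, the ideal contains these elements for
all `i` and `j`, whereas `σ_j τ_i` with `i ≠ j` is only a generator for `i < k`. -/
theorem σ_mul_geom_sq_mem_N {k : ℕ} (i j : Fin n) (a : R n) :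
    σ n j * geom (x n) (m ^ 2) i * a ∈ N n m k := by
  obtain ⟨p, q, h⟩ := geom_sq_eq m i
  rw [h]
  convert! Ideal.add_mem _ (Ideal.add_mem _ (sq_mem_N (σ n j * a))
    (mul_σ_σ_mem_N i j (p * a))) (σ_τ_mem_N (Or.inr rfl : i.val < k ∨ i = i) (q * a * σ n j)) using 1
  ring

theorem geom_sq_mem_L (i : Fin n) : geom (x n) (m ^ 2) i ∈ L n m := by
  obtain ⟨p, q, h⟩ := geom_sq_eq m i
  rw [h]
  convert! Ideal.add_mem _ (Ideal.add_mem _ (sq_mem_L (1 : R n))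
    (mul_σ_mem_L i p)) (τ_mem_L i (σ n i * q)) using 1
  ring

theorem Good.tv_geom_sq_of_gt {j : Fin n} (hj : v < j) (a : R n) :
    Good m v (tv (Pi.single v 1) ((a * geom (x n) (m ^ 2) j) • kos (x n) j v)) := by
  have hjv : j ≠ v := hj.ne'
  have hj0 : keep (low n (v + 1)) (σ n j) = 0 := keep_σ_of_notMem (notMem_low_of_lt hj)
  refine Good.tv_single (fun k => mem_E1_of_mem_N ?_) fun k => mem_E2_of_mem_E3 ?_
  · rw [Pi.smul_apply, smul_eq_mul]
    rcases eq_or_ne k v with rfl | hk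
    · rw [kos_right _ hjv, subOne_x]
      convert! σ_mul_geom_sq_mem_N j j a using 1
      ring
    · rcases eq_or_ne k j with rfl | hk'
      · rw [kos_left _ hjv, subOne_x]
        convert! Submodule.neg_mem _ (σ_mul_geom_sq_mem_N k v a) using 1
        ring
      · rw [kos_of_ne _ hk' hk, mul_zero]; exact Ideal.zero_mem _
  · rw [Pi.smul_apply, smul_eq_mul]
    rcases eq_or_ne k v with rfl | hk
    · rw [kos_right _ hjv, subOne_x, map_mul, hj0, mul_zero]; exact zero_mem _
    · rcases eq_or_ne k j with rfl | hk'
      · rw [kos_left _ hjv, subOne_x]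
        convert! keep_σ_mul_mem_E3 (Ideal.mul_mem_left _ (-a) (geom_sq_mem_L k)) using 2
        ring
      · rw [kos_of_ne _ hk' hk, mul_zero, map_zero]; exact zero_mem _

theorem Good.tv_geom_sq_of_ne {l : Fin n} (hl : l ≠ v) (a : R n) :
    Good m v (tv (Pi.single l 1) ((a * geom (x n) (m ^ 2) v) • kos (x n) v l)) := by
  refine Good.tv_of (fun i k => mem_E1_of_mem_N ?_) (fun k => ?_) fun i k hi hk => ?_
  · rcases eq_or_ne i l with rfl | hi
    · rw [Pi.single_eq_same, one_mul, Pi.smul_apply, smul_eq_mul]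
      rcases eq_or_ne k i with rfl | hk
      · rw [kos_right _ hl.symm, subOne_x]
        convert! σ_mul_geom_sq_mem_N v v a using 1
        ring
      · rcases eq_or_ne k v with rfl | hk'
        · rw [kos_left _ hl.symm, subOne_x]
          convert! Submodule.neg_mem _ (σ_mul_geom_sq_mem_N k i a) using 1
          ring
        · rw [kos_of_ne _ hk' hk, mul_zero]; exact Ideal.zero_mem _
    · rw [Pi.single_eq_of_ne hi, zero_mul]; exact Ideal.zero_mem _
  · rw [Pi.single_eq_of_ne hl.symm, zero_mul, map_zero]; exact zero_mem _
  · rcases eq_or_ne i l with rfl | hi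
    · rw [Pi.single_eq_same, one_mul, Pi.smul_apply, smul_eq_mul]
      rcases eq_or_ne k i with rfl | hk'
      · rw [kos_right _ hl.symm, subOne_x]
        convert! keep_σ_mul_mem_E3 (Ideal.mul_mem_left _ a (geom_sq_mem_L v)) using 2
        ring
      · rw [kos_of_ne _ hk hk', mul_zero, map_zero]; exact zero_mem _
    · rw [Pi.single_eq_of_ne hi, zero_mul, map_zero]; exact zero_mem _

theorem tv_geom_sq_mem_powMat {u r : Fin n} (h : r ≠ u) :
    tv (Pi.single u 1) (((1 : R n) * geom (x n) (m ^ 2) r) • kos (x n) r u) ∈ powMat (σ n) m := by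
  rw [one_mul, ← scaling_pow h, pow_two, pow_mul]
  have h1 := pow_mem_powMat (m := m) (scaling_mem_stabMat (X := x n) h)
  rw [subOne_x] at h1
  exact pow_mem h1 m

theorem tv_inv_geom_sq_mem_powMat {u r : Fin n} (h : r ≠ u) :
    tv (Pi.single u 1) ((-(((x n r ^ m ^ 2)⁻¹ : (R n)ˣ) : R n) * geom (x n) (m ^ 2) r) •
      kos (x n) r u) ∈ powMat (σ n) m := by
  refine powMat_of_mul_left ?_ (tv_geom_sq_mem_powMat h)
  have h1 : (1 : R n) + geom (x n) (m ^ 2) r * σ n r = ((x n r ^ m ^ 2 : (R n)ˣ) : R n) := by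
    rw [geom_mul_σ, τ, add_sub_cancel, Units.val_pow_eq_pow_val]
  rw [tv_mul_tv, one_mul, smul_dotProduct, dotProduct_single_one, kos_right _ h, subOne_x,
    smul_eq_mul, h1, smul_smul, ← mul_assoc, mul_neg, Units.mul_inv, neg_one_mul, neg_smul,
    add_neg_cancel, tv_zero]
  exact one_mem _

theorem det_tv_geom_sq {u r : Fin n} (h : r ≠ u) : ((x n r ^ m ^ 2 : (R n)ˣ) : R n) =
    (tv (Pi.single u 1) (((1 : R n) * geom (x n) (m ^ 2) r) • kos (x n) r u)).det := by
  rw [det_tv, smul_dotProduct, dotProduct_single_one, kos_right _ h, subOne_x, one_mul,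
    smul_eq_mul, geom_mul_σ, τ, add_sub_cancel, Units.val_pow_eq_pow_val]

theorem det_tv_inv_geom_sq {u r : Fin n} (h : r ≠ u) : (((x n r ^ m ^ 2)⁻¹ : (R n)ˣ) : R n) =
    (tv (Pi.single u 1) ((-(((x n r ^ m ^ 2)⁻¹ : (R n)ˣ) : R n) * geom (x n) (m ^ 2) r) •
      kos (x n) r u)).det := by
  have h2 : (((x n r ^ m ^ 2)⁻¹ : (R n)ˣ) : R n) * (x n r : R n) ^ m ^ 2 = 1 := by
    rw [← Units.val_pow_eq_pow_val, Units.inv_mul]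
  rw [det_tv, smul_dotProduct, dotProduct_single_one, kos_right _ h, subOne_x,
    smul_eq_mul, mul_assoc, geom_mul_σ, τ]
  linear_combination h2

theorem x_pow_mem_detGroup (i : Fin n) : x n i ^ m ^ 2 ∈ detGroup n m :=
  Subgroup.subset_closure ⟨i, rfl⟩

/-- The determinant is placed in a row `l ≠ v`, so that row `v` is undisturbed. The case of negative
exponents uses the inverse matrix, whose determinant is `x_v ^ (-m²)`. -/
theorem exists_mem_adm_det_eq (hn : 4 ≤ n) (q : ℤ) :
    ∃ P ∈ adm m v, (((x n v ^ m ^ 2) ^ q : (R n)ˣ) : R n) = P.det ∧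
      ∀ j, P v j = (1 : Matrix (Fin n) (Fin n) (R n)) v j := by
  obtain ⟨l, hl, -⟩ := exists_notMem_triple hn v v v
  have h1 : ∀ w : Fin n → R n, ∀ j, tv (Pi.single l 1) w v j =
      (1 : Matrix (Fin n) (Fin n) (R n)) v j :=
    fun w j => by rw [tv_apply, Pi.single_eq_of_ne hl.symm, zero_mul, add_zero]
  have h2 : ∀ P : Matrix (Fin n) (Fin n) (R n), ∀ u : (R n)ˣ, P ∈ adm m v → (u : R n) = P.det →
      (∀ j, P v j = (1 : Matrix (Fin n) (Fin n) (R n)) v j) → ∀ q : ℕ,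
      ∃ P ∈ adm m v, ((u ^ q : (R n)ˣ) : R n) = P.det ∧
      ∀ j, P v j = (1 : Matrix (Fin n) (Fin n) (R n)) v j := by
    intro P u hP hd hr q
    refine ⟨P ^ q, pow_mem hP q, by rw [det_pow, ← hd, Units.val_pow_eq_pow_val], ?_⟩
    induction q with
    | zero => intro j; rw [pow_zero]
    | succ q ih =>
      intro j
      rw [pow_succ, Matrix.mul_apply]
      simp_rw [ih]
      rw [← Matrix.mul_apply, one_mul, hr]
  obtain ⟨k, rfl | rfl⟩ := q.eq_nat_or_neg
  · rw [zpow_natCast]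
    exact h2 _ _ ⟨tv_geom_sq_mem_powMat hl.symm, Good.tv_geom_sq_of_ne hl _,
      _, x_pow_mem_detGroup v, det_tv_geom_sq hl.symm⟩ (det_tv_geom_sq hl.symm) (h1 _) k
  · rw [_root_.zpow_neg, zpow_natCast, ← inv_pow]
    exact h2 _ _ ⟨tv_inv_geom_sq_mem_powMat hl.symm, Good.tv_geom_sq_of_ne hl _,
      _, inv_mem (x_pow_mem_detGroup v), det_tv_inv_geom_sq hl.symm⟩
      (det_tv_inv_geom_sq hl.symm) (h1 _) k

end GoodGenerators

/-! ### Clearing the entries of row `v` beyond the diagonal, after retraction -/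

section Tail

open Matrix

variable {n m : ℕ} {v : Fin n}

theorem exists_keep_empty_eq (f : R n) : ∃ c : ℤ, keep ∅ f = c := by
  induction f using AddMonoidAlgebra.induction_linear with
  | zero => exact ⟨0, by simp⟩
  | add f g hf hg =>
    obtain ⟨c, hc⟩ := hf
    obtain ⟨d, hd⟩ := hg
    exact ⟨c + d, by rw [map_add, hc, hd, Int.cast_add]⟩
  | single g c =>
    refine ⟨c, ?_⟩
    rw [keep_single, AddMonoidAlgebra.intCast_def]
    simp; rfl

theorem map_keep_tv_single (S : Finset (Fin n)) (v : Fin n) (w : Fin n → R n) :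
    (tv (Pi.single v 1) w).map (keep S) = tv (Pi.single v 1) (keep S ∘ w) := by
  rw [map_tv]
  congr 1
  ext1 i
  rw [Function.comp_apply]
  rcases eq_or_ne i v with rfl | h
  · rw [Pi.single_eq_same, map_one]
  · rw [Pi.single_eq_of_ne h, map_zero]

/-- The rows, supported beyond `v`, which can be added to the `v`-th row of the identity by
an admissible matrix after setting the variables beyond `v` to one. -/
noncomputable def tail (m : ℕ) (v : Fin n) : AddSubmonoid (Fin n → R n) where
  carrier := {κ | (∀ j ≤ v, κ j = 0) ∧
    ∃ P ∈ admOne m v, P.map (keep (low n (v + 1))) = tv (Pi.single v 1) κ}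
  zero_mem' := ⟨fun _ _ => rfl, 1, one_mem _, by
    rw [tv_zero, Matrix.map_one _ (map_zero _) (map_one _)]⟩
  add_mem' := by
    rintro κ κ' ⟨h, P, hP, hP'⟩ ⟨h', Q, hQ, hQ'⟩
    refine ⟨fun j hj => by rw [Pi.add_apply, h j hj, h' j hj, add_zero], P * Q, mul_mem hP hQ, ?_⟩
    rw [Matrix.map_mul, hP', hQ', tv_mul_tv_of_dotProduct_eq_zero]
    rw [dotProduct_single_one, h v le_rfl]

theorem mem_tail_single {j : Fin n} (hj : v < j) {a : R n} {P : Matrix (Fin n) (Fin n) (R n)}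
    (hP : P ∈ admOne m v)
    (h : P.map (keep (low n (v + 1))) = tv (Pi.single v 1) (Pi.single j a)) :
    Pi.single j a ∈ tail m v :=
  ⟨fun _ hk => Pi.single_eq_of_ne (hk.trans_lt hj).ne _, P, hP, h⟩

theorem single_natCast_mul_σ_mem_tail {k j : Fin n} (hk : k < v) (hj : v < j) {a : R n}
    (ha : keep (low n (v + 1)) a = a) :
    (Pi.single j (σ n v * (m * σ n k * a)) : Fin n → R n) ∈ tail m v := by
  have hkj : k ≠ j := (hk.trans hj).ne
  have hj0 : keep (low n (v + 1)) (σ n j) = 0 := keep_σ_of_notMem (notMem_low_of_lt hj)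
  have hk0 : keep (low n (v + 1)) (σ n k) = σ n k := keep_σ_of_mem (mem_low_of_le hk.le)
  have hv0 : keep (low n (v + 1)) (σ n v) = σ n v := keep_σ_of_mem (mem_low_self v)
  have hcv : kos (x n) k j v = 0 := kos_of_ne _ hk.ne' hj.ne
  have hmem : tv (Pi.single v 1) (((m : R n) * (σ n v * a)) • kos (x n) k j) ∈ powMat (σ n) m := by
    rw [mul_smul]
    exact (natCast_smul_mem_rowGroup (X := x n) (by rw [Pi.smul_apply, hcv, smul_zero])
      (by rw [smul_dotProduct, kos_dotProduct_subOne, smul_zero])).2.2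
  have hentry : ∀ i, keep (low n (v + 1)) ((((m : R n) * (σ n v * a)) • kos (x n) k j) i) =
      (Pi.single j (σ n v * (m * σ n k * a)) : Fin n → R n) i := by
    intro i
    rw [Pi.smul_apply, smul_eq_mul]
    rcases eq_or_ne i j with rfl | hi
    · rw [kos_right _ hkj, Pi.single_eq_same, subOne_x, map_mul, map_mul, map_mul, hk0, hv0, ha,
        map_natCast]
      ring
    · rw [Pi.single_eq_of_ne hi]
      rcases eq_or_ne i k with rfl | hi'
      · rw [kos_left _ hkj, subOne_x, map_mul, map_neg, hj0, neg_zero, mul_zero]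
      · rw [kos_of_ne _ hi' hi, mul_zero, map_zero]
  refine mem_tail_single hj (mem_admOne_of_det_eq_one hmem (Good.tv_single (fun i => ?_)
    fun i => ?_) ?_) ?_
  · refine mem_E1_of_mem_N ?_
    rw [Pi.smul_apply, smul_eq_mul]
    rcases eq_or_ne i j with rfl | hi
    · rw [kos_right _ hkj, subOne_x]
      convert! mul_σ_σ_mem_N v k a using 1; ring
    · rcases eq_or_ne i k with rfl | hi'
      · rw [kos_left _ hkj, subOne_x]
        convert! mul_σ_σ_mem_N v j (-a) using 1; ring
      · rw [kos_of_ne _ hi' hi, mul_zero]; exact Ideal.zero_mem _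
  · refine mem_E2_of_mem_E3 ?_
    rw [hentry]
    rcases eq_or_ne i j with rfl | hi
    · rw [Pi.single_eq_same]
      refine σ_mul_mem_E3 (mul_σ_mem_L _ _) ?_
      rw [map_mul, map_mul, hk0, ha, map_natCast]
    · rw [Pi.single_eq_of_ne hi]; exact zero_mem _
  · rw [det_tv, dotProduct_single_one, Pi.smul_apply, hcv, smul_zero, add_zero]
  · rw [map_keep_tv_single]
    congr 1
    ext1 i
    exact hentry i

theorem single_pairCol_mem_tail {j : Fin n} (hj : v < j) {a b : R n}
    (ha : keep (low n (v + 1)) a = a) (hb : keep (low n (v + 1)) b = b) :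
    (Pi.single j (σ n v * (m * σ n v * a + τ n m v * b)) : Fin n → R n) ∈ tail m v := by
  have hj0 : keep (low n (v + 1)) (σ n j) = 0 := keep_σ_of_notMem (notMem_low_of_lt hj)
  have hv0 : keep (low n (v + 1)) (σ n v) = σ n v := keep_σ_of_mem (mem_low_self v)
  have hb' : keep (low n (v + 1)) (-b) = -b := by rw [map_neg, hb]
  refine mem_tail_single hj (tv_pairCol_mem_admOne_of_gt (a := -a) hj hb') ?_
  refine Matrix.ext fun i k => ?_
  rw [map_apply, tv_apply, tv_apply, map_add, map_mul, Pi.smul_apply, smul_eq_mul]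
  congr 1
  · rw [one_apply]; split_ifs <;> simp
  · rcases eq_or_ne i v with rfl | hi
    · rw [pairCol_left hj.ne', Pi.single_eq_same, one_mul]
      rcases eq_or_ne k j with rfl | hk
      · rw [kos_left _ hj.ne', Pi.single_eq_same, subOne_x]
        simp only [map_mul, map_add, map_neg, map_natCast, hv0, ha, hb,
          keep_geom_of_mem (mem_low_self i)]
        rw [← σ_mul_geom]
        ring
      · rw [Pi.single_eq_of_ne hk]
        rcases eq_or_ne k i with rfl | hk'
        · rw [kos_right _ hj.ne', subOne_x, map_mul (keep _) _ (σ n j), hj0, mul_zero, mul_zero]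
        · rw [kos_of_ne _ hk hk', mul_zero, map_zero, mul_zero]
    · rw [Pi.single_eq_of_ne hi, zero_mul]
      rcases eq_or_ne i j with rfl | hi'
      · rw [pairCol_right hj.ne', hj0, zero_mul]
      · rw [pairCol_of_ne hi hi', map_zero, zero_mul]

/-- Adding a multiple of `σ_v μ_r • kos r j` to row `v` would give the right retraction but leave
`σ_v σ_j μ_r` in entry `(v, r)`, a form which `E1` does not provide for. The commutator of `scaling
(x n) j v` with a transvection in row `v` has the same retracted row, while its exceptional term
`σ_j² μ_r` sits in entry `(j, r)`, where it is permitted. -/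
theorem single_τ_mem_tail {r j : Fin n} (hr : r < v) (hj : v < j) {b : R n}
    (hb : keep (low n (v + 1)) b = b) :
    (Pi.single j (σ n v * (τ n m r * b)) : Fin n → R n) ∈ tail m v := by
  have hrj : r ≠ j := (hr.trans hj).ne
  have hj0 : keep (low n (v + 1)) (σ n j) = 0 := keep_σ_of_notMem (notMem_low_of_lt hj)
  have hv0 : keep (low n (v + 1)) (σ n v) = σ n v := keep_σ_of_mem (mem_low_self v)
  have hτ0 : keep (low n (v + 1)) (τ n m r) = τ n m r := keep_τ_of_mem (mem_low_of_le hr.le)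
  have hg := σ_mul_geom (n := n) m r
  obtain ⟨X, hX⟩ : ∃ X : R n, X = (x n v : R n) := ⟨_, rfl⟩
  have hXσ : X = σ n v + 1 := by rw [hX, σ, sub_add_cancel]
  obtain ⟨c, hc⟩ : ∃ c : R n, c = -b := ⟨_, rfl⟩
  have hcb : keep (low n (v + 1)) c = c := by rw [hc, map_neg, hb]
  -- The factor `x_v` makes entry `j` of `w + d` equal to `(x_v - σ_v) τ_r c = τ_r c`. This is what
  -- turns `w + d` into `w` under `scaling (x n) j v`, so that `w + d` is the row of the conjugated
  -- transvection. The sign in `c = -b` makes entry `j` of `d` equal to `σ_v τ_r b`.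
  set w : Fin n → R n := (geom (x n) m r * (X * c)) • kos (x n) r j with hw
  have hwv : w v = 0 := by rw [hw, Pi.smul_apply, kos_of_ne _ hr.ne' hj.ne, smul_zero]
  have hwj : w j = X * (τ n m r * c) := by
    rw [hw, Pi.smul_apply, kos_right _ hrj, subOne_x, ← hg, smul_eq_mul]; ring
  have hwr : w r = -(X * (σ n j * geom (x n) m r * c)) := by
    rw [hw, Pi.smul_apply, kos_left _ hrj, subOne_x, smul_eq_mul]; ring
  have hwk : ∀ k, k ≠ j → k ≠ r → w k = 0 := fun k hk hk' => by
    rw [hw, Pi.smul_apply, kos_of_ne _ hk' hk, smul_zero]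
  set d : Fin n → R n := (τ n m r * c) • kos (x n) j v with hd
  have hdv : d v = σ n j * (τ n m r * c) := by
    rw [hd, Pi.smul_apply, kos_right _ hj.ne', subOne_x, smul_eq_mul]; ring
  have hdj : d j = -(σ n v * (τ n m r * c)) := by
    rw [hd, Pi.smul_apply, kos_left _ hj.ne', subOne_x, smul_eq_mul]; ring
  have hdk : ∀ k, k ≠ j → k ≠ v → d k = 0 := fun k hk hk' => by
    rw [hd, Pi.smul_apply, kos_of_ne _ hk hk', smul_zero]
  set y : Fin n → R n := Pi.single v 1 - σ n j • Pi.single j 1 with hy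
  have hyv : y v = 1 := by simp [hy, hj.ne]
  have hyj : y j = -σ n j := by simp [hy, hj.ne']
  have hyk : ∀ k, k ≠ v → k ≠ j → y k = 0 := fun k hk hk' => by simp [hy, hk, hk']
  have hwmem : tv (Pi.single v 1) w ∈ powMat (σ n) m := by
    rw [hw, mul_smul]
    exact (geom_smul_mem_rowGroup (X := x n) hr.ne
      (by rw [Pi.smul_apply, kos_of_ne _ hr.ne' hj.ne, smul_zero])
      (by rw [smul_dotProduct, kos_dotProduct_subOne, smul_zero])).2.2
  have hWmem : tv y (w + d) ∈ powMat (σ n) m := by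
    refine powMat_of_conj (scaling_mem_stabMat (X := x n) (u := j) hj.ne) hwmem ?_
    have h1 : scaling (x n) j v *ᵥ Pi.single v 1 = y := by
      rw [scaling, tv_mulVec, dotProduct_single_one, kos_left _ hj.ne, subOne_x, hy, neg_smul,
        sub_eq_add_neg]
    have h2 : (w + d) ᵥ* scaling (x n) j v = w := by
      rw [scaling, vecMul_tv, dotProduct_single_one, Pi.add_apply, hwj, hdj, hd, kos_swap,
        smul_neg]
      have : X * (τ n m r * c) + -(σ n v * (τ n m r * c)) = τ n m r * c := by rw [hXσ]; ring
      rw [this]; abel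
    rw [mul_tv, tv_mul, h1, h2]
  set P := tv y (w + d) * tv (Pi.single v 1) (-w) with hP
  have hPmem : P ∈ powMat (σ n) m :=
    mul_mem hWmem (tv_neg_mem_powMat (by rw [dotProduct_single_one, hwv]) hwmem)
  have hPe : ∀ i k, (P - 1) i k =
      y i * (w k + d k - d v * w k) - (Pi.single v 1 : Fin n → R n) i * w k := by
    intro i k
    rw [hP, mul_tv, tv_mulVec, dotProduct_single_one, Matrix.sub_apply, Matrix.add_apply, tv_apply,
      vecMulVec_apply]
    simp only [Pi.add_apply, Pi.smul_apply, Pi.neg_apply, smul_eq_mul, hwv]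
    ring
  have hτN : ∀ i a, σ n i * τ n m r * a ∈ N n m (v + 1) := fun i a =>
    σ_τ_mem_N (Or.inl (Nat.lt_succ_of_lt hr)) a
  have hPvk : ∀ k, (P - 1) v k = d k - d v * w k := by
    intro k; rw [hPe, hyv, Pi.single_eq_same]; ring
  have hPjk : ∀ k, (P - 1) j k = -(σ n j * (w k + d k - d v * w k)) := by
    intro k; rw [hPe, hyj, Pi.single_eq_of_ne hj.ne']; ring
  have hPik : ∀ i k, i ≠ v → i ≠ j → (P - 1) i k = 0 := by
    intro i k h h'; rw [hPe, hyk i h h', Pi.single_eq_of_ne h]; ring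
  have hdvN : d v ∈ N n m (v + 1) := by
    rw [hdv]; convert! hτN j c using 1; ring
  have hdN : ∀ k, d k ∈ N n m (v + 1) := by
    intro k
    rcases eq_or_ne k j with rfl | hk
    · rw [hdj]; convert! hτN v (-c) using 1; ring
    · rcases eq_or_ne k v with rfl | hk'
      · exact hdvN
      · rw [hdk k hk hk']; exact Ideal.zero_mem _
  have hdv0 : keep (low n (v + 1)) (d v) = 0 := by rw [hdv, map_mul, hj0, zero_mul]
  have hd0 : ∀ k, keep (low n (v + 1)) (d k) =
      (Pi.single j (σ n v * (τ n m r * b)) : Fin n → R n) k := by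
    intro k
    rcases eq_or_ne k j with rfl | hk
    · rw [hdj, Pi.single_eq_same, map_neg, map_mul, map_mul, hv0, hτ0, hcb, hc]; ring
    · rw [Pi.single_eq_of_ne hk]
      rcases eq_or_ne k v with rfl | hk'
      · exact hdv0
      · rw [hdk k hk hk', map_zero]
  have hρv : ∀ k, keep (low n (v + 1)) ((P - 1) v k) =
      (Pi.single j (σ n v * (τ n m r * b)) : Fin n → R n) k := by
    intro k; rw [hPvk, map_sub, map_mul, hdv0, zero_mul, sub_zero, hd0]
  have hρi : ∀ i k, i ≠ v → keep (low n (v + 1)) ((P - 1) i k) = 0 := by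
    intro i k hi
    rcases eq_or_ne i j with rfl | hi'
    · rw [hPjk, map_neg, map_mul, hj0, zero_mul, neg_zero]
    · rw [hPik i k hi hi', map_zero]
  have hGood : Good m v P := by
    refine ⟨fun i k => ?_, fun k => mem_E2_of_mem_E3 ?_, fun i k hi _ => ?_⟩
    · rcases eq_or_ne i v with rfl | hi
      · rw [hPvk]
        exact mem_E1_of_mem_N (Ideal.sub_mem _ (hdN k) (Ideal.mul_mem_right _ _ hdvN))
      · rcases eq_or_ne i j with rfl | hi'
        · have h1 : (P - 1) i k = -(σ n i * w k) - σ n i * (d k - d v * w k) := by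
            rw [hPjk]; ring
          rw [h1]
          refine sub_mem ?_ (mem_E1_of_mem_N (Ideal.mul_mem_left _ _
            (Ideal.sub_mem _ (hdN k) (Ideal.mul_mem_right _ _ hdvN))))
          rcases eq_or_ne k i with rfl | hk
          · rw [hwj]
            refine mem_E1_of_mem_N ?_
            convert! hτN k (-(X * c)) using 1; ring
          · rcases eq_or_ne k r with rfl | hk'
            · rw [hwr]
              convert! mem_E1_of_eq (m := m) (v := v) (i := i) (j := k) (f := X * c) ?_ ?_ using 1
              · ring
              · refine keep_low_of_le (Nat.succ_le_succ hj.le) ?_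
                rw [map_mul, hcb, hX, keep_x_of_mem (mem_low_self v)]
              · intro h
                exact absurd h (by simp [hj.le, hr.le])
            · rw [hwk k hk hk', mul_zero, neg_zero]; exact zero_mem _
        · rw [hPik i k hi hi']; exact zero_mem _
    · rw [hρv]
      rcases eq_or_ne k j with rfl | hk
      · rw [Pi.single_eq_same]
        exact σ_mul_mem_E3 (τ_mem_L _ _) (by rw [map_mul, hτ0, hb])
      · rw [Pi.single_eq_of_ne hk]; exact zero_mem _
    · rw [hρi i k hi]; exact zero_mem _
  refine mem_tail_single hj (mem_admOne_of_det_eq_one hPmem hGood ?_) ?_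
  · have h1 : (w + d) ⬝ᵥ y = 0 := by
      rw [hy, dotProduct_sub, dotProduct_smul, dotProduct_single_one, dotProduct_single_one,
        Pi.add_apply, Pi.add_apply, hwv, hdv, hwj, hdj, hXσ, smul_eq_mul]
      ring
    rw [hP, det_mul, det_tv, det_tv, h1, dotProduct_single_one, Pi.neg_apply, hwv]
    ring
  · refine Matrix.ext fun i k => ?_
    have h1 : P i k = (1 : Matrix (Fin n) (Fin n) (R n)) i k + (P - 1) i k := by
      rw [Matrix.sub_apply, add_sub_cancel]
    rw [map_apply, h1, tv_apply, map_add]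
    congr 1
    · rw [one_apply]; split_ifs <;> simp
    · rcases eq_or_ne i v with rfl | hi
      · rw [hρv, Pi.single_eq_same (M := fun _ => R n) i, one_mul]
      · rw [hρi i k hi, Pi.single_eq_of_ne hi, zero_mul]

/-- Iterating the `m`-th power of `scaling (x n) v j` produces the multiplier `1 + x_j + ⋯ + x_j ^
(m² - 1)`, which retracts to `m²`, and the determinant `x_j ^ m²`, which retracts to `1`. Since
`tail` is only known to be a submonoid, both signs are produced, the second by the inverse matrix.
-/
theorem single_sq_mem_tail {j : Fin n} (hj : v < j) (c : ℤ) :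
    (Pi.single j (σ n v * ((m : R n) ^ 2 * c)) : Fin n → R n) ∈ tail m v := by
  have hj0 : keep (low n (v + 1)) (σ n j) = 0 := keep_σ_of_notMem (notMem_low_of_lt hj)
  have hv0 : keep (low n (v + 1)) (σ n v) = σ n v := keep_σ_of_mem (mem_low_self v)
  have hx : ∀ k : ℕ, keep (low n (v + 1)) ((x n j : R n) ^ k) = 1 := fun k => by
    rw [map_pow, keep_x_of_notMem (notMem_low_of_lt hj), one_pow]
  have hxi : keep (low n (v + 1)) (((x n j ^ m ^ 2)⁻¹ : (R n)ˣ) : R n) = 1 := by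
    have h : keep (low n (v + 1)) ((x n j : R n) ^ m ^ 2) *
        keep (low n (v + 1)) (((x n j ^ m ^ 2)⁻¹ : (R n)ˣ) : R n) = 1 := by
      rw [← map_mul, ← Units.val_pow_eq_pow_val, Units.mul_inv, map_one]
    rwa [hx, one_mul] at h
  have key : ∀ a b : R n, keep (low n (v + 1)) a = -b →
      (tv (Pi.single v 1) ((a * geom (x n) (m ^ 2) j) • kos (x n) j v)).map
        (keep (low n (v + 1))) =
      tv (Pi.single v 1) (Pi.single j (σ n v * ((m : R n) ^ 2 * b))) := by
    intro a b hab
    rw [map_keep_tv_single]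
    congr 1
    ext1 i
    rw [Function.comp_apply, Pi.smul_apply, smul_eq_mul]
    rcases eq_or_ne i j with rfl | hi
    · rw [kos_left _ hj.ne', Pi.single_eq_same, subOne_x, map_mul, map_mul, map_neg, hv0, hab,
        keep_geom_of_notMem (notMem_low_of_lt hj), Nat.cast_pow]
      ring
    · rw [Pi.single_eq_of_ne hi]
      rcases eq_or_ne i v with rfl | hi'
      · rw [kos_right _ hj.ne', subOne_x, map_mul (keep _) _ (σ n j), hj0, mul_zero]
      · rw [kos_of_ne _ hi hi', mul_zero, map_zero]
  have h1 : (Pi.single j (σ n v * ((m : R n) ^ 2 * (-1))) : Fin n → R n) ∈ tail m v := by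
    refine mem_tail_single hj ⟨⟨tv_geom_sq_mem_powMat hj.ne', Good.tv_geom_sq_of_gt hj _,
      _, x_pow_mem_detGroup j, det_tv_geom_sq hj.ne'⟩, ?_⟩ (key 1 (-1) (by simp))
    rw [← det_tv_geom_sq hj.ne', Units.val_pow_eq_pow_val, hx]
  have h2 : (Pi.single j (σ n v * ((m : R n) ^ 2 * 1)) : Fin n → R n) ∈ tail m v := by
    refine mem_tail_single hj ⟨⟨tv_inv_geom_sq_mem_powMat hj.ne', Good.tv_geom_sq_of_gt hj _,
      _, inv_mem (x_pow_mem_detGroup j), det_tv_inv_geom_sq hj.ne'⟩, ?_⟩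
      (key _ 1 (by rw [map_neg, hxi]))
    rw [← det_tv_inv_geom_sq hj.ne', hxi]
  obtain ⟨k, rfl | rfl⟩ := c.eq_nat_or_neg
  · convert! nsmul_mem h2 k using 1
    rw [← Pi.single_smul, nsmul_eq_mul]
    congr 1; push_cast; ring
  · convert! nsmul_mem h1 k using 1
    rw [← Pi.single_smul, nsmul_eq_mul]
    congr 1; push_cast; ring

theorem single_sum_mem_tail {j : Fin n} (S : Finset (Fin n)) {f : Fin n → R n}
    (h : ∀ i ∈ S, (Pi.single j (f i) : Fin n → R n) ∈ tail m v) :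
    (Pi.single j (∑ i ∈ S, f i) : Fin n → R n) ∈ tail m v := by
  have : (Pi.single j (∑ i ∈ S, f i) : Fin n → R n) = ∑ i ∈ S, Pi.single j (f i) :=
    map_sum (AddMonoidHom.single (fun _ : Fin n => R n) j) _ _
  rw [this]
  exact sum_mem h

theorem single_σ_mul_mem_tail {j : Fin n} (hj : v < j) {h : R n} (hh : h ∈ L n m)
    (hh' : keep (low n (v + 1)) h = h) : (Pi.single j (σ n v * h) : Fin n → R n) ∈ tail m v := by
  have hmσ : ∀ k a, keep (low n (v + 1)) a = a →
      (Pi.single j (σ n v * keep (low n (v + 1)) (m * σ n k * a)) : Fin n → R n) ∈ tail m v := by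
    intro k a ha
    rw [map_mul, map_mul, map_natCast, ha]
    rcases lt_trichotomy k v with hk | rfl | hk
    · rw [keep_σ_of_mem (mem_low_of_le hk.le)]
      exact single_natCast_mul_σ_mem_tail hk hj ha
    · rw [keep_σ_of_mem (mem_low_self k)]
      have := single_pairCol_mem_tail (m := m) hj ha (map_zero _)
      rwa [mul_zero, add_zero] at this
    · rw [keep_σ_of_notMem (notMem_low_of_lt hk)]
      simp
  obtain ⟨z, a, b, rfl⟩ := mem_L_iff.1 hh
  rw [← hh']
  simp only [map_add, map_sum, mul_add, Pi.single_add, Finset.mul_sum]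
  refine add_mem (add_mem ?_ ?_) ?_
  -- Only integer multiples of `m²` are directly available. The rest of `z` is a combination of the
  -- `σ_i`, and `m² σ_i` is treated as a multiple of `m σ_i`.
  · obtain ⟨u, hu⟩ := exists_sub_keep_eq ∅ z
    obtain ⟨c, hc⟩ := exists_keep_empty_eq z
    have h1 : (m : R n) ^ 2 * z = (m : R n) ^ 2 * c + ∑ i, m * σ n i * (m * u i) := by
      rw [sub_eq_iff_eq_add.1 hu, hc, Finset.compl_empty, mul_add, Finset.mul_sum, add_comm]
      congr 1
      exact Finset.sum_congr rfl fun i _ => by ring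
    rw [h1, map_add, mul_add, Pi.single_add, map_sum, Finset.mul_sum]
    refine add_mem ?_ (single_sum_mem_tail _ fun i _ => ?_)
    · have := single_sq_mem_tail (m := m) hj c
      simpa using this
    · have := hmσ i _ (keep_idem _ ((m : R n) * u i))
      rwa [map_mul, keep_idem, ← map_mul] at this
  · refine single_sum_mem_tail _ fun i _ => ?_
    have := hmσ i _ (keep_idem _ (a i))
    rwa [map_mul, keep_idem, ← map_mul] at this
  · refine single_sum_mem_tail _ fun r _ => ?_
    rw [map_mul]
    rcases lt_trichotomy r v with hk | rfl | hk
    · rw [keep_τ_of_mem (mem_low_of_le hk.le)]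
      exact single_τ_mem_tail hk hj (keep_idem _ _)
    · rw [keep_τ_of_mem (mem_low_self r)]
      have := single_pairCol_mem_tail (m := m) hj (map_zero _) (keep_idem (low n (r + 1)) (b r))
      rwa [mul_zero, zero_add] at this
    · rw [keep_τ_of_notMem (notMem_low_of_lt hk)]
      simp

theorem mem_tail {κ : Fin n → R n} (h0 : ∀ j ≤ v, κ j = 0)
    (h : ∀ j, v < j → ∃ a ∈ L n m, keep (low n (v + 1)) a = a ∧ κ j = σ n v * a) :
    κ ∈ tail m v := by
  rw [← Finset.univ_sum_single κ]
  refine sum_mem fun j _ => ?_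
  rcases le_or_gt j v with hj | hj
  · rw [h0 j hj, Pi.single_zero]; exact zero_mem _
  · obtain ⟨a, ha, ha', hκ⟩ := h j hj
    rw [hκ]
    exact single_σ_mul_mem_tail hj ha ha'

end Tail

/-! ### Making row `v` and the determinant trivial after retraction -/

section RowReduction

open Matrix

variable {n m : ℕ} {v : Fin n}

/-- The `v`-th row of `X`, after setting the variables beyond `v` to one, is `e_v + σ_v c`. -/
def IsRow (v : Fin n) (X : Matrix (Fin n) (Fin n) (R n)) (c : Fin n → R n) : Prop :=
  ∀ j, keep (low n (v + 1)) (X v j) = (Pi.single v 1 : Fin n → R n) j + σ n v * c j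

theorem low_succ (v : Fin n) : low n (v + 1) = insert v (low n v) := by
  ext i
  rw [Finset.mem_insert, mem_low, mem_low, Fin.ext_iff]
  omega

theorem self_notMem_low (v : Fin n) : v ∉ low n v := fun h => lt_irrefl _ (mem_low.1 h)

theorem keep_one_apply (S : Finset (Fin n)) (i j : Fin n) :
    keep S ((1 : Matrix (Fin n) (Fin n) (R n)) i j) = (1 : Matrix (Fin n) (Fin n) (R n)) i j := by
  rw [one_apply]; split_ifs <;> simp

theorem IsRow.decomp {X : Matrix (Fin n) (Fin n) (R n)} {c : Fin n → R n} (hX : Good m v X)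
    (hc : IsRow v X c) (j : Fin n) : ∃ f h, keep (low n (v + 1)) f = f ∧ (v < j → f = 0) ∧
      h ∈ L n m ∧ keep (low n (v + 1)) h = h ∧ c j = h + σ n v * geom (x n) m j * f := by
  obtain ⟨f, h, hf, hf0, hh, hh', he⟩ := hX.row j
  refine ⟨f, h, hf, hf0, hh, hh', mul_left_cancel₀ (σ_ne_zero v) ?_⟩
  rw [← he, Matrix.sub_apply, map_sub, hc j, keep_one_apply, one_apply, Pi.single_apply]
  simp only [eq_comm, add_sub_cancel_left]

theorem exists_isRow {X : Matrix (Fin n) (Fin n) (R n)} (hX : Good m v X) :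
    ∃ c, IsRow v X c := by
  have h : ∀ j, ∃ c, keep (low n (v + 1)) ((X - 1) v j) = σ n v * c := fun j => by
    obtain ⟨f, h, -, -, -, -, he⟩ := hX.row j
    exact ⟨_, he⟩
  choose c hc using h
  refine ⟨c, fun j => ?_⟩
  rw [← hc, Matrix.sub_apply, map_sub, keep_one_apply, one_apply, Pi.single_apply]
  simp only [eq_comm, add_sub_cancel]

theorem IsRow.keep_eq {X : Matrix (Fin n) (Fin n) (R n)} {c : Fin n → R n} (hX : Good m v X)
    (hc : IsRow v X c) (j : Fin n) : keep (low n (v + 1)) (c j) = c j := by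
  obtain ⟨f, h, hf, hf0, hh, hh', he⟩ := hc.decomp hX j
  rcases le_or_gt j v with hj | hj
  · rw [he, map_add, map_mul, map_mul, hf, hh', keep_σ_of_mem (mem_low_self v),
      keep_geom_of_mem (mem_low_of_le hj)]
  · rw [he, hf0 hj, mul_zero, add_zero, hh']

theorem IsRow.dotProduct_eq {X : Matrix (Fin n) (Fin n) (R n)} {c : Fin n → R n}
    (hs : X *ᵥ σ n = σ n) (hc : IsRow v X c) : c ⬝ᵥ (keep (low n (v + 1)) ∘ σ n) = 0 := by
  have h1 := congrArg (keep (low n (v + 1))) (congrFun hs v)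
  rw [mulVec, dotProduct, map_sum] at h1
  simp only [map_mul, hc _, add_mul] at h1
  rw [Finset.sum_add_distrib, Finset.sum_eq_single v
    (fun j _ hj => by rw [Pi.single_eq_of_ne hj, zero_mul]) (by simp), Pi.single_eq_same,
    one_mul, add_eq_left] at h1
  simp only [mul_assoc] at h1
  rw [← Finset.mul_sum] at h1
  exact (mul_eq_zero.1 h1).resolve_left (σ_ne_zero v)

theorem IsRow.sum_eq {X : Matrix (Fin n) (Fin n) (R n)} {c : Fin n → R n}
    (hs : X *ᵥ σ n = σ n) (hc : IsRow v X c) :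
    c v * σ n v + ∑ k ∈ low n v, c k * σ n k = 0 := by
  rw [← Finset.sum_insert (f := fun k => c k * σ n k) (self_notMem_low v), ← low_succ,
    ← hc.dotProduct_eq hs, dotProduct,
    ← Finset.sum_subset (Finset.subset_univ (low n (v + 1)))]
  · exact Finset.sum_congr rfl fun j hj => by rw [Function.comp_apply, keep_σ_of_mem hj]
  · intro j _ hj
    rw [Function.comp_apply, keep_σ_of_notMem hj, mul_zero]

theorem IsRow.mul_tv {X P : Matrix (Fin n) (Fin n) (R n)} {c c' y w : Fin n → R n}
    (hc : IsRow v X c) (hP : P.map (keep (low n (v + 1))) = tv y w)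
    (h : ∀ j, (y v + σ n v * (c ⬝ᵥ y)) * w j = σ n v * (c' j - c j)) : IsRow v (X * P) c' := by
  intro j
  have h1 : keep (low n (v + 1)) ((X * P) v j) =
      ((Pi.single v 1 + σ n v • c) ᵥ* P.map (keep (low n (v + 1)))) j := by
    rw [mul_apply, map_sum, vecMul, dotProduct]
    refine Finset.sum_congr rfl fun k _ => ?_
    rw [map_mul, hc k, map_apply, Pi.add_apply, Pi.smul_apply, smul_eq_mul]
  rw [h1, hP, vecMul_tv, add_dotProduct, smul_dotProduct, single_one_dotProduct, Pi.add_apply,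
    Pi.add_apply, Pi.smul_apply, Pi.smul_apply, smul_eq_mul, smul_eq_mul, smul_eq_mul, h j]
  ring

theorem mulVec_of_mem_adm {P : Matrix (Fin n) (Fin n) (R n)} (hP : P ∈ adm m v) :
    P *ᵥ σ n = σ n := by
  obtain ⟨U, hU, rfl⟩ := mem_stabMat.1 (powMat_le_stabMat hP.1)
  exact hU

theorem mul_mulVec_σ {X P : Matrix (Fin n) (Fin n) (R n)} (hX : X *ᵥ σ n = σ n)
    (hP : P ∈ adm m v) : (X * P) *ᵥ σ n = σ n := by
  rw [← mulVec_mulVec, mulVec_of_mem_adm hP, hX]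

/-- The elements of `∑ k < v, σ_k H + ∑ k ∈ T, τ_k R` involving only the variables up to `v`. -/
def IsPartial (m : ℕ) (v : Fin n) (T : Finset (Fin n)) (y : R n) : Prop :=
  ∃ h b : Fin n → R n, (∀ k, h k ∈ H n m) ∧ (∀ k, keep (low n (v + 1)) (h k) = h k) ∧
    (∀ k, keep (low n (v + 1)) (b k) = b k) ∧
    y = ∑ k ∈ low n v, σ n k * h k + ∑ k ∈ T, τ n m k * b k

theorem isPartial_zero (T : Finset (Fin n)) : IsPartial m v T 0 :=
  ⟨0, 0, fun _ => Ideal.zero_mem _, fun _ => map_zero _, fun _ => map_zero _, by simp⟩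

theorem IsPartial.add {T : Finset (Fin n)} {y z : R n} (hy : IsPartial m v T y)
    (hz : IsPartial m v T z) : IsPartial m v T (y + z) := by
  obtain ⟨h, b, hh, hh', hb, rfl⟩ := hy
  obtain ⟨h', b', hk, hk', hb', rfl⟩ := hz
  refine ⟨h + h', b + b', fun k => Ideal.add_mem _ (hh k) (hk k),
    fun k => by rw [Pi.add_apply, map_add, hh', hk'],
    fun k => by rw [Pi.add_apply, map_add, hb, hb'], ?_⟩
  simp only [Pi.add_apply, mul_add, Finset.sum_add_distrib]
  ring

theorem IsPartial.mul {T : Finset (Fin n)} {y z : R n} (hy : IsPartial m v T y)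
    (hz : keep (low n (v + 1)) z = z) : IsPartial m v T (z * y) := by
  obtain ⟨h, b, hh, hh', hb, rfl⟩ := hy
  refine ⟨z • h, z • b, fun k => Ideal.mul_mem_left _ _ (hh k),
    fun k => by rw [Pi.smul_apply, smul_eq_mul, map_mul, hh', hz],
    fun k => by rw [Pi.smul_apply, smul_eq_mul, map_mul, hb, hz], ?_⟩
  simp only [Pi.smul_apply, smul_eq_mul, mul_add, Finset.mul_sum]
  congr 1 <;> exact Finset.sum_congr rfl fun i _ => by ring

theorem keep_keep_singleton (v : Fin n) (f : R n) :
    keep (low n (v + 1)) (keep {v} f) = keep {v} f := by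
  rw [keep_keep, Finset.inter_eq_right.2 (Finset.singleton_subset_iff.2 (mem_low_self v))]

/-- The terms in `x_v` alone cancel. A generator `m σ_k` or `τ_k` with `k < v` survives as it
stands. A difference of coefficients contributes `σ_k` with `k < v` times an element of `L`, hence
of `H`. -/
theorem isPartial_keep_sub_keep {f : R n} (hf : f ∈ L n m) :
    IsPartial m v (low n v) (keep (low n (v + 1)) f - keep {v} f) := by
  have hsingle : ∀ (a b : R n) (k : Fin n), a ∈ H n m → keep (low n (v + 1)) a = a →
      keep (low n (v + 1)) b = b → k ∈ low n v →
      IsPartial m v (low n v) (σ n k * a + τ n m k * b) := by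
    intro a b k ha ha' hb hk
    refine ⟨Pi.single k a, Pi.single k b, fun i => ?_, fun i => ?_, fun i => ?_, ?_⟩
    · rcases eq_or_ne i k with rfl | hi
      · rwa [Pi.single_eq_same]
      · rw [Pi.single_eq_of_ne hi]; exact Ideal.zero_mem _
    · rcases eq_or_ne i k with rfl | hi
      · rwa [Pi.single_eq_same]
      · rw [Pi.single_eq_of_ne hi, map_zero]
    · rcases eq_or_ne i k with rfl | hi
      · rwa [Pi.single_eq_same]
      · rw [Pi.single_eq_of_ne hi, map_zero]
    · rw [Finset.sum_eq_single_of_mem k hk, Finset.sum_eq_single_of_mem k hk, Pi.single_eq_same,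
        Pi.single_eq_same]
      · intro i _ hi; rw [Pi.single_eq_of_ne hi, mul_zero]
      · intro i _ hi; rw [Pi.single_eq_of_ne hi, mul_zero]
  have hmem : ∀ k, k < v → k ∈ low n v := fun k hk => mem_low.2 hk
  induction hf using Submodule.span_induction with
  | mem f hf =>
    obtain rfl | ⟨i, rfl⟩ | ⟨r, rfl⟩ := hf
    · simpa using isPartial_zero (low n v)
    · simp only [map_mul, map_natCast]
      rcases lt_trichotomy i v with hi | rfl | hi
      · rw [keep_σ_of_mem (mem_low_of_le hi.le), keep_σ_of_notMem (by simpa using hi.ne), mul_zero,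
          sub_zero]
        have := hsingle m 0 i (Ideal.mem_sup_right (Ideal.mem_span_singleton_self _))
          (map_natCast _ _) (map_zero _) (hmem i hi)
        rwa [mul_zero, add_zero, mul_comm] at this
      · rw [keep_σ_of_mem (mem_low_self i), keep_σ_of_mem (Finset.mem_singleton_self i), sub_self]
        exact isPartial_zero _
      · rw [keep_σ_of_notMem (notMem_low_of_lt hi), keep_σ_of_notMem (by simpa using hi.ne'),
          sub_self]
        exact isPartial_zero _
    · rcases lt_trichotomy r v with hi | rfl | hi
      · rw [keep_τ_of_mem (mem_low_of_le hi.le), keep_τ_of_notMem (by simpa using hi.ne),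
          sub_zero]
        have := hsingle 0 1 r (Ideal.zero_mem _) (map_zero _) (map_one _) (hmem r hi)
        rwa [mul_zero, zero_add, mul_one] at this
      · rw [keep_τ_of_mem (mem_low_self r), keep_τ_of_mem (Finset.mem_singleton_self r), sub_self]
        exact isPartial_zero _
      · rw [keep_τ_of_notMem (notMem_low_of_lt hi), keep_τ_of_notMem (by simpa using hi.ne'),
          sub_self]
        exact isPartial_zero _
  | zero => simpa using isPartial_zero (low n v)
  | add f g _ _ hf hg =>
    convert! hf.add hg using 1
    rw [map_add, map_add]; ring
  | smul a f hf ih =>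
    obtain ⟨u, hu⟩ := exists_sub_keep_eq {v} a
    have hu' := congrArg (keep (low n (v + 1))) hu
    rw [map_sub, keep_keep_singleton, map_sum] at hu'
    have h1 : IsPartial m v (low n v) ((keep (low n (v + 1)) a - keep {v} a) * keep {v} f) := by
      rw [hu', Finset.sum_mul]
      refine Finset.sum_induction _ _ (fun _ _ => IsPartial.add) (isPartial_zero _) fun i hi => ?_
      rcases lt_or_ge v i with hi' | hi'
      · rw [map_mul, keep_σ_of_notMem (notMem_low_of_lt hi'), mul_zero, zero_mul]
        exact isPartial_zero _
      · have hiv : i < v := lt_of_le_of_ne hi' (by simpa using hi)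
        have := hsingle (keep (low n (v + 1)) (u i) * keep {v} f) 0 i
          (Ideal.mul_mem_left _ _ (L_le_H (keep_mem_L _ hf)))
          (by rw [map_mul, keep_idem, keep_keep_singleton]) (map_zero _) (hmem i hiv)
        rw [map_mul, keep_σ_of_mem (mem_low_of_le hi')]
        convert! this using 1
        ring
    convert! h1.add (ih.mul (keep_idem _ a)) using 1
    rw [smul_eq_mul, map_mul, map_mul]; ring

/-- The diagonal entry `c v` lies in `L` as `σ_v μ_v = τ_v`. Setting all variables but `x_v` to one
in `c_v σ_v + ∑ k < v, c_k σ_k = 0` shows that `c v` has no part in `x_v` alone. -/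
theorem IsRow.isPartial {X : Matrix (Fin n) (Fin n) (R n)} {c : Fin n → R n} (hX : Good m v X)
    (hs : X *ᵥ σ n = σ n) (hc : IsRow v X c) : IsPartial m v (low n v) (c v) := by
  have h1 : c v ∈ L n m := by
    obtain ⟨f, h, -, -, hh, -, he⟩ := hc.decomp hX v
    rw [he, σ_mul_geom]
    exact Ideal.add_mem _ hh (τ_mem_L _ _)
  have h2 : keep {v} (c v) = 0 := by
    have := congrArg (keep {v}) (hc.sum_eq hs)
    rw [map_add, map_mul, keep_σ_of_mem (Finset.mem_singleton_self v), map_sum, map_zero,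
      Finset.sum_eq_zero, add_zero] at this
    · exact (mul_eq_zero.1 this).resolve_right (σ_ne_zero v)
    · intro k hk
      rw [map_mul, keep_σ_of_notMem, mul_zero]
      rw [Finset.mem_singleton]
      rintro rfl
      exact self_notMem_low k hk
  have h3 := isPartial_keep_sub_keep (v := v) h1
  rwa [hc.keep_eq hX, h2, sub_zero] at h3

/-- One `τ_j` is removed at a time with the column `σ_v e_v + σ_j e_j`. This changes `c_v` by `-(1 +
c_v σ_v + c_j σ_j) τ_j b_j`. By the relation among the `c_k σ_k`, the unwanted part is `∑ σ_k c_k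
τ_j b_j` over the other `k < v`, and it is absorbed in `∑ σ_k H`. -/
theorem exists_admOne_isPartial_empty (T : Finset (Fin n)) (hT : T ⊆ low n v)
    {X : Matrix (Fin n) (Fin n) (R n)} {c : Fin n → R n} (hX : Good m v X) (hs : X *ᵥ σ n = σ n)
    (hc : IsRow v X c) (hcT : IsPartial m v T (c v)) :
    ∃ P ∈ admOne m v, ∃ c', IsRow v (X * P) c' ∧ IsPartial m v ∅ (c' v) := by
  induction T using Finset.induction_on generalizing X c with
  | empty => exact ⟨1, one_mem _, c, by rwa [mul_one], hcT⟩
  | insert j T hj ih =>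
    obtain ⟨h, b, hh, hh', hb, he⟩ := hcT
    have hjl : j ∈ low n v := hT (Finset.mem_insert_self _ _)
    have hjv : j < v := mem_low.1 hjl
    have hρv := keep_σ_of_mem (mem_low_self v)
    have hρj : keep (low n (v + 1)) (σ n j) = σ n j := keep_σ_of_mem (mem_low_of_le hjv.le)
    have hb' : keep (low n (v + 1)) (-b j) = -b j := by rw [map_neg, hb]
    have hP := tv_pairCol_mem_admOne_of_lt (m := m) hjv hb'
    set w : Fin n → R n := (geom (x n) m j * -b j) • kos (x n) j v with hw
    have hwv : w v = -(τ n m j * b j) := by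
      rw [hw, Pi.smul_apply, kos_right _ hjv.ne, subOne_x, smul_eq_mul, ← σ_mul_geom]; ring
    have hdot : c ⬝ᵥ pairCol (x n) v j = c v * σ n v + c j * σ n j := by
      simp [pairCol, subOne_x, dotProduct_add, mul_comm]
    have hmap : (tv (pairCol (x n) v j) w).map (keep (low n (v + 1))) =
        tv (pairCol (x n) v j) w := by
      rw [map_tv]
      congr 1
      · ext1 i
        rw [Function.comp_apply]
        rcases eq_or_ne i v with rfl | hi
        · rw [pairCol_left hjv.ne, hρv]
        · rcases eq_or_ne i j with rfl | hi'
          · rw [pairCol_right hjv.ne, hρj]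
          · rw [pairCol_of_ne hi hi', map_zero]
      · ext1 i
        rw [Function.comp_apply, hw, Pi.smul_apply, smul_eq_mul, map_mul, map_mul, hb',
          keep_geom_of_mem (mem_low_of_le hjv.le)]
        congr 1
        rcases eq_or_ne i v with rfl | hi
        · rw [kos_right _ hjv.ne, subOne_x, hρj]
        · rcases eq_or_ne i j with rfl | hi'
          · rw [kos_left _ hjv.ne, subOne_x, map_neg, hρv]
          · rw [kos_of_ne _ hi' hi, map_zero]
    have hrow := hc.mul_tv (c' := c + (1 + (c v * σ n v + c j * σ n j)) • w) hmap fun k => by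
      rw [pairCol_left hjv.ne, hdot, Pi.add_apply, Pi.smul_apply, smul_eq_mul]; ring
    have hpart : IsPartial m v T ((c + (1 + (c v * σ n v + c j * σ n j)) • w) v) := by
      have hsum := hc.sum_eq hs
      rw [← Finset.add_sum_erase _ _ hjl] at hsum
      have hp1 : IsPartial m v T (∑ k ∈ low n v, σ n k * h k + ∑ k ∈ T, τ n m k * b k) :=
        ⟨h, b, hh, hh', hb, rfl⟩
      have hp2 : IsPartial m v T
          (∑ k ∈ low n v, σ n k * (if k = j then 0 else c k * (τ n m j * b j))) := by
        refine ⟨fun k => if k = j then 0 else c k * (τ n m j * b j), 0, fun k => ?_, fun k => ?_,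
          fun _ => map_zero _, by simp⟩
        · dsimp only
          split_ifs
          · exact Ideal.zero_mem _
          · exact Ideal.mul_mem_left _ _ (L_le_H (τ_mem_L _ _))
        · dsimp only
          split_ifs
          · exact map_zero _
          · rw [map_mul, map_mul, hc.keep_eq hX, hb, keep_τ_of_mem (mem_low_of_le hjv.le)]
      convert! hp1.add hp2 using 1
      rw [Pi.add_apply, Pi.smul_apply, smul_eq_mul, hwv,
        ← Finset.add_sum_erase _ (fun k => σ n k * if k = j then 0 else c k * (τ n m j * b j))
          hjl, if_pos rfl]
      have h2 : ∑ k ∈ (low n v).erase j, σ n k * (if k = j then 0 else c k * (τ n m j * b j)) =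
          (∑ k ∈ (low n v).erase j, c k * σ n k) * (τ n m j * b j) := by
        rw [Finset.sum_mul]
        refine Finset.sum_congr rfl fun k hk => ?_
        rw [if_neg (Finset.ne_of_mem_erase hk)]; ring
      rw [Finset.sum_insert hj] at he
      rw [h2]
      linear_combination he + (-τ n m j * b j) * hsum
    obtain ⟨Q, hQ, c', hc', hp⟩ := ih ((Finset.subset_insert _ _).trans hT) (hX.mul hP.1.2.1)
      (mul_mulVec_σ hs hP.1) hrow hpart
    exact ⟨_ * Q, mul_mem hP hQ, c', by rwa [← mul_assoc], hp⟩

/-- The column `σ` is orthogonal to `c` after retraction, so multiplication by `1 + σ w` changes `c`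
by exactly the retraction of `w`. Entry `v` of `∑ -h_k • kos k v` is the required `-∑ σ_k h_k`. -/
theorem exists_admOne_apply_self_eq_zero {X : Matrix (Fin n) (Fin n) (R n)} {c : Fin n → R n}
    (hs : X *ᵥ σ n = σ n) (hc : IsRow v X c)
    (hp : IsPartial m v ∅ (c v)) : ∃ P ∈ admOne m v, ∃ c', IsRow v (X * P) c' ∧ c' v = 0 := by
  obtain ⟨h, b, hh, hh', -, he⟩ := hp
  rw [Finset.sum_empty, add_zero] at he
  refine ⟨_, tv_σ_sum_mem_admOne (low n v) (fun k hk => mem_low.1 hk) (h := fun k => -h k)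
    (fun k => Submodule.neg_mem _ (hh k)) (fun k => by rw [map_neg, hh']), _,
    hc.mul_tv (map_tv _ _ _) (c' := c + keep (low n (v + 1)) ∘
      (∑ k ∈ low n v, -h k • kos (x n) k v)) fun j => ?_, ?_⟩
  · rw [hc.dotProduct_eq hs, Function.comp_apply, keep_σ_of_mem (mem_low_self v), Pi.add_apply]
    ring
  · rw [Pi.add_apply, Function.comp_apply, he, Finset.sum_apply, map_sum, ← Finset.sum_add_distrib]
    refine Finset.sum_eq_zero fun k hk => ?_
    have hk' : k < v := mem_low.1 hk
    rw [Pi.smul_apply, kos_right _ hk'.ne, subOne_x, smul_eq_mul, map_mul, map_neg, hh',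
      keep_σ_of_mem (mem_low_of_le hk'.le)]
    ring

/-- Once `c v = 0`, the entries before `v` form a syzygy by themselves, and the criterion for rows
applies to `-σ_v` times it. The exceptional parts `σ_v² μ_j f` are the reason why that criterion
tolerates multiples of `σ_v μ_j`. -/
theorem exists_admOne_eq_zero_of_lt (hn : 4 ≤ n) (hm : m ≠ 0) {X : Matrix (Fin n) (Fin n) (R n)}
    {c : Fin n → R n} (hX : Good m v X) (hs : X *ᵥ σ n = σ n) (hc : IsRow v X c)
    (hv : c v = 0) : ∃ P ∈ admOne m v, ∃ c', IsRow v (X * P) c' ∧ ∀ j ≤ v, c' j = 0 := by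
  let c0 : Fin n → R n := fun j => if j < v then c j else 0
  have hc0 : ∀ j, v ≤ j → c0 j = 0 := fun j hj => if_neg hj.not_gt
  have hc0' : ∀ j, j < v → c0 j = c j := fun j hj => if_pos hj
  have hc0v : c0 v = 0 := hc0 v le_rfl
  have hdot : c0 ⬝ᵥ σ n = 0 := by
    have h1 := hc.sum_eq hs
    rw [hv, zero_mul, zero_add] at h1
    rw [← h1, dotProduct, ← Finset.sum_subset (Finset.subset_univ (low n v))]
    · exact Finset.sum_congr rfl fun j hj => by rw [hc0' j (mem_low.1 hj)]
    · intro j _ hj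
      rw [hc0 j (not_lt.1 fun h => hj (mem_low.2 h)), zero_mul]
  let w : Fin n → R n := fun j => σ n v * -c0 j
  have hwv : w v = 0 := by simp only [w, hc0v, neg_zero, mul_zero]
  have hdec : ∀ j, ∃ f h, keep (low n (v + 1)) f = f ∧ (v < j → f = 0) ∧
      h ∈ L n m ∧ keep (low n (v + 1)) h = h ∧ w j = σ n v * (h + σ n v * geom (x n) m j * f) := by
    intro j
    rcases lt_or_ge j v with hj | hj
    · obtain ⟨f, h, hf, hf0, hh, hh', he⟩ := hc.decomp hX j
      refine ⟨-f, -h, by rw [map_neg, hf], fun h' => by rw [hf0 h', neg_zero],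
        Submodule.neg_mem _ hh, by rw [map_neg, hh'], ?_⟩
      simp only [w, hc0' j hj, he]
      ring
    · exact ⟨0, 0, map_zero _, fun _ => rfl, Ideal.zero_mem _, map_zero _, by simp [w, hc0 j hj]⟩
  have hρw : keep (low n (v + 1)) ∘ w = w := by
    ext1 j
    simp only [Function.comp_apply, w, map_mul, map_neg, keep_σ_of_mem (mem_low_self v)]
    rcases lt_or_ge j v with hj | hj
    · rw [hc0' j hj, hc.keep_eq hX]
    · rw [hc0 j hj, map_zero]
  have hmem : w ∈ rowGroup (x n) m v := by
    refine mem_rowGroup_of_mem_H hn hm hwv ?_ fun j => ?_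
    · have : w = (-σ n v) • c0 := by ext1 j; simp [w]
      rw [this, smul_dotProduct, hdot, smul_zero]
    · obtain ⟨f, h, hf, hf0, hh, hh', he⟩ := hdec j
      refine ⟨σ n v * f, ?_⟩
      rw [he]
      convert! Ideal.mul_mem_left _ (σ n v) (L_le_H hh) using 1
      ring
  refine ⟨tv (Pi.single v 1) w, mem_admOne_of_det_eq_one hmem.2.2 (Good.tv_single (fun j => ?_)
    fun j => ?_) ?_, c - c0, hc.mul_tv (by rw [map_keep_tv_single, hρw]) fun j => ?_,
    fun j hj => ?_⟩
  · obtain ⟨f, h, hf, hf0, hh, hh', he⟩ := hdec j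
    refine ⟨f, hf, fun h' => hf0 (h'.resolve_left (lt_irrefl _)), ?_⟩
    have := σ_mul_keep_mem_N (k := v + 1) v hh
    rw [hh'] at this
    rw [he]
    convert! this using 1
    ring
  · obtain ⟨f, h, hf, hf0, hh, hh', he⟩ := hdec j
    exact ⟨f, h, hf, hf0, hh, hh', by rw [← he]; exact congrFun hρw j⟩
  · rw [det_tv, dotProduct_single_one, hwv, add_zero]
  · rw [dotProduct_single_one, hv, Pi.single_eq_same, Pi.sub_apply]
    simp only [w]
    ring
  · rw [Pi.sub_apply]
    rcases hj.lt_or_eq with hj | rfl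
    · rw [hc0' j hj, sub_self]
    · rw [hv, hc0v, sub_zero]

theorem exists_admOne_row_eq (hn : 4 ≤ n) (hm : m ≠ 0) {X : Matrix (Fin n) (Fin n) (R n)}
    (hX : Good m v X) (hs : X *ᵥ σ n = σ n) :
    ∃ P ∈ admOne m v, ∀ j,
      keep (low n (v + 1)) ((X * P) v j) = (Pi.single v 1 : Fin n → R n) j := by
  obtain ⟨c, hc⟩ := exists_isRow hX
  obtain ⟨P, hP, c, hc, hp⟩ := exists_admOne_isPartial_empty _ subset_rfl hX hs hc
    (hc.isPartial hX hs)
  replace hX := hX.mul hP.1.2.1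
  replace hs := mul_mulVec_σ hs hP.1
  obtain ⟨Q, hQ, c, hc, hv⟩ := exists_admOne_apply_self_eq_zero hs hc hp
  replace hX := hX.mul hQ.1.2.1
  replace hs := mul_mulVec_σ hs hQ.1
  obtain ⟨S, hS, c, hc, hlow⟩ := exists_admOne_eq_zero_of_lt hn hm hX hs hc hv
  replace hX := hX.mul hS.1.2.1
  -- Beyond the diagonal there is no exceptional term, so these entries lie in `σ_v L` and the
  -- remaining row belongs to `tail`.
  have hκ : (fun j => σ n v * -c j) ∈ tail m v := by
    refine mem_tail (fun j hj => by rw [hlow j hj, neg_zero, mul_zero]) fun j hj => ?_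
    obtain ⟨f, h, hf, hf0, hh, hh', he⟩ := hc.decomp hX j
    refine ⟨-h, Submodule.neg_mem _ hh, by rw [map_neg, hh'], ?_⟩
    rw [he, hf0 hj, mul_zero, add_zero]
  obtain ⟨-, Z, hZ, hZ'⟩ := hκ
  have h0 := hc.mul_tv (c' := 0) hZ' fun j => by
    rw [dotProduct_single_one, hlow v le_rfl, Pi.single_eq_same, Pi.zero_apply]; ring
  refine ⟨P * (Q * (S * Z)), mul_mem hP (mul_mem hQ (mul_mem hS hZ)), fun j => ?_⟩
  have h1 := h0 j
  rw [Pi.zero_apply, mul_zero, add_zero] at h1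
  rw [← h1]
  simp only [mul_assoc]

theorem exists_keep_eq_of_mem_detGroup {u : (R n)ˣ} (hu : u ∈ detGroup n m) : ∃ q : ℤ,
    keep (low n (v + 1)) (u : R n) = keep (low n v) (u : R n) * ((x n v ^ m ^ 2) ^ q : (R n)ˣ) := by
  suffices h : ∃ q : ℤ, Units.map (keep (low n (v + 1))).toMonoidHom u =
      Units.map (keep (low n v)).toMonoidHom u * (x n v ^ m ^ 2) ^ q by
    obtain ⟨q, hq⟩ := h
    exact ⟨q, congrArg Units.val hq⟩
  induction hu using Subgroup.closure_induction with
  | mem u hu =>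
    obtain ⟨i, rfl⟩ := hu
    have hx : ∀ (S : Finset (Fin n)), (i ∈ S → Units.map (keep S).toMonoidHom (x n i) = x n i) ∧
        (i ∉ S → Units.map (keep S).toMonoidHom (x n i) = 1) := fun S =>
      ⟨fun h => Units.ext (keep_x_of_mem h), fun h => Units.ext (keep_x_of_notMem h)⟩
    dsimp only
    rw [map_pow, map_pow]
    rcases lt_trichotomy i v with hi | rfl | hi
    · refine ⟨0, ?_⟩
      rw [(hx _).1 (mem_low_of_le hi.le), (hx _).1 (mem_low.2 hi), _root_.zpow_zero, mul_one]
    · refine ⟨1, ?_⟩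
      rw [(hx _).1 (mem_low_self i), (hx _).2 (self_notMem_low i), one_pow, one_mul,
        _root_.zpow_one]
    · refine ⟨0, ?_⟩
      rw [(hx _).2 (notMem_low_of_lt hi), (hx _).2 (fun h => hi.not_gt (mem_low.1 h)),
        _root_.zpow_zero, mul_one]
  | one => exact ⟨0, by simp⟩
  | mul u w _ _ hu hw =>
    obtain ⟨q, hq⟩ := hu
    obtain ⟨q', hq'⟩ := hw
    refine ⟨q + q', ?_⟩
    rw [map_mul, map_mul, hq, hq', _root_.zpow_add, mul_mul_mul_comm]
  | inv u _ hu =>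
    obtain ⟨q, hq⟩ := hu
    refine ⟨-q, ?_⟩
    rw [map_inv, map_inv, hq, _root_.zpow_neg, mul_inv]

/-- The row reduction does not change the retracted determinant. As the determinant is a monomial in
the `x_i ^ m²` and became `1` at the previous retraction, it is now a power of `x_v ^ m²`, which a
matrix with trivial row `v` can cancel. -/
theorem exists_adm_row_eq_det_eq_one (hn : 4 ≤ n) (hm : m ≠ 0)
    {X : Matrix (Fin n) (Fin n) (R n)} (hX : Good m v X) (hs : X *ᵥ σ n = σ n)
    (hd : ∃ u ∈ detGroup n m, (u : R n) = X.det) (h1 : keep (low n v) X.det = 1) :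
    ∃ P ∈ adm m v,
      (∀ j, keep (low n (v + 1)) ((X * P) v j) = (1 : Matrix (Fin n) (Fin n) (R n)) v j) ∧
      keep (low n (v + 1)) (X * P).det = 1 := by
  obtain ⟨P, hP, hrow⟩ := exists_admOne_row_eq hn hm hX hs
  obtain ⟨u, hu, hud⟩ := hd
  obtain ⟨q, hq⟩ := exists_keep_eq_of_mem_detGroup (v := v) hu
  rw [hud, h1, one_mul] at hq
  obtain ⟨Q, hQ, hQd, hQr⟩ := exists_mem_adm_det_eq (m := m) (v := v) hn (-q)
  refine ⟨P * Q, mul_mem hP.1 hQ, fun j => ?_, ?_⟩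
  · rw [← mul_assoc, mul_apply, map_sum]
    simp only [map_mul, hrow]
    rw [Finset.sum_eq_single v (fun k _ hk => by rw [Pi.single_eq_of_ne hk, zero_mul]) (by simp),
      Pi.single_eq_same, one_mul, hQr, keep_one_apply]
  · rw [det_mul, det_mul, map_mul, map_mul, hP.2, hq, one_mul, ← hQd]
    have hx : keep (low n (v + 1)) (((x n v ^ m ^ 2) ^ (-q) : (R n)ˣ) : R n) =
        (((x n v ^ m ^ 2) ^ (-q) : (R n)ˣ) : R n) := by
      have : Units.map (keep (low n (v + 1))).toMonoidHom (x n v) = x n v :=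
        Units.ext (keep_x_of_mem (mem_low_self v))
      change ((Units.map (keep (low n (v + 1))).toMonoidHom ((x n v ^ m ^ 2) ^ (-q)) : (R n)ˣ) : R n) = _
      rw [map_zpow, map_pow, this]
    rw [hx, ← Units.val_mul, ← _root_.zpow_add, add_neg_cancel, _root_.zpow_zero, Units.val_one]

end RowReduction

/-! ### Determinants and the invariant between the stages -/

section Invariant

open Matrix

variable {n m : ℕ}

/-- A Laurent polynomial dividing one is a monomial. -/
theorem exists_eq_single_of_mul_eq_one {u w : R n} (h : u * w = 1) :
    ∃ (g : Fin n → ℤ) (c : ℤ), u = AddMonoidAlgebra.single g c := by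
  have hu : u.coeff.support.Nonempty := by
    rw [Finsupp.support_nonempty_iff, Ne, AddMonoidAlgebra.coeff_eq_zero]
    rintro rfl
    exact zero_ne_one ((zero_mul w).symm.trans h)
  have hw : w.coeff.support.Nonempty := by
    rw [Finsupp.support_nonempty_iff, Ne, AddMonoidAlgebra.coeff_eq_zero]
    rintro rfl
    exact zero_ne_one ((mul_zero u).symm.trans h)
  -- With more than one pair of exponents, two distinct pairs would have sums attained only once.
  -- Both sums carry nonzero coefficients of `u w = 1`, so both are zero, which contradicts
  -- uniqueness.
  have hcard : u.coeff.support.card = 1 := by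
    by_contra hc
    have hc' : 1 < u.coeff.support.card * w.coeff.support.card := by
      have h1 := Finset.card_pos.2 hu
      have h2 := Finset.card_pos.2 hw
      nlinarith [(by omega : 2 ≤ u.coeff.support.card)]
    obtain ⟨p, hp, q, hq, hpq, hpu, hqu⟩ := TwoUniqueSums.uniqueAdd_of_one_lt_card hc'
    rw [Finset.mem_product] at hp hq
    have key : ∀ p : (Fin n → ℤ) × (Fin n → ℤ), p.1 ∈ u.coeff.support → p.2 ∈ w.coeff.support →
        UniqueAdd u.coeff.support w.coeff.support p.1 p.2 → p.1 + p.2 = 0 := by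
      intro p hp1 hp2 hp
      have h1 := AddMonoidAlgebra.coeff_mul_add_of_uniqueAdd hp
      rw [h] at h1
      by_contra hne
      have h2 : (1 : R n).coeff (p.1 + p.2) = 0 := by
        rw [AddMonoidAlgebra.one_def]
        exact Finsupp.single_eq_of_ne hne
      rw [h2] at h1
      exact mul_ne_zero (Finsupp.mem_support_iff.1 hp1) (Finsupp.mem_support_iff.1 hp2) h1.symm
    have h1 := hpu hq.1 hq.2 ((key q hq.1 hq.2 hqu).trans (key p hp.1 hp.2 hpu).symm)
    exact hpq (Prod.ext h1.1.symm h1.2.symm)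
  obtain ⟨g, hg⟩ := Finset.card_eq_one.1 hcard
  refine ⟨g, u.coeff g, ?_⟩
  ext1
  exact (Finsupp.support_subset_singleton.1 hg.le)

/-- Reducing coefficients and exponents modulo `k` kills `H n k` and keeps distinct monomials of
`(ℤ/k)ⁿ` apart, provided the coefficient ring is not trivial. -/
theorem dvd_of_single_sub_one_mem_H {k : ℕ} {g : Fin n → ℤ}
    (h : (AddMonoidAlgebra.single g 1 : R n) - 1 ∈ H n k) (i : Fin n) : (k : ℤ) ∣ g i := by
  rcases eq_or_ne k 1 with rfl | hk
  · simp
  have : Nontrivial (ZMod k) := ZMod.nontrivial_iff.2 hk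
  let f : R n →+* AddMonoidAlgebra (ZMod k) (Fin n → ZMod k) :=
    (AddMonoidAlgebra.mapRingHom (Fin n → ZMod k) (Int.castRingHom (ZMod k))).comp
      (AddMonoidAlgebra.mapDomainRingHom ℤ
        ((Int.castAddHom (ZMod k)).compLeft (Fin n)))
  have hf : ∀ g c, f (AddMonoidAlgebra.single g c) =
      AddMonoidAlgebra.single (fun i => (g i : ZMod k)) (c : ZMod k) := by
    intro g c
    have h1 : AddMonoidAlgebra.mapDomainRingHom ℤ ((Int.castAddHom (ZMod k)).compLeft (Fin n))
        (AddMonoidAlgebra.single g c) = AddMonoidAlgebra.single (fun i => (g i : ZMod k)) c :=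
      AddMonoidAlgebra.mapDomain_single
    rw [RingHom.comp_apply, h1, AddMonoidAlgebra.mapRingHom_single, Int.coe_castRingHom]
  have hker : H n k ≤ RingHom.ker f := by
    rw [H, sup_le_iff, Ideal.span_le, Ideal.span_le]
    constructor
    · rintro _ ⟨j, rfl⟩
      change f ((AddMonoidAlgebra.single (Pi.single j 1) 1 : R n) ^ k - 1) = 0
      rw [AddMonoidAlgebra.single_pow, map_sub, map_one, hf, sub_eq_zero, AddMonoidAlgebra.one_def]
      congr 1
      · ext l
        simp
      · simp
    · rintro _ rfl
      change f (k : R n) = 0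
      rw [map_natCast, AddMonoidAlgebra.natCast_def, ZMod.natCast_self, AddMonoidAlgebra.single_zero]
  have h1 := hker h
  rw [RingHom.mem_ker, map_sub, map_one, hf, sub_eq_zero, AddMonoidAlgebra.one_def,
    Int.cast_one, AddMonoidAlgebra.single_left_inj one_ne_zero] at h1
  exact (ZMod.intCast_zmod_eq_zero_iff_dvd _ _).1 (congrFun h1 i)

/-- A unit is a monomial. Its coefficient is read off by setting all variables to one, and the
congruence makes its exponents divisible by `m²`. -/
theorem mem_detGroup {u : (R n)ˣ} (h0 : keep ∅ (u : R n) = 1) (h : (u : R n) - 1 ∈ H n (m ^ 2)) :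
    u ∈ detGroup n m := by
  obtain ⟨g, c, hg⟩ := exists_eq_single_of_mul_eq_one u.mul_inv
  have hc : c = 1 := by
    rw [hg, keep_single, AddMonoidAlgebra.one_def] at h0
    have h1 : (fun i => if i ∈ (∅ : Finset (Fin n)) then g i else 0) = 0 := by ext; simp
    rw [h1] at h0
    simpa using congrArg (fun f => f.coeff 0) h0
  subst hc
  rw [hg] at h
  have hdvd := dvd_of_single_sub_one_mem_H h
  choose q hq using hdvd
  have h1 : u = mon n (Multiplicative.ofAdd g) := Units.ext hg
  have h2 : Multiplicative.ofAdd g =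
      ∏ i, (Multiplicative.ofAdd (Pi.single i 1 : Fin n → ℤ) ^ m ^ 2) ^ q i := by
    apply Multiplicative.toAdd.injective
    rw [toAdd_prod, toAdd_ofAdd]
    conv_lhs => rw [← Finset.univ_sum_single g]
    refine Finset.sum_congr rfl fun i _ => ?_
    rw [hq i, toAdd_zpow, toAdd_pow, toAdd_ofAdd]
    ext l
    rcases eq_or_ne l i with rfl | hl
    · simp; ring
    · simp [hl]
  rw [h1, h2, map_prod]
  refine Subgroup.prod_mem _ fun i _ => ?_
  rw [map_zpow, map_pow, mon_single]
  exact Subgroup.zpow_mem _ (x_pow_mem_detGroup i) _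

/-- The invariant of the matrices between the stages of the reduction. -/
structure Inv (m k : ℕ) (X : Matrix (Fin n) (Fin n) (R n)) : Prop where
  entry : ∀ i j : Fin n, ∃ f, keep (low n (i + 1)) f = f ∧ (i.val < k ∨ k ≤ j.val → f = 0) ∧
    (X - 1) i j - σ n i ^ 2 * geom (x n) m j * f ∈ N n m k
  keep_eq : ∀ i j, keep (low n k) ((X - 1) i j) = 0
  stab : X ∈ stabMat (σ n)
  det : ∃ u ∈ detGroup n m, (u : R n) = X.det

theorem H_sq_le_N {k : ℕ} : H n (m ^ 2) ≤ N n m k := by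
  rw [H, sup_le_iff, Ideal.span_le, Ideal.span_le]
  constructor
  · rintro _ ⟨i, rfl⟩
    have := σ_mul_geom_sq_mem_N (m := m) (k := k) i i (1 : R n)
    rwa [mul_one, σ_mul_geom] at this
  · rintro _ rfl
    simpa using sq_mem_N (m := m) (k := k) (1 : R n)

/-- Retaining only `x_i`, the relation reduces to a single term, and `σ_i` is not a zero divisor. -/
theorem keep_empty_eq_zero {c : Fin n → R n} (h : c ⬝ᵥ σ n = 0) (i : Fin n) :
    keep ∅ (c i) = 0 := by
  have h1 := congrArg (keep {i}) h
  rw [dotProduct, map_sum, Finset.sum_eq_single i, map_mul, map_zero,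
    keep_σ_of_mem (Finset.mem_singleton_self i)] at h1
  · have h2 := (mul_eq_zero.1 h1).resolve_right (σ_ne_zero i)
    have h3 := congrArg (keep ∅) h2
    rwa [keep_keep, Finset.empty_inter, map_zero] at h3
  · intro j _ hj
    rw [map_mul, keep_σ_of_notMem (by simpa using hj), mul_zero]
  · simp

theorem map_keep_eq_one {X : Matrix (Fin n) (Fin n) (R n)} {S : Finset (Fin n)}
    (h : ∀ i j, keep S ((X - 1) i j) = 0) : X.map (keep S) = 1 := by
  refine Matrix.ext fun i j => ?_
  have := h i j
  rwa [Matrix.sub_apply, map_sub, keep_one_apply, sub_eq_zero] at this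

theorem inv_zero {X : Matrix (Fin n) (Fin n) (R n)} (hX : X ∈ stabMat (σ n))
    (hH : ∀ i j, (X - 1) i j ∈ H n (m ^ 2)) : Inv m 0 X := by
  have hlow : low n 0 = ∅ := by ext i; simp [low]
  have hkeep : ∀ i j, keep (low n 0) ((X - 1) i j) = 0 := by
    intro i j
    rw [hlow]
    refine keep_empty_eq_zero (c := (X - 1) i) ?_ j
    obtain ⟨U, hU, rfl⟩ := mem_stabMat.1 hX
    change ((U.val - 1) *ᵥ σ n) i = 0
    rw [sub_mulVec, one_mulVec, hU, sub_self, Pi.zero_apply]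
  refine ⟨fun i j => ⟨0, map_zero _, fun _ => rfl, ?_⟩, hkeep, hX, ?_⟩
  · rw [mul_zero, sub_zero]
    exact H_sq_le_N (hH i j)
  · obtain ⟨U, hU, hUX⟩ := mem_stabMat.1 hX
    have hdet : ((Units.map (detMonoidHom (n := Fin n) (R := R n)) U : (R n)ˣ) : R n) = X.det := by
      rw [← hUX]; rfl
    refine ⟨_, mem_detGroup ?_ ?_, hdet⟩
    · rw [hdet, RingHom.map_det, ← hlow]
      change (X.map (keep (low n 0))).det = 1
      rw [map_keep_eq_one hkeep, det_one]
    · rw [hdet, ← Ideal.Quotient.eq, RingHom.map_det, map_one]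
      have : (Ideal.Quotient.mk (H n (m ^ 2))).mapMatrix X = 1 := by
        refine Matrix.ext fun i j => ?_
        rw [RingHom.mapMatrix_apply, map_apply]
        have h1 := Ideal.Quotient.eq.2 (by simpa using hH i j :
          X i j - (1 : Matrix (Fin n) (Fin n) (R n)) i j ∈ H n (m ^ 2))
        rw [h1, one_apply, one_apply]
        split_ifs <;> simp
      rw [this, det_one]

/-- The retraction by `low n v` kills both `X - 1` and the exceptional terms. The retraction by `low
n (v + 1)` therefore sees only a difference of two consecutive retractions of an element of `N`,
which is `σ_v` times an element of `L`, plus an exceptional term that survives only in row `v`. -/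
theorem Inv.good {v : Fin n} {X : Matrix (Fin n) (Fin n) (R n)} (hX : Inv m v X) : Good m v X := by
  have hdiff : ∀ i j f, keep (low n v) (σ n i ^ 2 * geom (x n) m j * f) = 0 →
      (X - 1) i j - σ n i ^ 2 * geom (x n) m j * f ∈ N n m v →
      ∃ h ∈ L n m, keep (low n (v + 1)) h = h ∧ keep (low n (v + 1)) ((X - 1) i j) =
        σ n v * h + keep (low n (v + 1)) (σ n i ^ 2 * geom (x n) m j * f) := by
    intro i j f hf hN
    obtain ⟨h, hh, he⟩ := exists_keep_sub_keep_eq v hN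
    rw [map_sub (keep (low n v)), hX.keep_eq, hf, sub_zero, sub_zero] at he
    refine ⟨keep (low n (v + 1)) h, keep_mem_L _ hh, keep_idem _ _, ?_⟩
    have h1 := congrArg (keep (low n (v + 1))) he
    rw [keep_idem, map_mul, keep_σ_of_mem (mem_low_self v), map_sub] at h1
    rw [← h1, sub_add_cancel]
  have hzero : ∀ i j f, (i.val < v.val ∨ v.val ≤ j.val → f = 0) →
      keep (low n v) (σ n i ^ 2 * geom (x n) m j * f) = 0 := by
    intro i j f hf0
    rcases lt_or_ge i.val v.val with hi | hi
    · rw [hf0 (Or.inl hi), mul_zero, map_zero]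
    · rw [map_mul, map_mul, map_pow, keep_σ_of_notMem fun h => hi.not_gt (mem_low.1 h),
        zero_pow two_ne_zero, zero_mul, zero_mul]
  refine ⟨fun i j => ?_, fun j => ?_, fun i j hi hj => ?_⟩
  · obtain ⟨f, hf, hf0, hN⟩ := hX.entry i j
    refine ⟨f, hf, fun h => hf0 (h.imp (fun h => h) fun h => le_of_lt h), N_mono (Nat.le_succ _) hN⟩
  · obtain ⟨f, hf, hf0, hN⟩ := hX.entry v j
    obtain ⟨h, hh, hh', he⟩ := hdiff v j f (hzero v j f hf0) hN
    refine ⟨f, h, hf, fun h => hf0 (Or.inr (le_of_lt h)), hh, hh', ?_⟩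
    rw [he]
    rcases lt_or_ge j v with hj | hj
    · rw [map_mul, map_mul, map_pow, hf, keep_σ_of_mem (mem_low_self v),
        keep_geom_of_mem (mem_low_of_le hj.le)]
      ring
    · rw [hf0 (Or.inr hj), mul_zero, mul_zero, map_zero]; ring
  · obtain ⟨f, hf, hf0, hN⟩ := hX.entry i j
    obtain ⟨h, hh, hh', he⟩ := hdiff i j f (hzero i j f hf0) hN
    refine ⟨h, hh, hh', ?_⟩
    rw [he]
    rcases lt_or_gt_of_ne hi with hi | hi
    · rw [hf0 (Or.inl hi), mul_zero, map_zero, add_zero]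
    · rw [map_mul, map_mul, map_pow, keep_σ_of_notMem (notMem_low_of_lt hi),
        zero_pow two_ne_zero, zero_mul, zero_mul, add_zero]

end Invariant

/-! ### Splitting off the factors in `ISL` -/

section Factorization

open Matrix

variable {n m : ℕ}

/-- Expansion of the determinant of a matrix whose `v`-th row is that of the identity. -/
theorem det_eq_det_minor {v : Fin n} {A : Type*} [CommRing A] {X : Matrix (Fin n) (Fin n) A}
    (h : ∀ j, X v j = (1 : Matrix (Fin n) (Fin n) A) v j) : X.det = (minor X v).det := by
  rw [twoBlockTriangular_det X (fun j => j ≠ v)]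
  · have h1 : (X.toSquareBlockProp fun i => ¬i ≠ v).det = 1 := by
      have : X.toSquareBlockProp (fun i => ¬i ≠ v) = 1 := by
        refine Matrix.ext fun i j => ?_
        have hi : i.1 = v := not_not.1 i.2
        have hj : j.1 = v := not_not.1 j.2
        have hij : i = j := Subtype.ext (hi.trans hj.symm)
        rw [toSquareBlockProp_def, of_apply, hij, one_apply_eq, hj, h, one_apply_eq]
      rw [this, det_one]
    rw [h1, mul_one]
    rfl
  · intro i hi j hj
    rw [not_not.1 hi, h, one_apply_ne hj.symm]

theorem mem_ISL {v : Fin n} {I : Ideal (R n)} (hI : I ≤ Ideal.span {σ n v})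
    {C : Matrix (Fin n) (Fin n) (R n)} (hs : C *ᵥ σ n = σ n)
    (hrow : ∀ j, C v j = (1 : Matrix (Fin n) (Fin n) (R n)) v j) (hd : C.det = 1)
    (hC : ∀ i j, i ≠ v → j ≠ v → (C - 1) i j ∈ I) : C ∈ ISL n v I := by
  have hm : (minor C v).det = 1 := by rw [← det_eq_det_minor hrow, hd]
  have hmem : ∀ i j : {j : Fin n // j ≠ v}, minor C v i j -
      (1 : Matrix {j : Fin n // j ≠ v} {j : Fin n // j ≠ v} (R n)) i j ∈ I := by
    intro i j
    have h1 := hC i j i.2 j.2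
    rw [Matrix.sub_apply, one_apply] at h1
    rw [one_apply]
    simpa only [minor, submatrix_apply, Subtype.ext_iff] using h1
  have hmk : ∀ (J : Ideal (R n)), I ≤ J → ∀ i j : {j : Fin n // j ≠ v},
      Ideal.Quotient.mk J (minor C v i j) =
      (1 : Matrix {j : Fin n // j ≠ v} {j : Fin n // j ≠ v} (R n ⧸ J)) i j := by
    intro J hJ i j
    rw [Ideal.Quotient.eq.2 (hJ (hmem i j)), one_apply, one_apply]
    split_ifs <;> simp
  let B : SpecialLinearGroup {j : Fin n // j ≠ v} (R n) := ⟨minor C v, hm⟩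
  refine ⟨⟨?_, hrow, SpecialLinearGroup.toGL B, ?_, rfl⟩, B, ?_, rfl⟩
  · have hdet : IsUnit C.det := by rw [hd]; exact isUnit_one
    exact mem_matrices_IA (A := C.nonsingInvUnit hdet) hs
  · refine MonoidHom.mem_ker.2 (Units.ext (Matrix.ext fun i j => ?_))
    rw [GeneralLinearGroup.map_apply]
    exact hmk _ hI i j
  · refine MonoidHom.mem_ker.2 (Subtype.ext (Matrix.ext fun i j => ?_))
    rw [SpecialLinearGroup.map_apply_coe, RingHom.mapMatrix_apply, map_apply]
    exact hmk _ le_rfl i j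

theorem one_mem_ISL (v : Fin n) (J : Ideal (R n)) : (1 : Matrix (Fin n) (Fin n) (R n)) ∈
    ISL n v (Ideal.span {σ n v} * J) := by
  have hI : Ideal.span {σ n v} * J ≤ Ideal.span {σ n v} := Ideal.mul_le_left
  refine mem_ISL hI (one_mulVec _) (fun j => ?_) det_one fun i j _ _ => ?_
  · with_reducible rfl
  · rw [sub_self]; exact Ideal.zero_mem _

/-- A matrix whose `v`-th row is trivial after setting the variables beyond `v` to one is the
product of an element of `ISL` and a matrix satisfying the invariant of the next stage. -/
theorem exists_eq_mul_inv_succ {v : Fin n} {X : Matrix (Fin n) (Fin n) (R n)} (hX : Good m v X)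
    (hs : X ∈ stabMat (σ n)) (hd : ∃ u ∈ detGroup n m, (u : R n) = X.det)
    (hrow : ∀ j, keep (low n (v + 1)) (X v j) = (1 : Matrix (Fin n) (Fin n) (R n)) v j)
    (hd1 : keep (low n (v + 1)) X.det = 1) :
    ∃ C ∈ ISL n v (Ideal.span {σ n v} * H n m), ∃ Y, Inv m (v + 1) Y ∧ X = C * Y := by
  have hXσ : X *ᵥ σ n = σ n := by
    obtain ⟨U, hU, rfl⟩ := mem_stabMat.1 hs
    exact hU
  have hρv : keep (low n (v + 1)) (σ n v) = σ n v := keep_σ_of_mem (mem_low_self v)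
  have hη : ∀ i j, ∃ h, h ∈ L n m ∧ keep (low n (v + 1)) h = h ∧
      (i ≠ v → j ≠ v → keep (low n (v + 1)) ((X - 1) i j) = σ n v * h) := by
    intro i j
    by_cases hi : i = v
    · exact ⟨0, Ideal.zero_mem _, map_zero _, fun h => absurd hi h⟩
    · by_cases hj : j = v
      · exact ⟨0, Ideal.zero_mem _, map_zero _, fun _ h => absurd hj h⟩
      · obtain ⟨h, hh, hh', he⟩ := hX.minor i j hi hj
        exact ⟨h, hh, hh', fun _ _ => he⟩
  choose η hηL hηρ hηX using hη
  let S : Finset (Fin n) := {v}ᶜ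
  have hS : ∀ {j}, j ∈ S ↔ j ≠ v := by simp [S]
  have hsplit : ∀ f : Fin n → R n, ∑ j, f j = f v + ∑ j ∈ S, f j := fun f => by
    rw [← Finset.sum_compl_add_sum S]
    simp [S]
  -- Off row and column `v` this is the retraction of `X - 1`. Column `v` is then forced by `D σ =
  -- 0`, and it may involve variables beyond `v`.
  let D : Matrix (Fin n) (Fin n) (R n) := of fun i j =>
    if i = v then 0 else if j = v then -∑ k ∈ S, η i k * σ n k else σ n v * η i j
  have hDv : ∀ j, D v j = 0 := fun j => by simp [D]
  have hDiv : ∀ i, i ≠ v → D i v = -∑ k ∈ S, η i k * σ n k := fun i hi => by simp [D, hi]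
  have hDij : ∀ i j, i ≠ v → j ≠ v → D i j = σ n v * η i j := fun i j hi hj => by simp [D, hi, hj]
  have hDσ : D *ᵥ σ n = 0 := by
    ext1 i
    rw [mulVec, dotProduct, Pi.zero_apply]
    by_cases hi : i = v
    · rw [hi]; simp [hDv]
    · rw [hsplit, hDiv i hi, neg_mul, Finset.sum_mul, ← Finset.sum_neg_distrib,
        ← Finset.sum_add_distrib]
      refine Finset.sum_eq_zero fun k hk => ?_
      rw [hDij i k hi (hS.1 hk)]; ring
  have hση : ∀ i j k, σ n k * η i j ∈ N n m (v + 1) := fun i j k => by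
    have := σ_mul_keep_mem_N (k := v + 1) k (hηL i j)
    rwa [hηρ] at this
  have hDN : ∀ i j, D i j ∈ N n m (v + 1) := by
    intro i j
    by_cases hi : i = v
    · rw [hi, hDv]; exact Ideal.zero_mem _
    · by_cases hj : j = v
      · rw [hj, hDiv i hi]
        refine Submodule.neg_mem _ (Ideal.sum_mem _ fun k _ => ?_)
        rw [mul_comm]; exact hση i k k
      · rw [hDij i j hi hj]; exact hση i j v
  have hρD : ∀ i j, keep (low n (v + 1)) (D i j) = keep (low n (v + 1)) ((X - 1) i j) := by
    intro i j
    by_cases hi : i = v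
    · rw [hi, hDv, map_zero, Matrix.sub_apply, map_sub, hrow, keep_one_apply, sub_self]
    · by_cases hj : j = v
      · rw [hj]
        have h1 : ∀ E : Matrix (Fin n) (Fin n) (R n), E *ᵥ σ n = 0 →
            keep (low n (v + 1)) (E i v) * σ n v +
              ∑ k ∈ S, keep (low n (v + 1)) (E i k) * keep (low n (v + 1)) (σ n k) = 0 := by
          intro E hE
          have := congrArg (keep (low n (v + 1))) (congrFun hE i)
          rw [mulVec, dotProduct, hsplit, map_add, map_mul, map_sum, hρv, Pi.zero_apply,
            map_zero] at this
          simpa only [map_mul] using this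
        have h2 := h1 D hDσ
        have h3 := h1 (X - 1) (by rw [sub_mulVec, one_mulVec, hXσ, sub_self])
        have h4 : ∑ k ∈ S, keep (low n (v + 1)) (D i k) * keep (low n (v + 1)) (σ n k) =
            ∑ k ∈ S, keep (low n (v + 1)) ((X - 1) i k) * keep (low n (v + 1)) (σ n k) := by
          refine Finset.sum_congr rfl fun k hk => ?_
          rw [hDij i k hi (hS.1 hk), hηX i k hi (hS.1 hk), map_mul, hρv, hηρ]
        refine mul_right_cancel₀ (σ_ne_zero v) ?_
        linear_combination h2 - h3 - h4
      · rw [hDij i j hi hj, hηX i j hi hj, map_mul, hρv, hηρ]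
  have hCX : (1 + D).map (keep (low n (v + 1))) = X.map (keep (low n (v + 1))) := by
    refine Matrix.ext fun i j => ?_
    rw [map_apply, map_apply, Matrix.add_apply, map_add, hρD, ← map_add, ← Matrix.add_apply,
      add_sub_cancel]
  have hCrow : ∀ j, (1 + D) v j = (1 : Matrix (Fin n) (Fin n) (R n)) v j := fun j => by
    rw [Matrix.add_apply, hDv, add_zero]
  have hCσ : (1 + D) *ᵥ σ n = σ n := by rw [add_mulVec, one_mulVec, hDσ, add_zero]
  -- The determinant equals that of the minor, which involves only the variables up to `v`. It may
  -- therefore be computed after retraction, where `1 + D` agrees with `X`.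
  have hCd : (1 + D).det = 1 := by
    have h1 : minor ((1 + D).map (keep (low n (v + 1)))) v = minor (1 + D) v := by
      refine Matrix.ext fun i j => ?_
      rw [minor, minor, submatrix_apply, submatrix_apply, map_apply, Matrix.add_apply, map_add,
        keep_one_apply, hDij i j i.2 j.2, map_mul, hρv, hηρ]
    rw [det_eq_det_minor hCrow, ← h1, ← det_eq_det_minor, hCX]
    · rw [← hd1, RingHom.map_det]; rfl
    · intro j
      rw [map_apply, hCrow, keep_one_apply]
  have hCunit : IsUnit (1 + D).det := by rw [hCd]; exact isUnit_one
  have hCstab : (1 + D) ∈ stabMat (σ n) :=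
    ⟨(1 + D).nonsingInvUnit hCunit, hCσ, rfl⟩
  have hI : Ideal.span {σ n v} * H n m ≤ Ideal.span {σ n v} := Ideal.mul_le_left
  set B := (1 + D)⁻¹ with hB
  have hCB : (1 + D) * B = 1 := mul_nonsing_inv _ hCunit
  have hBC : B * (1 + D) = 1 := nonsing_inv_mul _ hCunit
  refine ⟨1 + D, mem_ISL hI hCσ hCrow hCd fun i j hi hj => ?_, B * X,
    ⟨fun i j => ?_, ?_, mul_mem (stabMat_of_mul_left hCB hCstab) hs, ?_⟩, ?_⟩
  · rw [add_sub_cancel_left, hDij i j hi hj]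
    exact Ideal.mul_mem_mul (Ideal.mem_span_singleton_self _) (L_le_H (hηL i j))
  · have hsub : ∀ f, (X - 1) i j - f ∈ N n m (v + 1) →
        (B * X - 1) i j - f ∈ N n m (v + 1) := by
      intro f hf
      have h1 : B * X - 1 = (X - 1) - B * D * X := by
        have h2 : B * D = 1 - B := by rw [mul_add, mul_one] at hBC; rw [← hBC]; abel
        rw [h2, sub_mul, one_mul]; abel
      rw [h1, Matrix.sub_apply, sub_right_comm]
      refine Ideal.sub_mem _ hf ?_
      rw [mul_apply]
      refine Ideal.sum_mem _ fun k _ => Ideal.mul_mem_right _ _ ?_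
      rw [mul_apply]
      exact Ideal.sum_mem _ fun l _ => Ideal.mul_mem_left _ _ (hDN l k)
    obtain ⟨f, hf, hf0, hN⟩ := hX.entry i j
    by_cases hi : i = v
    · subst hi
      refine ⟨0, map_zero _, fun _ => rfl, hsub _ ?_⟩
      rw [mul_zero, sub_zero]
      rcases lt_or_ge i j with hj | hj
      · rwa [hf0 (Or.inr hj), mul_zero, sub_zero] at hN
      -- As row `v` of `X - 1` retracts to zero, the retraction of the congruence says that the
      -- exceptional term itself lies in `N`. It can be dropped, as the next stage demands for this
      -- row.
      · have h1 := keep_mem_N (low n (i + 1)) hN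
        rw [map_sub, Matrix.sub_apply, map_sub, hrow, keep_one_apply, sub_self, zero_sub, map_mul,
          map_mul, map_pow, hf, hρv, keep_geom_of_mem (mem_low_of_le hj)] at h1
        have h2 := Ideal.sub_mem _ hN h1
        rwa [sub_neg_eq_add, sub_add_cancel] at h2
    · refine ⟨f, hf, fun h => hf0 (h.imp (fun h => ?_) fun h => ?_), hsub _ hN⟩
      · exact lt_of_le_of_ne (Nat.lt_succ_iff.1 h) hi
      · exact h
  · have h1 : (B * X).map (keep (low n (v + 1))) = 1 := by
      rw [Matrix.map_mul, ← hCX, ← Matrix.map_mul, hBC, Matrix.map_one _ (map_zero _) (map_one _)]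
    intro i j
    have h2 := congrFun (congrFun h1 i) j
    rw [map_apply] at h2
    rw [Matrix.sub_apply, map_sub, h2, keep_one_apply, sub_self]
  · obtain ⟨u, hu, hud⟩ := hd
    refine ⟨u, hu, ?_⟩
    have h1 := congrArg det hCB
    rw [det_mul, hCd, one_mul, det_one] at h1
    rw [hud, det_mul, h1, one_mul]
  · rw [← mul_assoc, hCB, one_mul]

theorem exists_stage (hn : 4 ≤ n) (hm : m ≠ 0) {v : Fin n} {X : Matrix (Fin n) (Fin n) (R n)}
    (hX : Inv m v X) : ∃ P ∈ powMat (σ n) m, ∃ C ∈ ISL n v (Ideal.span {σ n v} * H n m), ∃ Y,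
      Inv m (v + 1) Y ∧ X * P = C * Y := by
  have hXσ : X *ᵥ σ n = σ n := by
    obtain ⟨U, hU, rfl⟩ := mem_stabMat.1 hX.stab
    exact hU
  have hd0 : keep (low n v) X.det = 1 := by
    rw [RingHom.map_det]
    change (X.map (keep (low n v))).det = 1
    rw [map_keep_eq_one hX.keep_eq, det_one]
  obtain ⟨P, hP, hrow, hd1⟩ := exists_adm_row_eq_det_eq_one hn hm hX.good hXσ hX.det hd0
  obtain ⟨u, hu, hud⟩ := hX.det
  obtain ⟨w, hw, hwd⟩ := hP.2.2
  obtain ⟨C, hC, Y, hY, h⟩ := exists_eq_mul_inv_succ (hX.good.mul hP.2.1)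
    (mul_mem hX.stab (powMat_le_stabMat hP.1))
    ⟨u * w, mul_mem hu hw, by rw [Units.val_mul, hud, hwd, det_mul]⟩ hrow hd1
  exact ⟨P, hP.1, C, hC, Y, hY, h⟩

/-- The stages from `k` on are iterated, multiplying by powers on the right while the factors in
`ISL` leave on the left. For `k = n` the retraction is the identity map, so the remaining matrix is
`1`. -/
theorem Inv.exists_mul_mem_prod (hn : 4 ≤ n) (hm : m ≠ 0) {k l : ℕ} (hkl : k + l = n)
    {X : Matrix (Fin n) (Fin n) (R n)} (hX : Inv m k X) : ∃ P ∈ powMat (σ n) m,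
      X * P ∈ ((List.ofFn fun i : Fin n => ISL n i (Ideal.span {σ n i} * H n m)).drop k).prod := by
  induction l generalizing k X with
  | zero =>
    obtain rfl : k = n := by simpa using hkl
    refine ⟨1, one_mem _, ?_⟩
    have hlow : low k k = Finset.univ := by ext i; simp [low]
    have h1 := map_keep_eq_one hX.keep_eq
    have h2 : X = 1 := by
      rw [← h1, hlow]
      refine Matrix.ext fun i j => ?_
      rw [map_apply, keep_univ]
    rw [List.drop_of_length_le (by simp), List.prod_nil, mul_one, h2]
    exact Set.mem_singleton 1
  | succ l ih =>
    have hk : k < n := by omega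
    have hkl' : (k + 1) + l = n := by omega
    obtain ⟨P, hP, C, hC, Y, hY, h⟩ := exists_stage hn hm (v := ⟨k, hk⟩) hX
    obtain ⟨Q, hQ, hYQ⟩ := ih hkl' hY
    refine ⟨P * Q, mul_mem hP hQ, ?_⟩
    rw [List.drop_eq_getElem_cons (by simpa using hk), List.prod_cons, ← mul_assoc, h, mul_assoc]
    refine Set.mul_mem_mul ?_ hYQ
    simpa using hC

theorem one_mem_prod : (1 : Matrix (Fin n) (Fin n) (R n)) ∈
    (List.ofFn fun i : Fin n => ISL n i (Ideal.span {σ n i} * H n m)).prod := by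
  refine List.prod_induction (fun S : Set (Matrix (Fin n) (Fin n) (R n)) => (1 : Matrix _ _ _) ∈ S)
    (fun S T hS hT => ?_) (Set.mem_singleton 1) fun S hS => ?_
  · simpa using Set.mul_mem_mul hS hT
  · obtain ⟨i, rfl⟩ := List.mem_ofFn.1 hS
    exact one_mem_ISL i _

theorem mem_matrices_IAPow_of_mem_powMat {P : Matrix (Fin n) (Fin n) (R n)}
    (hP : P ∈ powMat (σ n) m) : P ∈ matrices (IAPow n m : Set (MulAut (Φ n))) := by
  obtain ⟨U, hU, rfl⟩ := mem_powMat.1 hP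
  exact mem_matrices_IAPow hU

end Factorization

end FreeMetabelian

theorem lemma3p1 (n m : ℕ) (hn : 4 ≤ n) :
    FreeMetabelian.matrices (FreeMetabelian.IG n (m ^ 2) : Set (MulAut (FreeMetabelian.Φ n))) ⊆
      FreeMetabelian.matrices
          (FreeMetabelian.IAPow n m : Set (MulAut (FreeMetabelian.Φ n))) *
        (List.ofFn fun i : Fin n =>
          FreeMetabelian.ISL n i
            (Ideal.span {FreeMetabelian.σ n i} * FreeMetabelian.H n m)).prod := by
  open FreeMetabelian in
  rintro _ ⟨α, hα, rfl⟩
  have hH : ∀ i j, (toMatrix α - 1) i j ∈ H n (m ^ 2) := fun i j => toMatrix_sub_one_mem_H hα i j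
  -- For `m = 0` the ideal `H` is zero and the matrix is the identity. The reduction itself needs
  -- `τ_j` to be nonzerodivisors, hence `m ≠ 0`.
  rcases eq_or_ne m 0 with rfl | hm
  · have h1 : toMatrix α = 1 := by
      refine sub_eq_zero.1 (Matrix.ext fun i j => ?_)
      obtain ⟨a, b, h⟩ := mem_H_iff.1 (hH i j)
      rw [h]
      simp [τ]
    rw [h1]
    exact Set.mem_mul.2 ⟨1, mem_matrices_IAPow_of_mem_powMat (one_mem _), 1, one_mem_prod,
      mul_one 1⟩
  · obtain ⟨A, hA, hAα⟩ := exists_unit_toMatrix hα.1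
    have hstab : toMatrix α ∈ stabMat (σ n) := mem_stabMat.2 ⟨A, hA, hAα⟩
    obtain ⟨P, hP, h⟩ := (inv_zero hstab hH).exists_mul_mem_prod hn hm (zero_add n)
    rw [List.drop_zero] at h
    obtain ⟨U, hU, hUP⟩ := mem_powMat.1 hP
    have hU' : (U⁻¹).val ∈ powMat (σ n) m := ⟨U⁻¹, Subgroup.inv_mem _ hU, rfl⟩
    -- From `A U` in the product of the `ISL`, write `A = (A U⁻¹ A⁻¹) (A U)`. The first factor is
    -- again a product of `m`-th powers by normality.
    refine Set.mem_mul.2 ⟨A.val * (U⁻¹).val * (A⁻¹).val, mem_matrices_IAPow_of_mem_powMat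
      (powMat_of_conj (D := A.val) ⟨A, hA, rfl⟩ hU' ?_), _, h, ?_⟩
    · rw [mul_assoc _ _ A.val, Units.inv_mul, mul_one]
    · rw [← hAα, ← hUP, ← mul_assoc, mul_assoc _ _ A.val, Units.inv_mul, mul_one, mul_assoc,
        Units.inv_mul, mul_one]
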